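/- Let $\mathcal M=(S,s_0,A,P,R,\gamma,\mathrm{AP},L)$ be a finite labeled MDP: finite sets $S,A,\mathrm{AP}$, nonempty sets $A(s)\subseteq A$ of allowed actions, transition probabilities $P(s,a,\cdot)$ for $a\in A(s)$, state rewards $R:S\to\mathbb R$, discount factor $\gamma\in[0,1)$, labels $L:S\to 2^{\mathrm{AP}}$. The return of a path is $G(\rho)=\sum_{t\ge 0}\gamma^tR(\rho[t])$. A finite-memory policy of $\mathcal M$ has a finite set of modes and an initial mode; whenever a state is visited (including $s_0$ at time $0$), it first switches its mode at random, depending on the current mode and the visited state, and then draws an action at random, depending on the new mode and the state. Let $\Pi$ be the set of all finite-memory policies. Let $\psi,\varphi$ be LTL formulas over $\mathrm{AP}$. Let $\mathcal A_\psi$ be a finite safety automaton of $\psi$: it is deterministic, its non-accepting states are absorbing, and a word satisfies $\psi$ iff the run on it stays in the accepting set $B_\psi$. Let $\mathcal A_\varphi$ be a finite limit-deterministic Büchi automaton (LDBA) of $\varphi$: from each state it has exactly one transition for every letter in $2^{\mathrm{AP}}$ and possibly $\varepsilon$-transitions, which consume no letter; it has an accepting component $Q_A$ that contains the accepting set $B_\varphi$,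 is closed under letter transitions and has no outgoing $\varepsilon$-transitions; and a word satisfies $\varphi$ iff some execution on it visits $B_\varphi$ infinitely often. The product MDP $\mathcal M^\times$ has states $\langle s,q_\psi,q_\varphi\rangle$, the initial state formed by the three initial states, and in $\langle s,q_\psi,q_\varphi\rangle$ the actions $a\in A(s)$, which move $s$ according to $P(s,a,\cdot)$ and both automata by the letter $L(s)$, and the actions $\varepsilon_{q'}$ for each $\varepsilon$-successor $q'$ of $q_\varphi$, which change only $q_\varphi$, to $q'$. A product path satisfies $\square B_\psi^\times$ if all its states have $q_\psi\in B_\psi$, and $\square\lozenge B_\varphi^\times$ if infinitely many of its states have $q_\varphi\in B_\varphi$. Its induced path in $\mathcal M$ is obtained by deleting the steps in which an $\varepsilon$-action is taken, and its return $G^\times(\rho^\times)$ is the return of the induced path. Assume that $\mathcal A_\varphi$ is suitable: every $\varepsilon$-transition enters $Q_A$, and $\mathcal A_\varphi$ can be used for quantitative model checking of MDPs, i.e. for every finite MDP $\mathcal N$ labeled over $\mathrm{AP}$ and every finite-memory policy $\pi$ of $\mathcal N$ there is a memoryless policy of the product of $\mathcal N$ with $\mathcal A_\varphi$ whose probability of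 visiting accepting states infinitely often is at least the probability, under $\pi$, that the labels of the path form a word accepted by $\mathcal A_\varphi$. Let $\Pi^\times$ be the set of memoryless, possibly randomized, policies of $\mathcal M^\times$, let $\nu>0$, and put $$\Pi_\psi^\times=\operatorname*{argmax}_{\pi^\times\in\Pi^\times}\Pr_{\pi^\times}(\square B_\psi^\times),\qquad \Pi_{\psi,\varphi}^\times=\operatorname*{argmax}_{\pi^\times\in\Pi_\psi^\times}\Pr_{\pi^\times}(\square\lozenge B_\varphi^\times),$$ $$\Pi_{\psi,\varphi}^{R\nu\times}=\Big\{\pi^\times\in\Pi_{\psi,\varphi}^\times : \sup_{\sigma\in\Pi_{\psi,\varphi}^\times}\mathbb E_\sigma[G^\times]-\mathbb E_{\pi^\times}[G^\times]\le\nu\Big\},$$ and, for the original MDP, $$\Pi_\psi=\operatorname*{argmax}_{\pi\in\Pi}\Pr_\pi(\psi),\qquad \Pi_{\psi,\varphi}=\operatorname*{argmax}_{\pi\in\Pi_\psi}\Pr_\pi(\varphi),\qquad \Pi_{\psi,\varphi}^{R\nu}=\Big\{\pi\in\Pi_{\psi,\varphi}:\sup_{\sigma\in\Pi_{\psi,\varphi}}\mathbb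 E_\sigma[G]-\mathbb E_\pi[G]\le\nu\Big\}.$$ Every $\pi^\times\in\Pi^\times$ induces a finite-memory policy $\pi$ of $\mathcal M$ that uses the automata as its memory: $\pi$ tracks the joint automata state $\langle q_\psi,q_\varphi\rangle$; on a visit to $s$ it draws from $\pi^\times(\langle s,q_\psi,q_\varphi\rangle)$ whether an $\varepsilon$-action is taken and performs the resulting change of $q_\varphi$, then takes an action of $\mathcal M$ drawn from $\pi^\times$ at the resulting product state, conditioned on not being an $\varepsilon$-action, and both automata consume $L(s)$. Then $\Pi_{\psi,\varphi}^{R\nu\times}$ is nonempty, and for every $\pi^\times\in\Pi_{\psi,\varphi}^{R\nu\times}$ the induced policy of $\mathcal M$ belongs to $\Pi_{\psi,\varphi}^{R\nu}$. -/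

import Mathlib

open MeasureTheory ProbabilityTheory Filter

noncomputable section

/-! ### Linear temporal logic -/

/-- LTL formulas over the atomic propositions `AP`. -/
inductive LTL (AP : Type) : Type where
  | tru : LTL AP
  | atom : AP → LTL AP
  | and : LTL AP → LTL AP → LTL AP
  | not : LTL AP → LTL AP
  | next : LTL AP → LTL AP
  | until : LTL AP → LTL AP → LTL AP

/-- Satisfaction of an LTL formula by an infinite word of labels. -/
def LTL.Sat {AP : Type} : LTL AP → (ℕ → Set AP) → Prop
  | .tru, _ => True
  | .atom a, w => a ∈ w 0
  | .and f g, w => f.Sat w ∧ g.Sat w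
  | .not f, w => ¬ f.Sat w
  | .next f, w => f.Sat (fun i => w (i + 1))
  | .until f g, w =>
      ∃ t, g.Sat (fun i => w (i + t)) ∧ ∀ j < t, f.Sat (fun i => w (i + j))

/-! ### Automata -/

/-- A safety automaton: deterministic, with absorbing non-accepting states. -/
structure SafetyAutomaton (Q AP : Type) where
  /-- initial state -/
  init : Q
  /-- transition function -/
  step : Q → Set AP → Q
  /-- accepting states -/
  acc : Set Q
  absorbing : ∀ q, q ∉ acc → ∀ θ, step q θ = q

/-- The state of the automaton after reading the first `t` letters of `w`. -/
def SafetyAutomaton.run {Q AP : Type} (D : SafetyAutomaton Q AP) (w : ℕ → Set AP) : ℕ → Q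
  | 0 => D.init
  | t + 1 => D.step (D.run w t) (w t)

/-- A word is accepted when its run never leaves the accepting states. -/
def SafetyAutomaton.Accepts {Q AP : Type} (D : SafetyAutomaton Q AP) (w : ℕ → Set AP) : Prop :=
  ∀ t, D.run w t ∈ D.acc

/-- `D` is a safety automaton of the formula `ψ`. -/
def SafetyAutomaton.Recognizes {Q AP : Type} (D : SafetyAutomaton Q AP) (ψ : LTL AP) : Prop :=
  ∀ w, D.Accepts w ↔ ψ.Sat w

/-- The one-state safety automaton that accepts every word. -/
def SafetyAutomaton.trivial (AP : Type) : SafetyAutomaton Unit AP where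
  init := ()
  step _ _ := ()
  acc := Set.univ
  absorbing _ _ _ := rfl

/-- A limit-deterministic Büchi automaton. The initial component is the complement of the
accepting component `accComp`. Transitions on letters are deterministic; `eps q` is the set of
`ε`-successors of `q`. -/
structure LDBA (Q AP : Type) where
  /-- initial state -/
  init : Q
  /-- the unique successor on a letter -/
  step : Q → Set AP → Q
  /-- the `ε`-successors -/
  eps : Q → Set Q
  /-- accepting states -/
  acc : Set Q
  /-- the accepting component -/
  accComp : Set Q
  acc_subset : acc ⊆ accComp
  eps_accComp : ∀ q ∈ accComp, eps q = ∅
  step_accComp : ∀ q ∈ accComp, ∀ θ, step q θ ∈ accComp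

/-- Büchi acceptance. In an execution `σ`, step `t` either reads the letter at the current
position `n t` of the word, or follows an `ε`-transition and reads nothing. (An execution that
visits `acc` infinitely often reads the whole word, since no `ε`-transition leaves `accComp`.) -/
def LDBA.Accepts {Q AP : Type} (B : LDBA Q AP) (w : ℕ → Set AP) : Prop :=
  ∃ (σ : ℕ → Q) (n : ℕ → ℕ), σ 0 = B.init ∧ n 0 = 0 ∧
    (∀ t, (σ (t + 1) = B.step (σ t) (w (n t)) ∧ n (t + 1) = n t + 1) ∨
      (σ (t + 1) ∈ B.eps (σ t) ∧ n (t + 1) = n t)) ∧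
    ∃ᶠ t in atTop, σ t ∈ B.acc

/-- `B` is an LDBA of the formula `φ`. -/
def LDBA.Recognizes {Q AP : Type} (B : LDBA Q AP) (φ : LTL AP) : Prop :=
  ∀ w, B.Accepts w ↔ φ.Sat w

/-! ### Markov chains -/

/-- The law on infinite sequences of the Markov chain with the given initial distribution and
one-step transition distributions (every set of states is measurable; sequences carry the
product σ-algebra). -/
def chainMeasure {X : Type} (init : PMF X) (step : X → PMF X) :
    @Measure (ℕ → X) (@MeasurableSpace.pi ℕ (fun _ => X) (fun _ => ⊤)) :=
  letI : MeasurableSpace X := ⊤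
  let K : Kernel X X := ⟨fun x => (step x).toMeasure, measurable_from_top⟩
  haveI : IsMarkovKernel K := ⟨fun x => PMF.toMeasure.isProbabilityMeasure (step x)⟩
  Kernel.trajMeasure (X := fun _ => X) init.toMeasure
    (fun n => K.comap (fun h : (Finset.Iic n → X) => h ⟨n, Finset.mem_Iic.2 le_rfl⟩)
      (measurable_pi_apply _))

/-- The probability of an event under the law of a Markov chain. -/
def chainProb {X : Type} (init : PMF X) (step : X → PMF X) (E : Set (ℕ → X)) : ℝ :=
  letI : MeasurableSpace X := ⊤
  (chainMeasure init step).real E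

/-- The expectation of a real function under the law of a Markov chain. -/
def chainExp {X : Type} (init : PMF X) (step : X → PMF X) (f : (ℕ → X) → ℝ) : ℝ :=
  letI : MeasurableSpace X := ⊤
  ∫ x, f x ∂(chainMeasure init step)

/-! ### Markov decision processes -/

/-- An MDP: initial state, nonempty sets `act s` of allowed actions, transition distributions,
rewards and discount factor. -/
structure MDP (S A : Type) where
  /-- initial state -/
  init : S
  /-- actions allowed in a state -/
  act : S → Set A
  act_nonempty : ∀ s, (act s).Nonempty
  /-- transition probabilities -/
  P : (s : S) → act s → PMF S
  /-- rewards -/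
  R : S → ℝ
  /-- discount factor -/
  γ : ℝ
  γ_nonneg : 0 ≤ γ
  γ_lt_one : γ < 1

/-- An MDP with a labelling of its states by sets of atomic propositions. -/
structure LabeledMDP (S A AP : Type) extends MDP S A where
  /-- labels -/
  L : S → Set AP

/-- The discounted return of a path. -/
def MDP.ret {S A : Type} (M : MDP S A) (ρ : ℕ → S) : ℝ := ∑' t, M.γ ^ t * M.R (ρ t)

/-- A finite-memory policy. On a visit to `s` in mode `m` it first switches to a mode `m'`
drawn from `T m s`, and then takes an action drawn from `choose m' s`. -/
structure FinMemPolicy {S A : Type} (M : MDP S A) where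
  /-- modes -/
  Mode : Type
  finite_mode : Finite Mode
  /-- initial mode -/
  m₀ : Mode
  /-- mode switching probabilities -/
  T : Mode → S → PMF Mode
  /-- action probabilities -/
  choose : Mode → (s : S) → PMF (M.act s)

namespace FinMemPolicy

variable {S A : Type} {M : MDP S A}

/-- Initial distribution of the induced Markov chain; a configuration `(s, m)` consists of the
current state and the mode in which the action at this state is taken. -/
def chainInit (π : FinMemPolicy M) : PMF (S × π.Mode) :=
  (π.T π.m₀ M.init).map (fun m => (M.init, m))

/-- Transitions of the induced Markov chain. -/
def chainStep (π : FinMemPolicy M) (c : S × π.Mode) : PMF (S × π.Mode) :=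
  (π.choose c.2 c.1).bind fun a =>
    (M.P c.1 a).bind fun s' => (π.T c.2 s').map (fun m' => (s', m'))

/-- The probability that the random path of states lies in `E`. -/
def prob (π : FinMemPolicy M) (E : Set (ℕ → S)) : ℝ :=
  chainProb π.chainInit π.chainStep {c | (fun t => (c t).1) ∈ E}

/-- The expected return. -/
def expRet (π : FinMemPolicy M) : ℝ :=
  chainExp π.chainInit π.chainStep (fun c => M.ret (fun t => (c t).1))

end FinMemPolicy

/-- A memoryless, possibly mixed, policy. -/
abbrev MemorylessPolicy {S A : Type} (M : MDP S A) : Type := (s : S) → PMF (M.act s)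

namespace MemorylessPolicy

variable {S A : Type} {M : MDP S A}

/-- First state-action pair under a memoryless policy. -/
def chainInit (π : MemorylessPolicy M) : PMF (Σ s, M.act s) :=
  (π M.init).map (Sigma.mk M.init)

/-- Next state-action pair under a memoryless policy. -/
def chainStep (π : MemorylessPolicy M) (c : Σ s, M.act s) : PMF (Σ s, M.act s) :=
  (M.P c.1 c.2).bind fun s' => (π s').map (Sigma.mk s')

/-- The probability of a set of infinite sequences of state-action pairs. -/
def prob (π : MemorylessPolicy M) (E : Set (ℕ → Σ s, M.act s)) : ℝ :=
  chainProb (chainInit π) (chainStep π) E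

end MemorylessPolicy

/-! ### Product MDP -/

namespace LabeledMDP

variable {S A AP Qs Qb : Type}

/-- The product of a labelled MDP, a safety automaton and an LDBA. The action `Sum.inl a` is the
original action `a`, and `Sum.inr q` is the action `ε_q`, which moves the LDBA to `q`. -/
def product (M : LabeledMDP S A AP) (D : SafetyAutomaton Qs AP) (B : LDBA Qb AP) :
    MDP (S × Qs × Qb) (A ⊕ Qb) where
  init := (M.init, D.init, B.init)
  act x := {b | Sum.elim (fun a => a ∈ M.act x.1) (fun q => q ∈ B.eps x.2.2) b}
  act_nonempty x := (M.act_nonempty x.1).elim fun a ha => ⟨Sum.inl a, ha⟩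
  P x b := match b with
    | ⟨Sum.inl a, h⟩ => (M.P x.1 ⟨a, h⟩).map
        (fun s' => (s', D.step x.2.1 (M.L x.1), B.step x.2.2 (M.L x.1)))
    | ⟨Sum.inr q, _⟩ => PMF.pure (x.1, x.2.1, q)
  R x := M.R x.1
  γ := M.γ
  γ_nonneg := M.γ_nonneg
  γ_lt_one := M.γ_lt_one

variable (M : LabeledMDP S A AP) (D : SafetyAutomaton Qs AP) (B : LDBA Qb AP)

/-- The safety condition: only product states whose safety component accepts are visited. -/
def safeEvent : Set (ℕ → Σ x, (M.product D B).act x) :=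
  {ρ | ∀ t, (ρ t).1.2.1 ∈ D.acc}

/-- The Büchi condition: product states whose LDBA component accepts are visited infinitely
often. -/
def buchiEvent : Set (ℕ → Σ x, (M.product D B).act x) :=
  {ρ | ∃ᶠ t in atTop, (ρ t).1.2.2 ∈ B.acc}

/-- The path of `M` induced by a path of the product: the sequence of the `M`-states in which an
action of `M` is taken. Steps with `ε`-actions are skipped, as they cause no transition
in `M`. -/
def inducedPath (ρ : ℕ → Σ x, (M.product D B).act x) : ℕ → S :=
  fun n => (ρ (Nat.nth (fun t => (ρ t).2.1.isLeft = true) n)).1.1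

/-- Expected return of a product policy, where the return of a product path is the return of the
path of `M` that it induces. -/
def expRetProduct (σ : MemorylessPolicy (M.product D B)) : ℝ :=
  chainExp (MemorylessPolicy.chainInit σ) (MemorylessPolicy.chainStep σ)
    (fun ρ => M.ret (M.inducedPath D B ρ))

variable {M D B}

/-- The law of the LDBA state in which the next action of `M` is taken, when the product policy
`σ` starts in `x`: an `ε`-action moves the LDBA, an action of `M` does not. -/
def resolveEps (σ : MemorylessPolicy (M.product D B)) (x : S × Qs × Qb) : PMF Qb :=
  (σ x).map fun b => Sum.elim (fun _ => x.2.2) (fun q => q) b.1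

/-- Forget that an action is an action of the product (`a₀` replaces `ε`-actions). -/
def toAct {x : S × Qs × Qb} (a₀ : M.act x.1) : (M.product D B).act x → M.act x.1
  | ⟨Sum.inl a, h⟩ => ⟨a, h⟩
  | ⟨Sum.inr _, _⟩ => a₀

open Classical in
/-- The law of the action that `σ` takes in `x`, conditioned on it being an action of `M`
(arbitrary if that has probability zero). -/
def realAct (σ : MemorylessPolicy (M.product D B)) (x : S × Qs × Qb) : PMF (M.act x.1) :=
  let a₀ : M.act x.1 := ⟨(M.act_nonempty x.1).some, (M.act_nonempty x.1).some_mem⟩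
  if h : ∃ b ∈ {b : (M.product D B).act x | b.1.isLeft = true}, b ∈ (σ x).support then
    ((σ x).filter {b | b.1.isLeft = true} h).map (toAct a₀)
  else PMF.pure a₀

/-- The finite-memory policy of `M` induced by a memoryless policy `σ` of the product. A mode
is a pair of joint automata states `(c, n)`. In mode `m` with second component `n`, on a visit
to `s`, the policy
draws the `ε`-action, if any, that `σ` takes in `(s, n)`, which gives the new first component;
the new second component is what the automata move to from there after consuming `L s`. It then
takes the action of `M` that `σ` takes in `s` with the automata in the new first component. -/
def inducedPolicy [Finite Qs] [Finite Qb] (σ : MemorylessPolicy (M.product D B)) :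
    FinMemPolicy M.toMDP where
  Mode := (Qs × Qb) × (Qs × Qb)
  finite_mode := inferInstance
  m₀ := ((D.init, B.init), (D.init, B.init))
  T m s := (resolveEps σ (s, m.2)).map fun q =>
    ((m.2.1, q), (D.step m.2.1 (M.L s), B.step q (M.L s)))
  choose m s := realAct σ (s, m.1)

end LabeledMDP

/-- The automaton can be used for quantitative model checking of MDPs (it is "good for MDPs"):
for every finite labelled MDP, the maximal probability of the Büchi condition in the product with
the automaton is at least (hence equal to) the maximal probability that the labels of the path
form a word accepted by the automaton. -/
def LDBA.GoodForMDPs {Q AP : Type} (B : LDBA Q AP) : Prop :=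
  ∀ (S A : Type) [Finite S] [Finite A] (N : LabeledMDP S A AP) (π : FinMemPolicy N.toMDP),
    ∃ σ : MemorylessPolicy (N.product (SafetyAutomaton.trivial AP) B),
      π.prob {ρ | B.Accepts (fun t => N.L (ρ t))} ≤
        MemorylessPolicy.prob σ (N.buchiEvent (SafetyAutomaton.trivial AP) B)

/-- A suitable LDBA: every `ε`-transition enters the accepting component (so an execution has at
most one), and the automaton can be used for quantitative model checking of MDPs. -/
def LDBA.Suitable {Q AP : Type} (B : LDBA Q AP) : Prop :=
  (∀ q, B.eps q ⊆ B.accComp) ∧ B.GoodForMDPs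

/-! ### Lexicographically optimal policies -/

/-- The maximizers of `f` in `F`. -/
def argmaxOn {α : Type*} (F : Set α) (f : α → ℝ) : Set α := {x ∈ F | ∀ y ∈ F, f y ≤ f x}

/-- The elements of `F` at which `f` is within `ν` of its supremum over `F`. -/
def nearArgmaxOn {α : Type*} (F : Set α) (f : α → ℝ) (ν : ℝ) : Set α :=
  {x ∈ F | sSup (f '' F) - f x ≤ ν}

namespace LabeledMDP

variable {S A AP Qs Qb : Type}

/-- Finite-memory policies maximizing the probability of `ψ`. -/
def safeOpt (M : LabeledMDP S A AP) (ψ : LTL AP) : Set (FinMemPolicy M.toMDP) :=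
  argmaxOn Set.univ fun π => π.prob {ρ | ψ.Sat (fun t => M.L (ρ t))}

/-- Among those, the policies maximizing the probability of `φ`. -/
def ltlOpt (M : LabeledMDP S A AP) (ψ φ : LTL AP) : Set (FinMemPolicy M.toMDP) :=
  argmaxOn (M.safeOpt ψ) fun π => π.prob {ρ | φ.Sat (fun t => M.L (ρ t))}

/-- Among those, the policies whose expected return is `ν`-optimal. -/
def retNearOpt (M : LabeledMDP S A AP) (ψ φ : LTL AP) (ν : ℝ) : Set (FinMemPolicy M.toMDP) :=
  nearArgmaxOn (M.ltlOpt ψ φ) (fun π => π.expRet) ν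

/-- Memoryless product policies maximizing the probability of the safety condition. -/
def safeOptProduct (M : LabeledMDP S A AP) (D : SafetyAutomaton Qs AP) (B : LDBA Qb AP) :
    Set (MemorylessPolicy (M.product D B)) :=
  argmaxOn Set.univ fun σ => MemorylessPolicy.prob σ (M.safeEvent D B)

/-- Among those, the policies maximizing the probability of the Büchi condition. -/
def buchiOptProduct (M : LabeledMDP S A AP) (D : SafetyAutomaton Qs AP) (B : LDBA Qb AP) :
    Set (MemorylessPolicy (M.product D B)) :=
  argmaxOn (M.safeOptProduct D B) fun σ => MemorylessPolicy.prob σ (M.buchiEvent D B)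

/-- Among those, the policies whose expected return is `ν`-optimal. -/
def retNearOptProduct (M : LabeledMDP S A AP) (D : SafetyAutomaton Qs AP) (B : LDBA Qb AP)
    (ν : ℝ) : Set (MemorylessPolicy (M.product D B)) :=
  nearArgmaxOn (M.buchiOptProduct D B) (fun σ => M.expRetProduct D B σ) ν

end LabeledMDP

end

/-! The argument compares both optimization problems with three numbers attached to the initial
product state. Competitors are all finite Markov chains whose states map to state-action pairs and
whose successor states follow the MDP (`Sim`); this covers arbitrary finite memory. V is the best
safety probability; W is the best Büchi probability among chains using only pairs that preserve the
safety value in mean; U is the best return among chains using only those of these pairs that also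
preserve the Büchi value.

Upper bounds (`lexicographic_bounds`): a loss of value in mean can never be recovered, so a chain
attaining a value uses only pairs preserving it (`allowed_simPres`); applied twice, this confines
lexicographically optimal chains to the pairs defining U.

Attainment (`exists_policy_lexicographic`): take a memoryless policy whose support is exactly this
set of pairs. The deficit between value and achieved probability is harmonic along its chain, so by
the maximum principle `Sim.exists_closed_max` a positive deficit would be constant on a closed set.
Inside it lies a closed set where the value is a positive constant, and there the objective holds
almost surely, a contradiction (`safe_eq_simVal`, `buchi_eq_simVal`). For the return, most of the
mass goes to a Bellman-greedy action and the rest is spread over the support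
(`exists_policy_near_simVal`). Keeping the support full, as the Büchi argument requires, is why U is
approached only up to any ε.

Passage to the original MDP: an ε-action enters the accepting component, so a product path contains
at most one, and its induced path arises by deleting one entry. The induced policy reproduces the
law of this path (`chainExp_inducedPolicy`); hence safety probability and return agree, while the
probability of φ is at least the Büchi probability. Conversely, the Markov chain of a finite-memory
policy is an MDP with a single action, to which suitability applies. The resulting resolution of
ε-choices, run alongside the policy, is a chain on the product with the same path law and Büchi
probability at least that of φ (`exists_sim_of_policy`). So policies of the original MDP obey the
same three bounds, and `lexicographic_transfer` concludes. All equalities of path laws come from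
kernels that intertwine two chains (`chainExp_intertwine`). -/

noncomputable section

set_option linter.unusedSectionVars false

/-! ### Path space of a Markov chain -/

/-- The product σ-algebra on sequences, every set of states being measurable. -/
abbrev pathSpace (X : Type) : MeasurableSpace (ℕ → X) :=
  @MeasurableSpace.pi ℕ (fun _ => X) (fun _ => ⊤)

/-- Measurability of a real function of a path. -/
def PathMeasurable {X : Type} (F : (ℕ → X) → ℝ) : Prop := @Measurable _ _ (pathSpace X) _ F

/-- The sequence starting with `x` and continuing with `ρ`. -/
def pathCons {X : Type} (x : X) (ρ : ℕ → X) : ℕ → X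
  | 0 => x
  | n + 1 => ρ n

/-- Sequences whose first `n` entries lie in prescribed sets. -/
def pathBox {X : Type} (n : ℕ) (A : ℕ → Set X) : Set (ℕ → X) := {ρ | ∀ i < n, ρ i ∈ A i}

lemma measurableSet_coord {X : Type} (i : ℕ) (A : Set X) :
    @MeasurableSet _ (pathSpace X) {ρ : ℕ → X | ρ i ∈ A} := by
  let _ : MeasurableSpace X := ⊤
  exact measurable_pi_apply i (MeasurableSpace.measurableSet_top (s := A))

lemma measurableSet_pathBox {X : Type} (n : ℕ) (A : ℕ → Set X) :
    @MeasurableSet _ (pathSpace X) (pathBox n A) := by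
  have : pathBox n A = ⋂ i, ⋂ (_ : i < n), {ρ : ℕ → X | ρ i ∈ A i} := by
    ext ρ; simp [pathBox]
  rw [this]
  exact MeasurableSet.iInter fun i => MeasurableSet.iInter fun _ => measurableSet_coord i (A i)

/-- Boxes are a π-system generating the product σ-algebra, so every identity of path laws reduces to
boxes, where induction on the length is available. -/
lemma measure_ext_pathBox {X : Type} (μ ν : @Measure (ℕ → X) (pathSpace X))
    [IsProbabilityMeasure μ] [IsProbabilityMeasure ν]
    (h : ∀ n A, μ (pathBox n A) = ν (pathBox n A)) : μ = ν := by
  let _ : MeasurableSpace X := ⊤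
  refine ext_of_generate_finite {E | ∃ n A, E = pathBox n A} ?_ ?_ ?_ ?_
  · refine le_antisymm ?_ ?_
    · refine iSup_le fun i => ?_
      rintro _ ⟨A, -, rfl⟩
      have h1 : (fun ρ : ℕ → X => ρ i) ⁻¹' A
          = pathBox (i + 1) (fun j => if j = i then A else Set.univ) := by
        ext ρ
        simp only [Set.mem_preimage, pathBox, Set.mem_ofPred_eq]
        constructor
        · intro h j _
          by_cases hj : j = i
          · subst hj; simpa using h
          · simp [hj]
        · intro h; simpa using h i (Nat.lt_succ_self i)
      exact MeasurableSpace.measurableSet_generateFrom ⟨_, _, h1⟩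
    · refine MeasurableSpace.generateFrom_le ?_
      rintro _ ⟨n, A, rfl⟩
      exact measurableSet_pathBox n A
  · rintro _ ⟨n, A, rfl⟩ _ ⟨m, B, rfl⟩ -
    -- The shorter box imposes nothing beyond its length, hence the guarded conditions.
    refine ⟨max n m, fun i => {x | (i < n → x ∈ A i) ∧ (i < m → x ∈ B i)}, ?_⟩
    ext ρ
    simp only [pathBox, Set.mem_inter_iff, Set.mem_ofPred_eq, lt_max_iff]
    constructor
    · rintro ⟨h1, h2⟩ i -
      exact ⟨h1 i, h2 i⟩
    · intro h
      exact ⟨fun i hi => (h i (Or.inl hi)).1 hi, fun i hi => (h i (Or.inr hi)).2 hi⟩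
  · rintro _ ⟨n, A, rfl⟩
    exact h n A
  · simp

instance chainMeasure_isProb {X : Type} (init : PMF X) (step : X → PMF X) :
    IsProbabilityMeasure (chainMeasure init step) := by
  let _ : MeasurableSpace X := ⊤
  let _ : ∀ _ : ℕ, MeasurableSpace X := fun _ => ⊤
  have _ : IsProbabilityMeasure init.toMeasure := PMF.toMeasure.isProbabilityMeasure init
  unfold chainMeasure
  infer_instance

/-! ### Box probabilities of homogeneous Markov chains. -/

section Traj

variable {X : Type} [MeasurableSpace X] (μ : Measure X) (K : Kernel X X)

/-- The expectation of `g` at time `n`, on the event that the first `n` states lie in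
prescribed sets, as a function of the initial state. -/
def boxExp : ℕ → (ℕ → Set X) → (X → ENNReal) → X → ENNReal
  | 0, _, g => g
  | n + 1, A, g => fun x => (A 0).indicator 1 x * ∫⁻ y, boxExp n (fun i => A (i + 1)) g y ∂K x

/-- The recursion defining `boxExp` peels off the first step, whereas the trajectory measure is
extended at the end; this peels off the last step instead. -/
lemma boxExp_succ (n : ℕ) (A : ℕ → Set X) (g : X → ENNReal) :
    boxExp K (n + 1) A g = boxExp K n A (fun x => (A n).indicator 1 x * ∫⁻ y, g y ∂K x) := by
  induction n generalizing A with
  | zero => rfl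
  | succ n ih =>
    funext x
    rw [boxExp, ih]
    rfl

variable [IsMarkovKernel K]

/-- The law of the Markov chain with initial law `μ` and transition kernel `K`. -/
def homogeneousTraj : Measure (ℕ → X) :=
  Kernel.trajMeasure (X := fun _ => X) μ
    (fun n => K.comap (fun h : (Finset.Iic n → X) => h ⟨n, Finset.mem_Iic.2 le_rfl⟩)
      (measurable_pi_apply _))

lemma homogeneousTraj_map_zero : (homogeneousTraj μ K).map (fun ρ => ρ 0) = μ := by
  have h1 : (fun ρ : ℕ → X => ρ 0) = (fun h : (Finset.Iic 0 → X) => h ⟨0, by simp⟩) ∘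
      Preorder.frestrictLe 0 := rfl
  rw [h1, ← Measure.map_map (by fun_prop) (by fun_prop)]
  unfold homogeneousTraj Kernel.trajMeasure
  rw [Measure.map_comp _ _ (by fun_prop), Kernel.traj_map_frestrictLe, Kernel.partialTraj_self,
    Measure.id_comp, Measure.map_map (by fun_prop) (by fun_prop)]
  convert Measure.map_id
  ext x
  rfl

/-- This is the Markov property, read off from the description of the joint law of the first
coordinates and the next one as a composition-product. -/
lemma lintegral_homogeneousTraj_succ [IsProbabilityMeasure μ] (n : ℕ)
    {G : (Finset.Iic n → X) → ENNReal}
    (hG : Measurable G) {g : X → ENNReal} (hg : Measurable g) :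
    ∫⁻ ρ, G (Preorder.frestrictLe n ρ) * g (ρ (n + 1)) ∂(homogeneousTraj μ K) =
      ∫⁻ ρ, G (Preorder.frestrictLe n ρ) * ∫⁻ y, g y ∂(K (ρ n)) ∂(homogeneousTraj μ K) := by
  have h := Kernel.map_frestrictLe_trajMeasure_compProd_eq_map_trajMeasure (X := fun _ => X)
    (μ₀ := μ) (a := n)
    (κ := fun n => K.comap (fun h : (Finset.Iic n → X) => h ⟨n, Finset.mem_Iic.2 le_rfl⟩)
      (measurable_pi_apply _))
  have hm : Measurable (fun p : (Finset.Iic n → X) × X => G p.1 * g p.2) := by fun_prop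
  have h2 := lintegral_map (μ := homogeneousTraj μ K) hm
    (g := fun x => (Preorder.frestrictLe n x, x (n + 1))) (by fun_prop)
  rw [← h2]
  unfold homogeneousTraj
  rw [← h, Measure.lintegral_compProd hm, lintegral_map]
  · refine lintegral_congr fun ρ => ?_
    rw [Kernel.comap_apply]
    exact lintegral_const_mul (G (Preorder.frestrictLe n ρ)) hg
  · exact hm.lintegral_kernel_prod_right'
  · fun_prop

variable [DiscreteMeasurableSpace X] [IsProbabilityMeasure μ]

/-- The test function `g` is kept general so that in the induction the last transition can be
absorbed into it. -/
lemma lintegral_pathBox_mul (n : ℕ) (A : ℕ → Set X) (g : X → ENNReal) :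
    ∫⁻ ρ, (∏ i ∈ Finset.range n, (A i).indicator 1 (ρ i)) * g (ρ n) ∂(homogeneousTraj μ K) =
      ∫⁻ x, boxExp K n A g x ∂μ := by
  induction n generalizing g with
  | zero =>
    simp only [Finset.range_zero, Finset.prod_empty, one_mul, boxExp]
    conv_rhs => rw [← homogeneousTraj_map_zero μ K]
    rw [lintegral_map (Measurable.of_discrete) (by fun_prop)]
  | succ n ih =>
    rw [boxExp_succ, ← ih]
    have h := lintegral_homogeneousTraj_succ μ K n
      (G := fun h => ∏ i ∈ (Finset.range (n + 1)).attach, (A i).indicator 1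
        (h ⟨i, Finset.mem_Iic.2 (Nat.lt_succ_iff.1 (Finset.mem_range.1 i.2))⟩))
      (Finset.measurable_prod _ fun i _ =>
        (Measurable.of_discrete (f := (A i).indicator (1 : X → ENNReal))).comp
          (measurable_pi_apply _))
      (g := g) Measurable.of_discrete
    have h3 : ∀ ρ : ℕ → X, (∏ i ∈ (Finset.range (n + 1)).attach,
        (A i).indicator (1 : X → ENNReal) (Preorder.frestrictLe n ρ
          ⟨i, Finset.mem_Iic.2 (Nat.lt_succ_iff.1 (Finset.mem_range.1 i.2))⟩)) =
        ∏ i ∈ Finset.range (n + 1), (A i).indicator 1 (ρ i) := fun ρ =>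
      Finset.prod_attach (Finset.range (n + 1))
        (fun i => (A i).indicator (1 : X → ENNReal) (ρ i))
    simp only [h3] at h
    rw [h]
    refine lintegral_congr fun ρ => ?_
    rw [Finset.prod_range_succ, mul_assoc]

lemma homogeneousTraj_pathBox (n : ℕ) (A : ℕ → Set X) :
    homogeneousTraj μ K {ρ | ∀ i < n, ρ i ∈ A i} = ∫⁻ x, boxExp K n A 1 x ∂μ := by
  rw [← lintegral_pathBox_mul]
  have hm : MeasurableSet {ρ : ℕ → X | ∀ i < n, ρ i ∈ A i} := by
    have : {ρ : ℕ → X | ∀ i < n, ρ i ∈ A i} = ⋂ i, ⋂ (_ : i < n), {ρ : ℕ → X | ρ i ∈ A i} := by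
      ext ρ; simp
    rw [this]
    exact MeasurableSet.iInter fun i => MeasurableSet.iInter fun _ =>
      measurable_pi_apply i (MeasurableSet.of_discrete (s := A i))
  rw [← lintegral_indicator_one hm]
  refine lintegral_congr fun ρ => ?_
  rw [Pi.one_apply, mul_one]
  by_cases h : ∀ i < n, ρ i ∈ A i
  · rw [Set.indicator_of_mem (by exact h), Finset.prod_eq_one]
    · rfl
    · intro i hi
      rw [Set.indicator_of_mem (h i (Finset.mem_range.1 hi))]
      rfl
  · rw [Set.indicator_of_notMem (by exact h)]
    push Not at h
    obtain ⟨i, hi, hA⟩ := h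
    exact (Finset.prod_eq_zero (Finset.mem_range.2 hi) (Set.indicator_of_notMem hA _)).symm

end Traj

lemma chainMeasure_pathBox {X : Type} (init : PMF X) (step : X → PMF X) (n : ℕ)
    (A : ℕ → Set X) :
    chainMeasure init step (pathBox n A) =
      ∫⁻ x, @boxExp X ⊤ (@Kernel.mk X X ⊤ ⊤ (fun x => @PMF.toMeasure X ⊤ (step x))
        measurable_from_top) n A 1 x ∂(@PMF.toMeasure X ⊤ init) := by
  let _ : MeasurableSpace X := ⊤
  have _ : IsProbabilityMeasure init.toMeasure := PMF.toMeasure.isProbabilityMeasure init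
  have _ : IsMarkovKernel (Kernel.mk (fun x => (step x).toMeasure) measurable_from_top) :=
    ⟨fun x => PMF.toMeasure.isProbabilityMeasure (step x)⟩
  exact homogeneousTraj_pathBox _ _ n A

lemma measurable_pathCons {X : Type} (x : X) :
    @Measurable _ _ (pathSpace X) (pathSpace X) (pathCons x) := by
  let _ : MeasurableSpace X := ⊤
  refine measurable_pi_lambda _ fun n => ?_
  cases n with
  | zero => exact measurable_const
  | succ n => exact measurable_pi_apply n

/-- First-step analysis; together with `chainMeasure_eq_sum` it is all that is used about chain
measures afterwards, apart from their being probability measures. -/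
lemma chainMeasure_pure {X : Type} (x : X) (step : X → PMF X) :
    chainMeasure (PMF.pure x) step =
      @Measure.map _ _ (pathSpace X) (pathSpace X) (pathCons x)
        (chainMeasure (step x) step) := by
  let _ : MeasurableSpace X := ⊤
  have hc := measurable_pathCons x
  have _ : IsProbabilityMeasure ((chainMeasure (step x) step).map (pathCons x)) :=
    Measure.isProbabilityMeasure_map hc.aemeasurable
  refine measure_ext_pathBox _ _ fun n A => ?_
  rw [Measure.map_apply hc (measurableSet_pathBox n A), chainMeasure_pathBox]
  rw [PMF.toMeasure_pure, lintegral_dirac]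
  cases n with
  | zero => simp [pathBox, boxExp]
  | succ n =>
    have h : pathCons x ⁻¹' pathBox (n + 1) A =
        {ρ | x ∈ A 0 ∧ ρ ∈ pathBox n (fun i => A (i + 1))} := by
      ext ρ
      simp only [pathBox, Set.mem_preimage, Set.mem_ofPred_eq]
      constructor
      · intro h
        exact ⟨h 0 (Nat.succ_pos n), fun i hi => h (i + 1) (Nat.succ_lt_succ hi)⟩
      · rintro ⟨h0, h⟩ i hi
        cases i with
        | zero => exact h0
        | succ i => exact h i (Nat.lt_of_succ_lt_succ hi)
    rw [h, boxExp]
    by_cases hx : x ∈ A 0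
    · simp only [hx, true_and, Set.indicator_of_mem, Pi.one_apply, one_mul]
      exact (chainMeasure_pathBox (step x) step n _).symm
    · simp [hx]

lemma chainMeasure_eq_sum {X : Type} [Fintype X] (init : PMF X) (step : X → PMF X) :
    chainMeasure init step = ∑ x, init x • chainMeasure (PMF.pure x) step := by
  let _ : MeasurableSpace X := ⊤
  have key : ∀ n A, chainMeasure init step (pathBox n A) =
      (∑ x, init x • chainMeasure (PMF.pure x) step) (pathBox n A) := by
    intro n A
    simp only [Measure.coe_finsetSum, Measure.coe_smul, Finset.sum_apply, Pi.smul_apply,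
      smul_eq_mul, chainMeasure_pathBox, PMF.toMeasure_pure, lintegral_dirac]
    rw [lintegral_fintype]
    refine Finset.sum_congr rfl fun x _ => ?_
    rw [PMF.toMeasure_apply_singleton _ _ (measurableSet_singleton x), mul_comm]
  -- The box of length zero is the whole space, so `key` already gives the total mass.
  have _ : IsProbabilityMeasure (∑ x, init x • chainMeasure (PMF.pure x) step) := by
    constructor
    have := key 0 (fun _ => Set.univ)
    simp only [pathBox, Nat.not_lt_zero, IsEmpty.forall_iff, implies_true, Set.ofPred_true,
      measure_univ] at this
    exact this.symm
  exact measure_ext_pathBox _ _ key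

/-! ### Means of probability mass functions on finite types -/

/-- The mean of a real function. -/
def PMF.mean {α : Type} (p : PMF α) (f : α → ℝ) : ℝ := ∑' x, (p x).toReal * f x

namespace PMF

variable {α β : Type} [Finite α] [Finite β]

lemma mean_eq_sum [Fintype α] (p : PMF α) (f : α → ℝ) : p.mean f = ∑ x, (p x).toReal * f x :=
  tsum_fintype _

lemma sum_toReal [Fintype α] (p : PMF α) : ∑ x, (p x).toReal = 1 := by
  rw [← ENNReal.toReal_sum fun x _ => p.apply_ne_top x, ← tsum_fintype (L := .unconditional _),
    p.tsum_coe]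
  rfl

lemma mean_congr (p : PMF α) {f g : α → ℝ} (h : ∀ x ∈ p.support, f x = g x) :
    p.mean f = p.mean g := by
  refine tsum_congr fun x => ?_
  by_cases hx : x ∈ p.support
  · rw [h x hx]
  · rw [(p.apply_eq_zero_iff x).2 hx]; simp

lemma mean_const (p : PMF α) (c : ℝ) : p.mean (fun _ => c) = c := by
  have := Fintype.ofFinite α
  rw [mean_eq_sum, ← Finset.sum_mul, sum_toReal, one_mul]

lemma mean_congr_const (p : PMF α) {f : α → ℝ} {c : ℝ} (h : ∀ x ∈ p.support, f x = c) :
    p.mean f = c := by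
  rw [p.mean_congr h, mean_const]

lemma mean_pure (a : α) (f : α → ℝ) : (pure a).mean f = f a :=
  mean_congr_const _ fun x hx => by rw [(mem_support_pure_iff a x).1 hx]

lemma mean_bind (p : PMF α) (q : α → PMF β) (f : β → ℝ) :
    (p.bind q).mean f = p.mean (fun x => (q x).mean f) := by
  have := Fintype.ofFinite α
  have := Fintype.ofFinite β
  simp only [mean_eq_sum, bind_apply, tsum_fintype, Finset.mul_sum]
  rw [Finset.sum_comm]
  refine Finset.sum_congr rfl fun y _ => ?_
  rw [ENNReal.toReal_sum fun x _ => ENNReal.mul_ne_top (p.apply_ne_top x) ((q x).apply_ne_top y),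
    Finset.sum_mul]
  refine Finset.sum_congr rfl fun x _ => ?_
  rw [ENNReal.toReal_mul, mul_assoc]

lemma mean_map (p : PMF α) (g : α → β) (f : β → ℝ) : (p.map g).mean f = p.mean (f ∘ g) := by
  rw [← bind_pure_comp, mean_bind]
  exact p.mean_congr fun x _ => mean_pure _ _

lemma mean_mono (p : PMF α) {f g : α → ℝ} (h : ∀ x ∈ p.support, f x ≤ g x) :
    p.mean f ≤ p.mean g := by
  have := Fintype.ofFinite α
  simp only [mean_eq_sum]
  refine Finset.sum_le_sum fun x _ => ?_
  by_cases hx : x ∈ p.support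
  · exact mul_le_mul_of_nonneg_left (h x hx) ENNReal.toReal_nonneg
  · rw [(p.apply_eq_zero_iff x).2 hx]; simp

lemma mean_le (p : PMF α) {f : α → ℝ} {c : ℝ} (h : ∀ x ∈ p.support, f x ≤ c) : p.mean f ≤ c :=
  (p.mean_mono h).trans (p.mean_const c).le

lemma mean_sub (p : PMF α) (f g : α → ℝ) :
    p.mean (fun x => f x - g x) = p.mean f - p.mean g := by
  have := Fintype.ofFinite α
  simp only [mean_eq_sum, mul_sub, Finset.sum_sub_distrib]

lemma mean_add (p : PMF α) (f g : α → ℝ) :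
    p.mean (fun x => f x + g x) = p.mean f + p.mean g := by
  have := Fintype.ofFinite α
  simp only [mean_eq_sum, mul_add, Finset.sum_add_distrib]

lemma mean_const_mul (p : PMF α) (c : ℝ) (f : α → ℝ) :
    p.mean (fun x => c * f x) = c * p.mean f := by
  have := Fintype.ofFinite α
  simp only [mean_eq_sum, Finset.mul_sum]
  exact Finset.sum_congr rfl fun x _ => by ring

/-- Weights are positive on the support, so equality of the sums forces equality termwise. Both the
maximum principle and the confinement of optimal chains to value-preserving actions rest on this. -/
lemma eq_of_mean_le (p : PMF α) {f g : α → ℝ} (h : ∀ x ∈ p.support, f x ≤ g x)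
    (hm : p.mean g ≤ p.mean f) : ∀ x ∈ p.support, f x = g x := by
  have := Fintype.ofFinite α
  have h1 : ∀ x ∈ Finset.univ, (p x).toReal * f x ≤ (p x).toReal * g x := fun x _ => by
    by_cases hx : x ∈ p.support
    · exact mul_le_mul_of_nonneg_left (h x hx) ENNReal.toReal_nonneg
    · rw [(p.apply_eq_zero_iff x).2 hx]; simp
  intro x hx
  have h2 := (Finset.sum_eq_sum_iff_of_le h1).1
    (le_antisymm (Finset.sum_le_sum h1) (by simpa only [mean_eq_sum] using hm)) x
    (Finset.mem_univ x)
  exact mul_left_cancel₀ (ENNReal.toReal_ne_zero.2 ⟨(mem_support_iff _ _).1 hx,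
    p.apply_ne_top x⟩) h2

end PMF

/-! ### Expectations of path functions -/

/-- Bounded measurable functions of a path. -/
structure IsPathFun {X : Type} (F : (ℕ → X) → ℝ) : Prop where
  meas : PathMeasurable F
  bdd : ∃ K, ∀ ρ, |F ρ| ≤ K

lemma measurable_path_comp {X Y : Type} (o : X → Y) :
    @Measurable _ _ (pathSpace X) (pathSpace Y) (fun ρ t => o (ρ t)) := by
  let _ : MeasurableSpace X := ⊤
  let _ : MeasurableSpace Y := ⊤
  exact measurable_pi_lambda _ fun n => measurable_from_top.comp (measurable_pi_apply n)

lemma IsPathFun.comp_map {X Y : Type} {F : (ℕ → Y) → ℝ} (hF : IsPathFun F) (o : X → Y) :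
    IsPathFun (fun ρ : ℕ → X => F (fun t => o (ρ t))) :=
  ⟨@Measurable.comp _ _ _ (pathSpace X) (pathSpace Y) _ _ _ hF.meas (measurable_path_comp o),
    hF.bdd.imp fun _ h _ => h _⟩

lemma measurable_path_shift {X : Type} (n : ℕ) :
    @Measurable _ _ (pathSpace X) (pathSpace X) (fun ρ t => ρ (t + n)) := by
  let _ : MeasurableSpace X := ⊤
  exact measurable_pi_lambda _ fun k => measurable_pi_apply (k + n)

/-- Indicator functions of measurable sets of paths. -/
lemma isPathFun_indicator {X : Type} {E : Set (ℕ → X)}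
    (hE : @MeasurableSet _ (pathSpace X) E) : IsPathFun (E.indicator 1 : (ℕ → X) → ℝ) := by
  let _ : MeasurableSpace X := ⊤
  refine ⟨measurable_one.indicator hE, 1, fun ρ => ?_⟩
  by_cases h : ρ ∈ E <;> simp [h]

lemma isPathFun_const {X : Type} (c : ℝ) : IsPathFun (fun _ : ℕ → X => c) :=
  ⟨measurable_const, |c|, fun _ => le_rfl⟩

lemma IsPathFun.integrable {X : Type} {F : (ℕ → X) → ℝ} (hF : IsPathFun F)
    (init : PMF X) (step : X → PMF X) :
    Integrable F (chainMeasure init step) := by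
  obtain ⟨K, hK⟩ := hF.bdd
  exact Integrable.of_bound (Measurable.aestronglyMeasurable hF.meas) K
    (Eventually.of_forall hK)

/-- Sequences that follow transitions of positive probability. -/
def IsRun {X : Type} (step : X → PMF X) (ρ : ℕ → X) : Prop :=
  ∀ t, ρ (t + 1) ∈ (step (ρ t)).support

lemma chainMeasure_eq_zero_of_init {X : Type} [Finite X] {init : PMF X} {step : X → PMF X}
    {E : Set (ℕ → X)} (hE : @MeasurableSet _ (pathSpace X) E)
    (h : ∀ x ∈ init.support, chainMeasure (step x) step (pathCons x ⁻¹' E) = 0) :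
    chainMeasure init step E = 0 := by
  have := Fintype.ofFinite X
  rw [chainMeasure_eq_sum]
  simp only [Measure.coe_finsetSum, Measure.coe_smul, Finset.sum_apply, Pi.smul_apply,
    smul_eq_mul]
  refine Finset.sum_eq_zero fun x _ => ?_
  by_cases hx : x ∈ init.support
  · rw [chainMeasure_pure, Measure.map_apply (measurable_pathCons x) hE, h x hx, mul_zero]
  · rw [(init.apply_eq_zero_iff x).2 hx, zero_mul]

/-- A violation at time n + 1 is one at time n for the shifted path, so induction over all initial
laws works. Afterwards path functions need to be compared only along genuine runs. -/
lemma ae_isRun {X : Type} [Finite X] (init : PMF X) (step : X → PMF X) :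
    ∀ᵐ ρ ∂(chainMeasure init step), ρ 0 ∈ init.support ∧ IsRun step ρ := by
  have h0 : ∀ init : PMF X, chainMeasure init step {ρ | ρ 0 ∈ init.supportᶜ} = 0 := by
    intro init
    refine chainMeasure_eq_zero_of_init (measurableSet_coord 0 _) fun x hx => ?_
    have : pathCons x ⁻¹' {ρ | ρ 0 ∈ init.supportᶜ} = ∅ := by
      ext ρ; simpa [pathCons] using hx
    rw [this, measure_empty]
  have hm : ∀ n, @MeasurableSet _ (pathSpace X)
      {ρ : ℕ → X | ρ (n + 1) ∉ (step (ρ n)).support} := by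
    intro n
    have : {ρ : ℕ → X | ρ (n + 1) ∉ (step (ρ n)).support} =
        ⋃ x, {ρ : ℕ → X | ρ n ∈ ({x} : Set X)} ∩ {ρ | ρ (n + 1) ∈ (step x).supportᶜ} := by
      ext ρ; simp
    rw [this]
    exact MeasurableSet.iUnion fun x => (measurableSet_coord _ _).inter (measurableSet_coord _ _)
  have h1 : ∀ n, ∀ init : PMF X,
      chainMeasure init step {ρ | ρ (n + 1) ∉ (step (ρ n)).support} = 0 := by
    intro n
    induction n with
    | zero => exact fun init => chainMeasure_eq_zero_of_init (hm 0) fun x _ => h0 (step x)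
    | succ n ih => exact fun init => chainMeasure_eq_zero_of_init (hm _) fun x _ => ih (step x)
  refine Filter.Eventually.and ?_ ?_
  · rw [ae_iff]; exact h0 init
  · unfold IsRun
    rw [ae_all_iff]
    intro t
    rw [ae_iff]
    exact h1 t init

section chainExp

variable {X : Type} [Finite X] {init : PMF X} {step : X → PMF X} {F G : (ℕ → X) → ℝ}

lemma chainExp_congr (h : ∀ ρ, ρ 0 ∈ init.support → IsRun step ρ → F ρ = G ρ) :
    chainExp init step F = chainExp init step G :=
  integral_congr_ae ((ae_isRun init step).mono fun ρ hρ => h ρ hρ.1 hρ.2)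

lemma chainExp_mono (hF : IsPathFun F) (hG : IsPathFun G)
    (h : ∀ ρ, ρ 0 ∈ init.support → IsRun step ρ → F ρ ≤ G ρ) :
    chainExp init step F ≤ chainExp init step G :=
  integral_mono_ae (hF.integrable _ _) (hG.integrable _ _)
    ((ae_isRun init step).mono fun ρ hρ => h ρ hρ.1 hρ.2)

lemma chainExp_const (init : PMF X) (step : X → PMF X) (c : ℝ) :
    chainExp init step (fun _ => c) = c := by
  unfold chainExp
  simp

lemma chainExp_add_mul (hF : IsPathFun F) (a b : ℝ) :
    chainExp init step (fun ρ => a + b * F ρ) = a + b * chainExp init step F := by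
  unfold chainExp
  rw [integral_add (integrable_const a) ((hF.integrable init step).const_mul b),
    integral_const_mul]
  simp

lemma chainExp_eq_mean (hF : IsPathFun F) :
    chainExp init step F = init.mean (fun x => chainExp (PMF.pure x) step F) := by
  have := Fintype.ofFinite X
  unfold chainExp
  conv_lhs => rw [chainMeasure_eq_sum]
  rw [PMF.mean_eq_sum, integral_finsetSum_measure]
  · simp only [integral_smul_measure, smul_eq_mul]
  · intro x _
    exact (hF.integrable _ _).smul_measure (init.apply_ne_top x)

lemma chainExp_pure (hF : IsPathFun F) (x : X) :
    chainExp (PMF.pure x) step F = chainExp (step x) step (fun ρ => F (pathCons x ρ)) := by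
  let _ : MeasurableSpace X := ⊤
  unfold chainExp
  rw [chainMeasure_pure]
  exact integral_map (measurable_pathCons x).aemeasurable
    (Measurable.aestronglyMeasurable hF.meas)

lemma chainProb_eq_chainExp {E : Set (ℕ → X)} (hE : @MeasurableSet _ (pathSpace X) E) :
    chainProb init step E = chainExp init step (E.indicator 1) :=
  (integral_indicator_one hE).symm

lemma chainProb_iUnion_eq_zero {E : ℕ → Set (ℕ → X)} (h : ∀ n, chainProb init step (E n) = 0) :
    chainProb init step (⋃ n, E n) = 0 := by
  have : ∀ n, chainMeasure init step (E n) = 0 := fun n =>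
    ((measureReal_eq_zero_iff (measure_ne_top _ _)).1 (h n))
  exact (measureReal_eq_zero_iff (measure_ne_top _ _)).2 (measure_iUnion_null this)

end chainExp

/-! ### Intertwined Markov chains -/

open Classical in
/-- Delete the first entry that lies in `skip`. -/
def dropFirst {Z : Type} (skip : Set Z) (ρ : ℕ → Z) : ℕ → Z :=
  fun n => if ∀ i < n + 1, ρ i ∈ skipᶜ then ρ n else ρ (n + 1)

open Classical in
/-- Move on by one transition from states in `skip`. -/
def skipRes {Z : Type} (skip : Set Z) (step : Z → PMF Z) (z : Z) : PMF Z :=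
  if z ∈ skip then step z else PMF.pure z

/-- One transition of a chain, or two if the first one leads to `skip`. -/
def skipStep {Z : Type} (skip : Set Z) (step : Z → PMF Z) (z : Z) : PMF Z :=
  (step z).bind (skipRes skip step)

lemma measurable_dropFirst {Z : Type} (skip : Set Z) :
    @Measurable _ _ (pathSpace Z) (pathSpace Z) (dropFirst skip) := by
  let _ : MeasurableSpace Z := ⊤
  refine measurable_pi_lambda _ fun n => ?_
  exact Measurable.ite (measurableSet_pathBox (n + 1) fun _ => skipᶜ)
    (measurable_pi_apply _) (measurable_pi_apply _)

lemma dropFirst_eq_self {Z : Type} {skip : Set Z} {ρ : ℕ → Z} (h : ∀ i, ρ i ∉ skip) :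
    dropFirst skip ρ = ρ := by
  funext n
  exact if_pos fun i _ => h i

open Classical in
lemma dropFirst_cons_of_notMem {Z : Type} {skip : Set Z} {z : Z} (hz : z ∉ skip) (ρ : ℕ → Z) :
    dropFirst skip (pathCons z ρ) = pathCons z (dropFirst skip ρ) := by
  funext n
  cases n with
  | zero => simp [dropFirst, pathCons, hz]
  | succ n =>
    have : (∀ i < n + 1 + 1, pathCons z ρ i ∈ skipᶜ) ↔ ∀ i < n + 1, ρ i ∈ skipᶜ := by
      constructor
      · exact fun h i hi => h (i + 1) (Nat.succ_lt_succ hi)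
      · rintro h (_ | i) hi
        · exact hz
        · exact h i (Nat.lt_of_succ_lt_succ hi)
    change (if ∀ i < n + 1 + 1, pathCons z ρ i ∈ skipᶜ then ρ n else ρ (n + 1)) =
      if ∀ i < n + 1, ρ i ∈ skipᶜ then ρ n else ρ (n + 1)
    simp only [this]

lemma dropFirst_cons_of_mem {Z : Type} {skip : Set Z} {z : Z} (hz : z ∈ skip) (ρ : ℕ → Z) :
    dropFirst skip (pathCons z ρ) = ρ := by
  funext n
  exact if_neg fun h => h 0 (Nat.succ_pos n) hz

lemma IsRun.mem_of_closed {Z : Type} {step : Z → PMF Z} {ρ : ℕ → Z} (h : IsRun step ρ)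
    {N : Set Z} (hN : ∀ z ∈ N, ∀ z' ∈ (step z).support, z' ∈ N) (h0 : ρ 0 ∈ N) (t : ℕ) :
    ρ t ∈ N := by
  induction t with
  | zero => exact h0
  | succ t ih => exact hN _ ih _ (h t)

/-- The summand `0` gives the right side the affine form required by `chainExp_add_mul`. -/
lemma indicator_pathBox_succ {O : Type} (n : ℕ) (A : ℕ → Set O) (x : O) (ρ : ℕ → O) :
    (pathBox (n + 1) A).indicator (1 : (ℕ → O) → ℝ) (pathCons x ρ) =
      0 + (A 0).indicator 1 x * (pathBox n (fun i => A (i + 1))).indicator 1 ρ := by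
  have : pathCons x ρ ∈ pathBox (n + 1) A ↔ x ∈ A 0 ∧ ρ ∈ pathBox n (fun i => A (i + 1)) := by
    constructor
    · intro h
      exact ⟨h 0 (Nat.succ_pos n), fun i hi => h (i + 1) (Nat.succ_lt_succ hi)⟩
    · rintro ⟨h0, h⟩ (_ | i) hi
      · exact h0
      · exact h i (Nat.lt_of_succ_lt_succ hi)
  by_cases h1 : x ∈ A 0 <;> by_cases h2 : ρ ∈ pathBox n (fun i => A (i + 1)) <;>
    simp [this, h1, h2]

lemma map_comp_pathCons {X O : Type} (o : X → O) (x : X) (ρ : ℕ → X) :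
    (fun t => o (pathCons x ρ t)) = pathCons (o x) (fun t => o (ρ t)) := by
  funext t
  cases t <;> rfl

lemma IsPathFun.comp_dropFirst {Z : Type} {F : (ℕ → Z) → ℝ} (hF : IsPathFun F) (skip : Set Z) :
    IsPathFun (fun ρ => F (dropFirst skip ρ)) :=
  ⟨@Measurable.comp _ _ _ (pathSpace Z) (pathSpace Z) _ _ _ hF.meas (measurable_dropFirst skip),
    hF.bdd.imp fun _ h _ => h _⟩

/-- If two families of path laws give the same expectation to all indicators of boxes, they give
the same expectation to all path functions. -/
lemma chainExp_eq_of_pathBox {W Z O : Type} {initW : PMF W} {stepW : W → PMF W}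
    {initZ : PMF Z} {stepZ : Z → PMF Z} {f : (ℕ → W) → ℕ → O} {g : (ℕ → Z) → ℕ → O}
    (hf : @Measurable _ _ (pathSpace W) (pathSpace O) f)
    (hg : @Measurable _ _ (pathSpace Z) (pathSpace O) g)
    (h : ∀ n A, chainExp initW stepW (fun ρ => (pathBox n A).indicator 1 (f ρ)) =
      chainExp initZ stepZ (fun ρ => (pathBox n A).indicator 1 (g ρ)))
    {F : (ℕ → O) → ℝ} (hF : IsPathFun F) :
    chainExp initW stepW (fun ρ => F (f ρ)) = chainExp initZ stepZ (fun ρ => F (g ρ)) := by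
  let _ : MeasurableSpace W := ⊤
  let _ : MeasurableSpace Z := ⊤
  let _ : MeasurableSpace O := ⊤
  have h1 : ∀ {G : (ℕ → O) → ℝ}, IsPathFun G → chainExp initW stepW (fun ρ => G (f ρ)) =
      ∫ ρ, G ρ ∂((chainMeasure initW stepW).map f) := fun hG =>
    (integral_map hf.aemeasurable (Measurable.aestronglyMeasurable hG.meas)).symm
  have h2 : ∀ {G : (ℕ → O) → ℝ}, IsPathFun G → chainExp initZ stepZ (fun ρ => G (g ρ)) =
      ∫ ρ, G ρ ∂((chainMeasure initZ stepZ).map g) := fun hG =>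
    (integral_map hg.aemeasurable (Measurable.aestronglyMeasurable hG.meas)).symm
  have _ : IsProbabilityMeasure ((chainMeasure initW stepW).map f) :=
    Measure.isProbabilityMeasure_map hf.aemeasurable
  have _ : IsProbabilityMeasure ((chainMeasure initZ stepZ).map g) :=
    Measure.isProbabilityMeasure_map hg.aemeasurable
  have key : (chainMeasure initW stepW).map f = (chainMeasure initZ stepZ).map g := by
    refine measure_ext_pathBox _ _ fun n A => ?_
    have hb := isPathFun_indicator (measurableSet_pathBox n A)
    have h3 := h n A
    rw [h1 hb, h2 hb, integral_indicator_one (measurableSet_pathBox n A),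
      integral_indicator_one (measurableSet_pathBox n A)] at h3
    exact (measureReal_eq_measureReal_iff (measure_ne_top _ _) (measure_ne_top _ _)).1 h3
  rw [h1 hF, h2 hF, key]

/-- Skipping an initial state in `skip` does not change the law of the paths without their first
state in `skip`. -/
lemma chainExp_skipRes {Z : Type} [Finite Z] {stepZ : Z → PMF Z} (skip N : Set Z)
    (hN : ∀ z ∈ N, ∀ z' ∈ (stepZ z).support, z' ∈ N) (hNskip : ∀ z ∈ N, z ∉ skip)
    (hskip : ∀ z ∈ skip, ∀ z' ∈ (stepZ z).support, z' ∈ N) (init : PMF Z)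
    {F : (ℕ → Z) → ℝ} (hF : IsPathFun F) :
    chainExp (init.bind (skipRes skip stepZ)) stepZ (fun ρ => F (dropFirst skip ρ)) =
      chainExp init stepZ (fun ρ => F (dropFirst skip ρ)) := by
  have hF' := hF.comp_dropFirst skip
  rw [chainExp_eq_mean hF', chainExp_eq_mean (init := init) hF', PMF.mean_bind]
  refine init.mean_congr fun z _ => ?_
  unfold skipRes
  by_cases hz : z ∈ skip
  · rw [if_pos hz, chainExp_pure hF', ← chainExp_eq_mean hF']
    refine chainExp_congr fun ρ h0 hρ => ?_
    rw [dropFirst_cons_of_mem hz, dropFirst_eq_self]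
    -- After leaving `skip` the path stays in `N`, so nothing further is deleted.
    exact fun t => hNskip _ (hρ.mem_of_closed hN (hskip z hz _ h0) t)
  · rw [if_neg hz, PMF.mean_pure]

/-- The kernel `Λ` refines a state of the first chain to a random state of the second with the same
observation. By `hstep`, refining and then moving equals moving and then refining, so box
probabilities agree by induction on the length. A move of the second chain may pass through one
skipped state, which is then deleted; the closed set `N` ensures that this happens at most once per
path. -/
theorem chainExp_intertwine {W Z O : Type} [Finite W] [Finite Z] {stepW : W → PMF W}
    {stepZ : Z → PMF Z} (oW : W → O) (oZ : Z → O) (skip N : Set Z)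
    (hN : ∀ z ∈ N, ∀ z' ∈ (stepZ z).support, z' ∈ N) (hNskip : ∀ z ∈ N, z ∉ skip)
    (hskip : ∀ z ∈ skip, ∀ z' ∈ (stepZ z).support, z' ∈ N) (Λ : W → PMF Z)
    (hΛ : ∀ w, ∀ z ∈ (Λ w).support, z ∉ skip ∧ oZ z = oW w)
    (hstep : ∀ w, (Λ w).bind (skipStep skip stepZ) = (stepW w).bind Λ)
    (initW : PMF W) {F : (ℕ → O) → ℝ} (hF : IsPathFun F) :
    chainExp initW stepW (fun ρ => F (fun t => oW (ρ t))) =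
      chainExp (initW.bind Λ) stepZ (fun ρ => F (fun t => oZ (dropFirst skip ρ t))) := by
  have hbox := fun n (A : ℕ → Set O) => isPathFun_indicator (measurableSet_pathBox n A)
  have hZ : ∀ {G : (ℕ → O) → ℝ}, IsPathFun G →
      IsPathFun (fun ρ : ℕ → Z => G (fun t => oZ (dropFirst skip ρ t))) := fun hG =>
    (hG.comp_map oZ).comp_dropFirst skip
  have key : ∀ n (A : ℕ → Set O) w,
      chainExp (PMF.pure w) stepW (fun ρ => (pathBox n A).indicator 1 (fun t => oW (ρ t))) =
      chainExp (Λ w) stepZ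
        (fun ρ => (pathBox n A).indicator 1 (fun t => oZ (dropFirst skip ρ t))) := by
    intro n
    induction n with
    | zero =>
      intro A w
      have : ∀ ρ : ℕ → O, (pathBox 0 A).indicator (1 : (ℕ → O) → ℝ) ρ = 1 := fun ρ =>
        Set.indicator_of_mem (show ρ ∈ pathBox 0 A from fun i hi => absurd hi (Nat.not_lt_zero i)) _
      simp only [this, chainExp_const]
    | succ n ih =>
      intro A w
      have hb := hbox n (fun i => A (i + 1))
      rw [chainExp_pure ((hbox _ A).comp_map oW)]
      simp only [map_comp_pathCons, indicator_pathBox_succ]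
      rw [chainExp_add_mul (hb.comp_map oW), chainExp_eq_mean (hb.comp_map oW),
        (stepW w).mean_congr fun w' _ => ih _ w', zero_add]
      have h1 : ∀ z ∈ (Λ w).support, chainExp (PMF.pure z) stepZ
          (fun ρ => (pathBox (n + 1) A).indicator 1 (fun t => oZ (dropFirst skip ρ t))) =
          (A 0).indicator 1 (oW w) * (skipStep skip stepZ z).mean (fun z' =>
            chainExp (PMF.pure z') stepZ (fun ρ =>
              (pathBox n (fun i => A (i + 1))).indicator 1
                (fun t => oZ (dropFirst skip ρ t)))) := by
        intro z hz
        rw [chainExp_pure (hZ (hbox _ A))]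
        simp only [dropFirst_cons_of_notMem (hΛ w z hz).1, map_comp_pathCons,
          indicator_pathBox_succ]
        rw [chainExp_add_mul (hZ hb), zero_add, (hΛ w z hz).2, chainExp_eq_mean (hZ hb),
          skipStep, PMF.mean_bind]
        congr 1
        rw [← PMF.mean_bind, ← chainExp_eq_mean (hZ hb), ← chainExp_eq_mean (hZ hb)]
        -- The path after deletion has the same law whether or not a skipped state is passed at
        -- once; this turns `step` into `skipStep`, to which `hstep` applies.
        exact (chainExp_skipRes skip N hN hNskip hskip _ (hb.comp_map oZ)).symm
      rw [chainExp_eq_mean (hZ (hbox _ A)), (Λ w).mean_congr h1, PMF.mean_const_mul,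
        ← PMF.mean_bind, hstep, PMF.mean_bind]
      congr 1
      exact (stepW w).mean_congr fun w' _ => chainExp_eq_mean (hZ hb)
  have hm : @Measurable _ _ (pathSpace Z) (pathSpace O)
      (fun ρ t => oZ (dropFirst skip ρ t)) :=
    @Measurable.comp _ _ _ (pathSpace Z) (pathSpace Z) (pathSpace O) _ _
      (measurable_path_comp oZ) (measurable_dropFirst skip)
  rw [chainExp_eq_mean (hF.comp_map oW), chainExp_eq_mean (hZ hF), PMF.mean_bind]
  refine initW.mean_congr fun w _ => ?_
  rw [← chainExp_eq_mean (hZ hF)]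
  exact chainExp_eq_of_pathBox (measurable_path_comp oW) hm (fun n A => key n A w) hF

/-- The case of `chainExp_intertwine` in which no state is skipped. -/
theorem chainExp_intertwine' {W Z O : Type} [Finite W] [Finite Z] {stepW : W → PMF W}
    {stepZ : Z → PMF Z} (oW : W → O) (oZ : Z → O) (Λ : W → PMF Z)
    (hΛ : ∀ w, ∀ z ∈ (Λ w).support, oZ z = oW w)
    (hstep : ∀ w, (Λ w).bind stepZ = (stepW w).bind Λ)
    (initW : PMF W) {F : (ℕ → O) → ℝ} (hF : IsPathFun F) :
    chainExp initW stepW (fun ρ => F (fun t => oW (ρ t))) =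
      chainExp (initW.bind Λ) stepZ (fun ρ => F (fun t => oZ (ρ t))) := by
  have h := chainExp_intertwine oW oZ ∅ Set.univ (by simp) (by simp) (by simp) Λ
    (fun w z hz => ⟨by simp, hΛ w z hz⟩) (stepW := stepW) (stepZ := stepZ)
    (fun w => by
      have h1 : skipRes ∅ stepZ = PMF.pure := by funext z; simp [skipRes]
      have : skipStep ∅ stepZ = stepZ := by funext z; rw [skipStep, h1, PMF.bind_pure]
      rw [this, hstep]) initW hF
  simpa only [dropFirst_eq_self (fun i => Set.notMem_empty _)] using h

/-! ### Chains that simulate a Markov decision process -/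

section Sim

variable {S A : Type} {M : MDP S A}

/-- State-action sequences that follow transitions of positive probability. -/
def MDP.IsPath (M : MDP S A) (ρ : ℕ → Σ s, M.act s) : Prop :=
  ∀ t, (ρ (t + 1)).1 ∈ (M.P (ρ t).1 (ρ t).2).support

/-- A finite Markov chain whose states are mapped to state-action pairs of `M` in such a way that
the states of `M` evolve according to the transition probabilities of `M`. -/
structure Sim (M : MDP S A) where
  /-- states of the chain -/
  Z : Type
  finite : Finite Z
  /-- transitions of the chain -/
  step : Z → PMF Z
  /-- the state-action pair of `M` -/
  f : Z → Σ s, M.act s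
  compat : ∀ z, (step z).map (fun z' => (f z').1) = M.P (f z).1 (f z).2

namespace Sim

instance (C : Sim M) : Finite C.Z := C.finite

/-- The expectation of a function of the sequence of state-action pairs. -/
def E (C : Sim M) (F : (ℕ → Σ s, M.act s) → ℝ) (z : C.Z) : ℝ :=
  chainExp (PMF.pure z) C.step (fun ρ => F (fun t => C.f (ρ t)))

/-- Reachability with positive probability. -/
def Reach (C : Sim M) : C.Z → C.Z → Prop :=
  Relation.ReflTransGen (fun z z' => z' ∈ (C.step z).support)

/-- Only state-action pairs in `Act` occur along runs from `z`. -/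
def Allowed (C : Sim M) (Act : Set (Σ s, M.act s)) (z : C.Z) : Prop :=
  ∀ z', C.Reach z z' → C.f z' ∈ Act

/-- Sets of states that the chain cannot leave. -/
def Closed (C : Sim M) (N : Set C.Z) : Prop := ∀ z ∈ N, ∀ z' ∈ (C.step z).support, z' ∈ N

lemma closed_reach (C : Sim M) (z : C.Z) : C.Closed {z' | C.Reach z z'} :=
  fun _ h _ h' => Relation.ReflTransGen.tail h h'

lemma Closed.reach {C : Sim M} {N : Set C.Z} (hN : C.Closed N) {z z' : C.Z} (hz : z ∈ N)
    (h : C.Reach z z') : z' ∈ N := by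
  induction h with
  | refl => exact hz
  | tail _ h ih => exact hN _ ih _ h

lemma Allowed.of_reach {C : Sim M} {Act : Set (Σ s, M.act s)} {z z' : C.Z}
    (h : C.Allowed Act z) (hz : C.Reach z z') : C.Allowed Act z' :=
  fun _ h' => h _ (Relation.ReflTransGen.trans hz h')

lemma fst_mem_support (C : Sim M) {z z' : C.Z} (h : z' ∈ (C.step z).support) :
    (C.f z').1 ∈ (M.P (C.f z).1 (C.f z).2).support := by
  rw [← C.compat z, PMF.mem_support_map_iff]
  exact ⟨z', h, rfl⟩

lemma isPath_of_isRun (C : Sim M) {ρ : ℕ → C.Z} (h : IsRun C.step ρ) :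
    M.IsPath (fun t => C.f (ρ t)) := fun t => C.fst_mem_support (h t)

lemma mean_state (C : Sim M) [Finite S] (z : C.Z) (h : S → ℝ) :
    (C.step z).mean (fun z' => h (C.f z').1) = (M.P (C.f z).1 (C.f z).2).mean h := by
  rw [← C.compat z, PMF.mean_map]
  rfl

end Sim

/-- Path functions that satisfy a one-step recursion with rewards `r` and discount factors `g`. -/
structure MDP.IsObjective (M : MDP S A) (r g : (Σ s, M.act s) → ℝ)
    (F : (ℕ → Σ s, M.act s) → ℝ) : Prop extends IsPathFun F where
  recursion : ∀ ρ, M.IsPath ρ → F ρ = r (ρ 0) + g (ρ 0) * F (fun t => ρ (t + 1))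

namespace Sim

variable {C : Sim M} {F G : (ℕ → Σ s, M.act s) → ℝ}

lemma E_congr {z : C.Z}
    (h : ∀ ρ : ℕ → C.Z, ρ 0 = z → IsRun C.step ρ →
      F (fun t => C.f (ρ t)) = G (fun t => C.f (ρ t))) : C.E F z = C.E G z :=
  chainExp_congr fun ρ h0 hρ => h ρ ((PMF.mem_support_pure_iff _ _).1 h0) hρ

lemma E_congr_const {z : C.Z} {c : ℝ}
    (h : ∀ ρ : ℕ → C.Z, ρ 0 = z → IsRun C.step ρ → F (fun t => C.f (ρ t)) = c) :
    C.E F z = c :=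
  (E_congr (G := fun _ => c) h).trans (chainExp_const _ _ c)

lemma abs_E_le (hF : IsPathFun F) {K : ℝ} (hK : ∀ ρ, |F ρ| ≤ K) (z : C.Z) :
    |C.E F z| ≤ K := by
  rw [abs_le]
  constructor
  · refine (chainExp_const (PMF.pure z) C.step (-K)).symm.le.trans ?_
    exact chainExp_mono (isPathFun_const _) (hF.comp_map C.f)
      fun ρ _ _ => (abs_le.1 (hK _)).1
  · refine le_trans ?_ (chainExp_const (PMF.pure z) C.step K).le
    exact chainExp_mono (hF.comp_map C.f) (isPathFun_const _)
      fun ρ _ _ => (abs_le.1 (hK _)).2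

lemma E_nonneg (hF : IsPathFun F) (h : ∀ ρ, 0 ≤ F ρ) (z : C.Z) : 0 ≤ C.E F z := by
  refine (chainExp_const (PMF.pure z) C.step 0).symm.le.trans ?_
  exact chainExp_mono (isPathFun_const _) (hF.comp_map C.f) fun ρ _ _ => h _

/-- The recursion is assumed only along paths of the MDP, so the starting point is put back in front
of the run before it is invoked. -/
lemma E_step {r g : (Σ s, M.act s) → ℝ} (hF : M.IsObjective r g F) (z : C.Z) :
    C.E F z = r (C.f z) + g (C.f z) * (C.step z).mean (C.E F) := by
  have h1 := hF.toIsPathFun.comp_map C.f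
  unfold E
  rw [chainExp_pure h1, ← chainExp_eq_mean h1, ← chainExp_add_mul h1]
  refine chainExp_congr fun ρ h0 hρ => ?_
  have hrun : IsRun C.step (pathCons z ρ) := by
    rintro (_ | t)
    · exact h0
    · exact hρ t
  exact hF.recursion _ (C.isPath_of_isRun hrun)

/-- A positive function that is subharmonic where it is positive attains a positive maximum on a
closed set. -/
lemma exists_closed_max {N : Set C.Z} {d : C.Z → ℝ}
    (h : ∀ z ∈ N, 0 < d z → d z ≤ (C.step z).mean d ∧ ∀ z' ∈ (C.step z).support, z' ∈ N)
    {z₀ : C.Z} (hz₀ : z₀ ∈ N) (hd : 0 < d z₀) :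
    ∃ N' ⊆ N, N'.Nonempty ∧ C.Closed N' ∧ ∃ m, 0 < m ∧ ∀ z ∈ N', d z = m := by
  obtain ⟨z₁, hz₁, hmax⟩ := Set.exists_max_image N d (Set.toFinite N) ⟨z₀, hz₀⟩
  have hpos : 0 < d z₁ := hd.trans_le (hmax z₀ hz₀)
  refine ⟨{z ∈ N | d z = d z₁}, fun z hz => hz.1, ⟨z₁, hz₁, rfl⟩, ?_, d z₁, hpos,
    fun z hz => hz.2⟩
  rintro z ⟨hzN, hz⟩ z' hz'
  obtain ⟨h1, h2⟩ := h z hzN (hz ▸ hpos)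
  refine ⟨h2 z' hz', ?_⟩
  -- At a maximum the mean over successors is at least the maximum, so every successor attains it;
  -- hence the set of maximizers is closed.
  refine (C.step z).eq_of_mean_le (g := fun _ => d z₁) (fun y hy => hmax y (h2 y hy)) ?_ z' hz'
  rw [PMF.mean_const, ← hz]
  exact h1

end Sim

/-! ### Values -/

/-- The expectations of `F` that chains restricted to `Act` achieve from a state. -/
def simValues (Act : Set (Σ s, M.act s)) (F : (ℕ → Σ s, M.act s) → ℝ) (s : S) : Set ℝ :=
  {v | ∃ (C : Sim M) (z : C.Z), C.Allowed Act z ∧ (C.f z).1 = s ∧ C.E F z = v}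

/-- The optimal expectation of `F` for chains restricted to `Act`. -/
def simVal (Act : Set (Σ s, M.act s)) (F : (ℕ → Σ s, M.act s) → ℝ) (s : S) : ℝ :=
  sSup (simValues Act F s)

/-- The state-action pairs in `Act` that preserve the value. -/
def simPres (Act : Set (Σ s, M.act s)) (F : (ℕ → Σ s, M.act s) → ℝ) : Set (Σ s, M.act s) :=
  {c ∈ Act | (M.P c.1 c.2).mean (simVal Act F) = simVal Act F c.1}

/-- The chain of a memoryless policy. -/
def memSim [Finite S] [Finite A] (σ : MemorylessPolicy M) : Sim M where
  Z := Σ s, M.act s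
  finite := inferInstance
  step := MemorylessPolicy.chainStep σ
  f := id
  compat c := by
    unfold MemorylessPolicy.chainStep
    rw [PMF.map_bind]
    simp only [PMF.map_comp]
    change _ = M.P c.1 c.2
    conv_rhs => rw [← PMF.bind_pure (M.P c.1 c.2)]
    refine congrArg _ (funext fun s' => ?_)
    exact PMF.map_const _ _

variable {Act : Set (Σ s, M.act s)} {F : (ℕ → Σ s, M.act s) → ℝ}

lemma mem_chainStep_support (σ : MemorylessPolicy M) (c c' : Σ s, M.act s) :
    c' ∈ (MemorylessPolicy.chainStep σ c).support ↔
      c'.1 ∈ (M.P c.1 c.2).support ∧ c'.2 ∈ (σ c'.1).support := by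
  unfold MemorylessPolicy.chainStep
  simp only [PMF.mem_support_bind_iff, PMF.mem_support_map_iff]
  constructor
  · rintro ⟨s', hs', b, hb, rfl⟩
    exact ⟨hs', hb⟩
  · rintro ⟨h1, h2⟩
    exact ⟨c'.1, h1, c'.2, h2, rfl⟩

lemma memSim_allowed [Finite S] [Finite A] {σ : MemorylessPolicy M}
    (hσ : ∀ s, ∀ b ∈ (σ s).support, (⟨s, b⟩ : Σ s, M.act s) ∈ Act) {c : Σ s, M.act s}
    (hc : c ∈ Act) : (memSim σ).Allowed Act c := by
  intro c' h
  refine Sim.Closed.reach (N := Act) (C := memSim σ) ?_ hc h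
  exact fun c _ c' h => hσ _ _ ((mem_chainStep_support σ c c').1 h).2

lemma bddAbove_simValues (hF : IsPathFun F) (s : S) : BddAbove (simValues Act F s) := by
  obtain ⟨K, hK⟩ := hF.bdd
  refine ⟨K, ?_⟩
  rintro _ ⟨C, z, -, -, rfl⟩
  exact (abs_le.1 (Sim.abs_E_le hF hK z)).2

lemma E_le_simVal (hF : IsPathFun F) {C : Sim M} {z : C.Z} (hz : C.Allowed Act z) :
    C.E F z ≤ simVal Act F (C.f z).1 :=
  le_csSup (bddAbove_simValues hF _) ⟨C, z, hz, rfl, rfl⟩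

section Finite

variable [Finite S] [Finite A]

lemma simValues_nonempty (hAct : ∀ s, ∃ b, (⟨s, b⟩ : Σ s, M.act s) ∈ Act) (s : S) :
    (simValues Act F s).Nonempty := by
  choose b hb using hAct
  refine ⟨_, memSim (fun s => PMF.pure (b s)), ⟨s, b s⟩, memSim_allowed ?_ (hb s), rfl, rfl⟩
  intro s b' hb'
  rw [(PMF.mem_support_pure_iff _ _).1 hb']
  exact hb s

lemma simVal_le_one (hAct : ∀ s, ∃ b, (⟨s, b⟩ : Σ s, M.act s) ∈ Act) (hF : IsPathFun F)
    (h : ∀ ρ, |F ρ| ≤ 1) (s : S) : simVal Act F s ≤ 1 := by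
  refine csSup_le (simValues_nonempty hAct s) ?_
  rintro _ ⟨C, z, -, -, rfl⟩
  exact (abs_le.1 (Sim.abs_E_le hF h z)).2

lemma simVal_nonneg (hAct : ∀ s, ∃ b, (⟨s, b⟩ : Σ s, M.act s) ∈ Act) (hF : IsPathFun F)
    (h : ∀ ρ, 0 ≤ F ρ) (s : S) : 0 ≤ simVal Act F s := by
  obtain ⟨_, C, z, hz, rfl, rfl⟩ := simValues_nonempty (F := F) hAct s
  exact (Sim.E_nonneg hF h z).trans (E_le_simVal hF hz)

/-- The Bellman inequality: some action achieves at least the optimal value. -/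
lemma exists_simVal_le (hAct : ∀ s, ∃ b, (⟨s, b⟩ : Σ s, M.act s) ∈ Act)
    {r g : (Σ s, M.act s) → ℝ} (hg : ∀ c, 0 ≤ g c) (hF : M.IsObjective r g F) (s : S) :
    ∃ b, (⟨s, b⟩ : Σ s, M.act s) ∈ Act ∧
      simVal Act F s ≤ r ⟨s, b⟩ + g ⟨s, b⟩ * (M.P s b).mean (simVal Act F) := by
  -- The witness maximizes the one-step lookahead, which bounds every competing chain because a
  -- chain starts with some allowed pair.
  obtain ⟨b, hb, hmax⟩ := Set.exists_max_image {b | (⟨s, b⟩ : Σ s, M.act s) ∈ Act}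
    (fun b => r ⟨s, b⟩ + g ⟨s, b⟩ * (M.P s b).mean (simVal Act F)) (Set.toFinite _) (hAct s)
  refine ⟨b, hb, csSup_le (simValues_nonempty hAct s) ?_⟩
  rintro _ ⟨C, z, hz, rfl, rfl⟩
  refine le_trans ?_ (hmax (C.f z).2 (hz z Relation.ReflTransGen.refl))
  rw [Sim.E_step hF, ← C.mean_state z]
  refine add_le_add le_rfl (mul_le_mul_of_nonneg_left ?_ (hg _))
  exact PMF.mean_mono _ fun z' hz' =>
    E_le_simVal hF.toIsPathFun (hz.of_reach (Relation.ReflTransGen.single hz'))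

/-- The chain that takes one action and then continues with a chain depending on the successor. -/
def glueSim (C : S → Sim M) (z : ∀ s, (C s).Z) (hz : ∀ s, ((C s).f (z s)).1 = s)
    (c : Σ s, M.act s) : Sim M where
  Z := Option (Σ s, (C s).Z)
  finite := inferInstance
  step
    | none => (M.P c.1 c.2).map fun s => some ⟨s, z s⟩
    | some y => ((C y.1).step y.2).map fun z' => some ⟨y.1, z'⟩
  f
    | none => c
    | some y => (C y.1).f y.2
  compat := by
    rintro (_ | ⟨s, y⟩)
    · rw [PMF.map_comp]
      conv_rhs => rw [← PMF.map_id (M.P c.1 c.2)]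
      congr 1
      funext s
      exact hz s
    · rw [PMF.map_comp]
      exact (C s).compat y

lemma glueSim_E (C : S → Sim M) (z : ∀ s, (C s).Z) (hz : ∀ s, ((C s).f (z s)).1 = s)
    (c : Σ s, M.act s) (hF : IsPathFun F) (s : S) (y : (C s).Z) :
    (glueSim C z hz c).E F (some ⟨s, y⟩) = (C s).E F y := by
  have h := chainExp_intertwine' (stepW := (C s).step) (stepZ := (glueSim C z hz c).step)
    (C s).f (glueSim C z hz c).f (fun y => PMF.pure (some ⟨s, y⟩))
    (fun w x hx => by rw [(PMF.mem_support_pure_iff _ _).1 hx]; rfl)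
    (fun w => PMF.pure_bind (some (⟨s, w⟩ : Σ s, (C s).Z)) (glueSim C z hz c).step)
    (PMF.pure y) hF
  rw [PMF.pure_bind] at h
  exact h.symm

/-- Taking the given action and then following an ε-optimal chain for the state reached is again a
competitor, namely `glueSim`. -/
lemma mean_simVal_le (hAct : ∀ s, ∃ b, (⟨s, b⟩ : Σ s, M.act s) ∈ Act)
    (hF : M.IsObjective (fun _ => 0) (fun _ => 1) F) {c : Σ s, M.act s} (hc : c ∈ Act) :
    (M.P c.1 c.2).mean (simVal Act F) ≤ simVal Act F c.1 := by
  refine le_of_forall_pos_le_add fun ε hε => ?_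
  have h1 : ∀ s, ∃ (C : Sim M) (z : C.Z), C.Allowed Act z ∧ (C.f z).1 = s ∧
      simVal Act F s - ε < C.E F z := by
    intro s
    obtain ⟨_, ⟨C, z, h1, h2, rfl⟩, h3⟩ :=
      exists_lt_of_lt_csSup (simValues_nonempty (F := F) hAct s) (sub_lt_self _ hε)
    exact ⟨C, z, h1, h2, h3⟩
  choose C z hall hst hlt using h1
  set D := glueSim C z hst c with hD
  have hallD : D.Allowed Act none := by
    have hcl : D.Closed {x | x = none ∨ ∃ s y, (C s).Reach (z s) y ∧ x = some ⟨s, y⟩} := by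
      rintro x (rfl | ⟨s, y, hy, rfl⟩) x' hx'
      · obtain ⟨s, -, rfl⟩ := (PMF.mem_support_map_iff _ _ _).1 hx'
        exact Or.inr ⟨s, z s, Relation.ReflTransGen.refl, rfl⟩
      · obtain ⟨y', hy', rfl⟩ := (PMF.mem_support_map_iff _ _ _).1 hx'
        exact Or.inr ⟨s, y', hy.tail hy', rfl⟩
    intro x hx
    rcases hcl.reach (Or.inl rfl) hx with rfl | ⟨s, y, hy, rfl⟩
    · exact hc
    · exact hall s y hy
  have h2 := E_le_simVal hF.toIsPathFun hallD
  have h6 := Sim.E_step hF (C := D) none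
  simp only [zero_add, one_mul] at h6
  have h3 : (D.step none).mean (D.E F) = (M.P c.1 c.2).mean (fun s => (C s).E F (z s)) := by
    refine (PMF.mean_map (β := D.Z) (M.P c.1 c.2) (fun s => some ⟨s, z s⟩) (D.E F)).trans ?_
    exact PMF.mean_congr _ fun s _ => glueSim_E C z hst c hF.toIsPathFun s (z s)
  have h4 : (M.P c.1 c.2).mean (fun s => simVal Act F s - ε) ≤
      (M.P c.1 c.2).mean (fun s => (C s).E F (z s)) :=
    PMF.mean_mono _ fun s _ => (hlt s).le
  rw [PMF.mean_sub, PMF.mean_const] at h4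
  rw [h6, h3] at h2
  have h5 : (D.f none).1 = c.1 := rfl
  rw [h5] at h2
  linarith

lemma exists_mem_simPres (hAct : ∀ s, ∃ b, (⟨s, b⟩ : Σ s, M.act s) ∈ Act)
    (hF : M.IsObjective (fun _ => 0) (fun _ => 1) F) (s : S) :
    ∃ b, (⟨s, b⟩ : Σ s, M.act s) ∈ simPres Act F := by
  obtain ⟨b, hb, h⟩ := exists_simVal_le hAct (fun _ => zero_le_one) hF s
  refine ⟨b, hb, le_antisymm (mean_simVal_le hAct hF hb) ?_⟩
  simpa using h

/-- A chain that achieves the optimal value uses value-preserving actions only. -/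
lemma allowed_simPres (hAct : ∀ s, ∃ b, (⟨s, b⟩ : Σ s, M.act s) ∈ Act)
    (hF : M.IsObjective (fun _ => 0) (fun _ => 1) F) {C : Sim M} {z : C.Z}
    (hz : C.Allowed Act z) (hopt : simVal Act F (C.f z).1 ≤ C.E F z) :
    C.Allowed (simPres Act F) z := by
  -- At an optimal state the value is at most the mean of the successors' expectations, hence at
  -- most the mean of their values, hence at most the value again. Equality throughout makes the
  -- pair value-preserving and every successor optimal.
  have key : ∀ z', C.Allowed Act z' → simVal Act F (C.f z').1 ≤ C.E F z' →
      C.f z' ∈ simPres Act F ∧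
      ∀ y ∈ (C.step z').support, simVal Act F (C.f y).1 ≤ C.E F y := by
    intro z' hz' hopt'
    have h1 : ∀ y ∈ (C.step z').support, C.E F y ≤ simVal Act F (C.f y).1 := fun y hy =>
      E_le_simVal hF.toIsPathFun (hz'.of_reach (Relation.ReflTransGen.single hy))
    have hmem := hz' z' Relation.ReflTransGen.refl
    have h2 := mean_simVal_le hAct hF hmem
    have h3 := Sim.E_step hF z'
    simp only [zero_add, one_mul] at h3
    have h4 := C.mean_state z' (simVal Act F)
    refine ⟨⟨hmem, ?_⟩, fun y hy => ?_⟩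
    · refine le_antisymm h2 ?_
      rw [← h4]
      exact (hopt'.trans h3.le).trans (PMF.mean_mono _ h1)
    · refine (PMF.eq_of_mean_le _ h1 ?_ y hy).ge
      rw [h4]
      linarith
  have h : ∀ z', C.Reach z z' → simVal Act F (C.f z').1 ≤ C.E F z' := by
    intro z' hz'
    induction hz' with
    | refl => exact hopt
    | tail h1 h2 ih => exact (key _ (hz.of_reach h1) ih).2 _ h2
  exact fun z' hz' => (key z' (hz.of_reach hz') (h z' hz')).1

end Finite

end Sim

/-! ### Safety and Büchi objectives -/

section Objectives

variable {S A : Type} {M : MDP S A}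

/-- Sequences that visit only states in `G`. -/
def safeSet (M : MDP S A) (G : Set S) : Set (ℕ → Σ s, M.act s) := {ρ | ∀ t, (ρ t).1 ∈ G}

/-- Sequences that visit `acc` infinitely often. -/
def buchiSet (M : MDP S A) (acc : Set S) : Set (ℕ → Σ s, M.act s) :=
  {ρ | ∃ᶠ t in atTop, (ρ t).1 ∈ acc}

lemma measurableSet_forall_coord {X : Type} (A : Set X) :
    @MeasurableSet _ (pathSpace X) {ρ : ℕ → X | ∀ t, ρ t ∈ A} := by
  have : {ρ : ℕ → X | ∀ t, ρ t ∈ A} = ⋂ t, {ρ : ℕ → X | ρ t ∈ A} := by ext; simp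
  rw [this]
  exact MeasurableSet.iInter fun t => measurableSet_coord t A

lemma measurableSet_frequently_coord {X : Type} (A : Set X) :
    @MeasurableSet _ (pathSpace X) {ρ : ℕ → X | ∃ᶠ t in atTop, ρ t ∈ A} := by
  have : {ρ : ℕ → X | ∃ᶠ t in atTop, ρ t ∈ A} =
      ⋂ n, ⋃ t, ⋃ (_ : n ≤ t), {ρ : ℕ → X | ρ t ∈ A} := by
    ext ρ; simp [frequently_atTop]
  rw [this]
  exact MeasurableSet.iInter fun n => MeasurableSet.iUnion fun t => MeasurableSet.iUnion fun _ =>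
    measurableSet_coord t A

lemma measurableSet_safeSet (G : Set S) : @MeasurableSet _ (pathSpace _) (safeSet M G) :=
  measurableSet_forall_coord {c : Σ s, M.act s | c.1 ∈ G}

lemma measurableSet_buchiSet (acc : Set S) : @MeasurableSet _ (pathSpace _) (buchiSet M acc) :=
  measurableSet_frequently_coord {c : Σ s, M.act s | c.1 ∈ acc}

lemma isObjective_indicator {E : Set (ℕ → Σ s, M.act s)}
    (hE : @MeasurableSet _ (pathSpace _) E)
    (h : ∀ ρ, M.IsPath ρ → (ρ ∈ E ↔ (fun t => ρ (t + 1)) ∈ E)) :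
    M.IsObjective (fun _ => 0) (fun _ => 1) (E.indicator 1) where
  toIsPathFun := isPathFun_indicator hE
  recursion ρ hρ := by
    by_cases h1 : ρ ∈ E
    · rw [Set.indicator_of_mem h1, Set.indicator_of_mem ((h ρ hρ).1 h1)]; simp
    · rw [Set.indicator_of_notMem h1, Set.indicator_of_notMem (mt (h ρ hρ).2 h1)]; simp

lemma abs_indicator_one_le {α : Type} (E : Set α) (x : α) :
    |(E.indicator 1 : α → ℝ) x| ≤ 1 := by
  by_cases h : x ∈ E <;> simp [h]

lemma indicator_one_nonneg {α : Type} (E : Set α) (x : α) :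
    0 ≤ (E.indicator 1 : α → ℝ) x := by
  by_cases h : x ∈ E <;> simp [h]

/-- The states outside `G` are absorbing. -/
def MDP.Absorbing (M : MDP S A) (G : Set S) : Prop :=
  ∀ c : Σ s, M.act s, c.1 ∉ G → ∀ s' ∈ (M.P c.1 c.2).support, s' ∉ G

lemma isObjective_safe {G : Set S} (hG : M.Absorbing G) :
    M.IsObjective (fun _ => 0) (fun _ => 1) ((safeSet M G).indicator 1) := by
  refine isObjective_indicator (measurableSet_safeSet G) fun ρ hρ => ?_
  refine ⟨fun h t => h (t + 1), ?_⟩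
  rintro h (_ | t)
  · by_contra h0
    exact hG _ h0 _ (hρ 0) (h 0)
  · exact h t

lemma isObjective_buchi (acc : Set S) :
    M.IsObjective (fun _ => 0) (fun _ => 1) ((buchiSet M acc).indicator 1) := by
  refine isObjective_indicator (measurableSet_buchiSet acc) fun ρ _ => ?_
  simp only [buchiSet, Set.mem_ofPred_eq, frequently_atTop]
  constructor
  · intro h n
    obtain ⟨b, hb, hbacc⟩ := h (n + 1)
    obtain ⟨b, rfl⟩ := Nat.exists_eq_add_of_le' (Nat.one_le_of_lt hb)
    exact ⟨b, Nat.le_of_succ_le_succ hb, hbacc⟩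
  · intro h n
    obtain ⟨b, hb, hbacc⟩ := h n
    exact ⟨b + 1, hb.trans (Nat.le_succ b), hbacc⟩

variable [Finite S] [Finite A]

/-- A chain that uses actions preserving the safety value only is optimal for safety. -/
theorem safe_eq_simVal {G : Set S} (hG : M.Absorbing G) {C : Sim M} {z : C.Z}
    (hz : C.Allowed (simPres Set.univ ((safeSet M G).indicator 1)) z) :
    C.E ((safeSet M G).indicator 1) z =
      simVal Set.univ ((safeSet M G).indicator 1) (C.f z).1 := by
  set F : (ℕ → Σ s, M.act s) → ℝ := (safeSet M G).indicator 1 with hFdef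
  have hF : M.IsObjective (fun _ => 0) (fun _ => 1) F := isObjective_safe hG
  have hAct : ∀ s, ∃ b, (⟨s, b⟩ : Σ s, M.act s) ∈ (Set.univ : Set (Σ s, M.act s)) := fun s =>
    ⟨⟨_, (M.act_nonempty s).some_mem⟩, trivial⟩
  set V := simVal Set.univ F with hV
  have hV1 : ∀ s, V s ≤ 1 := simVal_le_one hAct hF.toIsPathFun (abs_indicator_one_le _)
  have hV0 : ∀ s, 0 < V s → s ∈ G := by
    intro s hs
    by_contra hsG
    refine hs.not_ge (csSup_le (simValues_nonempty hAct s) ?_)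
    rintro _ ⟨C, z, -, rfl, rfl⟩
    refine (Sim.E_congr_const fun ρ h0 _ => Set.indicator_of_notMem (fun h => ?_) _).le
    exact hsG (h0 ▸ h 0)
  refine le_antisymm (E_le_simVal hF.toIsPathFun fun _ _ => trivial) ?_
  by_contra hlt
  push Not at hlt
  have hstep : ∀ y, C.E F y = (C.step y).mean (C.E F) := fun y => by
    simpa using Sim.E_step hF y
  have hpres : ∀ y, C.Reach z y → V (C.f y).1 = (C.step y).mean (fun y' => V (C.f y').1) :=
    fun y hy => by rw [C.mean_state]; exact (hz y hy).2.symm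
  -- Value and achieved probability are both harmonic, so a positive deficit yields a closed set on
  -- which the deficit is constant.
  obtain ⟨N, hNz, ⟨y₀, hy₀⟩, hN, m, hm, hd⟩ :=
    Sim.exists_closed_max (N := {y | C.Reach z y}) (d := fun y => V (C.f y).1 - C.E F y)
      (fun y hy _ => ⟨by rw [PMF.mean_sub, ← hstep, ← hpres y hy], C.closed_reach z y hy⟩)
      (z₀ := z) Relation.ReflTransGen.refl (by simpa using hlt)
  have hEnn : ∀ y, 0 ≤ C.E F y := fun y =>
    Sim.E_nonneg hF.toIsPathFun (indicator_one_nonneg _) y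
  -- A second maximum principle inside `N`, now for the value. Where the value is positive the state
  -- lies in `G`, so the path is safe almost surely from `N'`; a deficit `m` would then push the
  -- value above 1.
  obtain ⟨N', hN'N, ⟨y₁, hy₁⟩, hN', w, hw, hVw⟩ :=
    Sim.exists_closed_max (N := N) (d := fun y => V (C.f y).1)
      (fun y hy _ => ⟨(hpres y (hNz hy)).le, hN y hy⟩) hy₀
      (by have := hd y₀ hy₀; have := hEnn y₀; linarith)
  have h1 : C.E F y₁ = 1 := Sim.E_congr_const fun ρ h0 hρ => by
    refine Set.indicator_of_mem (show _ ∈ safeSet M G from fun t => ?_) _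
    have := IsRun.mem_of_closed hρ hN' (h0 ▸ hy₁) t
    exact hV0 _ (by rw [hVw _ this]; exact hw)
  have h2 := hd y₁ (hN'N hy₁)
  have h3 := hV1 (C.f y₁).1
  linarith

/-- The probability of never visiting `acc` vanishes on a closed set from all of whose states
`acc` is reachable; hence `acc` is visited infinitely often almost surely. -/
lemma buchi_eq_one (acc : Set S) {C : Sim M} {N : Set C.Z} (hN : C.Closed N)
    (hreach : ∀ z ∈ N, ∃ z', C.Reach z z' ∧ (C.f z').1 ∈ acc) {z : C.Z} (hz : z ∈ N) :
    C.E ((buchiSet M acc).indicator 1) z = 1 := by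
  set A : Set C.Z := {z | (C.f z).1 ∉ acc} with hA
  set k : ℕ → C.Z → ℝ := fun n z => chainProb (PMF.pure z) C.step {ρ | ∀ t, ρ (t + n) ∈ A}
    with hk
  have hmeas : ∀ n, @MeasurableSet _ (pathSpace _) {ρ : ℕ → C.Z | ∀ t, ρ (t + n) ∈ A} :=
    fun n => measurable_path_shift n (measurableSet_forall_coord A)
  have hnonneg : ∀ n z, 0 ≤ k n z := fun n z => measureReal_nonneg
  have hsucc : ∀ n z, k (n + 1) z = (C.step z).mean (k n) := by
    intro n z
    simp only [hk, chainProb_eq_chainExp (hmeas _)]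
    rw [chainExp_pure (isPathFun_indicator (hmeas _)),
      ← chainExp_eq_mean (isPathFun_indicator (hmeas n))]
    rfl
  -- With `hsucc` this makes `k 0` subharmonic. A positive maximum would be constant on a closed
  -- set, which contains a state over `acc`, where `k 0` vanishes.
  have hmono : ∀ z, k 0 z ≤ k 1 z := fun z =>
    measureReal_mono (fun ρ h t => h (t + 1))
  have hacc : ∀ z, z ∉ A → k 0 z = 0 := by
    intro z hz
    simp only [hk, chainProb_eq_chainExp (hmeas 0)]
    rw [← chainExp_const (PMF.pure z) C.step 0]
    refine chainExp_congr fun ρ h0 _ => Set.indicator_of_notMem (fun h => hz ?_) _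
    rw [← (PMF.mem_support_pure_iff _ _).1 h0]
    exact h 0
  have hzero : ∀ n, ∀ z ∈ N, k n z = 0 := by
    intro n
    induction n with
    | zero =>
      intro z hz
      by_contra hne
      obtain ⟨N', hN'N, ⟨y₀, hy₀⟩, hN', m, hm, hd⟩ :=
        Sim.exists_closed_max (N := N) (d := k 0)
          (fun y hy _ => ⟨(hmono y).trans (hsucc 0 y).le, hN y hy⟩) hz
          (lt_of_le_of_ne (hnonneg 0 z) (Ne.symm hne))
      obtain ⟨y, hy, hyacc⟩ := hreach y₀ (hN'N hy₀)
      have h1 := hd y (hN'.reach hy₀ hy)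
      rw [hacc y (fun h => h hyacc)] at h1
      exact hm.ne h1
    | succ n ih =>
      intro z hz
      rw [hsucc]
      exact PMF.mean_congr_const _ fun y hy => ih y (hN z hz y hy)
  -- Failing the Büchi condition means avoiding `acc` from some time on, a countable union of null
  -- events.
  have hU : chainProb (PMF.pure z) C.step (⋃ n, {ρ | ∀ t, ρ (t + n) ∈ A}) = 0 :=
    chainProb_iUnion_eq_zero fun n => hzero n z hz
  have hUm : @MeasurableSet _ (pathSpace _) (⋃ n, {ρ : ℕ → C.Z | ∀ t, ρ (t + n) ∈ A}) :=
    MeasurableSet.iUnion hmeas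
  rw [chainProb_eq_chainExp hUm] at hU
  have hcompl : ∀ ρ : ℕ → C.Z,
      (buchiSet M acc).indicator (1 : (ℕ → Σ s, M.act s) → ℝ) (fun t => C.f (ρ t)) =
      1 + (-1) * (⋃ n, {ρ : ℕ → C.Z | ∀ t, ρ (t + n) ∈ A}).indicator
        (1 : (ℕ → C.Z) → ℝ) ρ := by
    intro ρ
    have hiff : (fun t => C.f (ρ t)) ∈ buchiSet M acc ↔
        ρ ∉ ⋃ n, {ρ : ℕ → C.Z | ∀ t, ρ (t + n) ∈ A} := by
      simp only [buchiSet, Set.mem_iUnion, Set.mem_ofPred_eq, not_exists, frequently_atTop, hA,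
        not_forall, not_not]
      refine forall_congr' fun n => ⟨?_, ?_⟩
      · rintro ⟨b, hb, h⟩
        exact ⟨b - n, by rwa [Nat.sub_add_cancel hb]⟩
      · rintro ⟨t, h⟩
        exact ⟨t + n, Nat.le_add_left _ _, h⟩
    by_cases h : ρ ∈ ⋃ n, {ρ : ℕ → C.Z | ∀ t, ρ (t + n) ∈ A}
    · rw [Set.indicator_of_notMem (fun h' => hiff.1 h' h), Set.indicator_of_mem h]; simp
    · rw [Set.indicator_of_mem (hiff.2 h), Set.indicator_of_notMem h]; simp
  unfold Sim.E
  simp only [hcompl]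
  rw [chainExp_add_mul (isPathFun_indicator hUm), hU]
  simp

end Objectives

/-! ### Memoryless policies attaining the Büchi value and nearly the discounted value. -/

section Optimality

variable {S A : Type} {M : MDP S A}

/-- One-step reachability by an action in `Act`. -/
def actEdge (Act : Set (Σ s, M.act s)) (s s' : S) : Prop :=
  ∃ b, (⟨s, b⟩ : Σ s, M.act s) ∈ Act ∧ s' ∈ (M.P s b).support

variable [Finite S] [Finite A]

/-- Where the Büchi value is positive, accepting states can be reached by value-preserving
actions. -/
lemma exists_reach_acc {Act : Set (Σ s, M.act s)}
    (hAct : ∀ s, ∃ b, (⟨s, b⟩ : Σ s, M.act s) ∈ Act) (acc : Set S) {s : S}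
    (hs : 0 < simVal Act ((buchiSet M acc).indicator 1) s) :
    ∃ s' ∈ acc, Relation.ReflTransGen
      (actEdge (simPres Act ((buchiSet M acc).indicator 1))) s s' := by
  set F : (ℕ → Σ s, M.act s) → ℝ := (buchiSet M acc).indicator 1 with hFdef
  have hF : M.IsObjective (fun _ => 0) (fun _ => 1) F := isObjective_buchi acc
  set W := simVal Act F with hW
  have hW0 : ∀ s, 0 ≤ W s := simVal_nonneg hAct hF.toIsPathFun (indicator_one_nonneg _)
  have hW1 : ∀ s, W s ≤ 1 := simVal_le_one hAct hF.toIsPathFun (abs_indicator_one_le _)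
  by_contra hno
  push Not at hno
  -- The supremum need not be known to be attained, so competing chains may use non-preserving
  -- pairs; by finiteness each such use costs at least `δ`.
  obtain ⟨δ, hδ, hgap⟩ : ∃ δ > 0, ∀ c ∈ Act, c ∉ simPres Act F →
      (M.P c.1 c.2).mean W ≤ W c.1 - δ := by
    rcases Set.eq_empty_or_nonempty (Act \ simPres Act F) with h | h
    · refine ⟨1, one_pos, fun c hc hc' => ?_⟩
      exact absurd (show c ∈ Act \ simPres Act F from ⟨hc, hc'⟩) (by simp [h])
    · obtain ⟨c₀, hc₀, hmin⟩ := Set.exists_min_image (Act \ simPres Act F)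
        (fun c => W c.1 - (M.P c.1 c.2).mean W) (Set.toFinite _) h
      refine ⟨W c₀.1 - (M.P c₀.1 c₀.2).mean W, ?_, fun c hc hc' => ?_⟩
      · have h1 := mean_simVal_le hAct hF hc₀.1
        have h2 : (M.P c₀.1 c₀.2).mean W ≠ W c₀.1 := fun h => hc₀.2 ⟨hc₀.1, h⟩
        exact sub_pos.2 (lt_of_le_of_ne h1 h2)
      · have := hmin c ⟨hc, hc'⟩
        linarith
  -- The test function is (1 + δ)E − W. At a non-preserving pair E ≤ W − δ and W ≤ 1 make it
  -- negative, so where it is positive the pair preserves W and the function is harmonic. A positive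
  -- maximum therefore lives on a closed set reached by preserving actions only, which misses `acc`;
  -- there E = 0, contradicting W ≥ 0.
  have key : ∀ (C : Sim M) (z : C.Z), C.Allowed Act z → (C.f z).1 = s →
      (1 + δ) * C.E F z ≤ W s := by
    intro C z hz hzs
    by_contra hlt
    push Not at hlt
    set N : Set C.Z := {y | C.Reach z y ∧
      Relation.ReflTransGen (actEdge (simPres Act F)) s (C.f y).1} with hN
    have hstep : ∀ y, C.E F y = (C.step y).mean (C.E F) := fun y => by
      simpa using Sim.E_step hF y
    have hsub : ∀ y ∈ N, 0 < (1 + δ) * C.E F y - W (C.f y).1 →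
        (1 + δ) * C.E F y - W (C.f y).1 ≤
          (C.step y).mean (fun y' => (1 + δ) * C.E F y' - W (C.f y').1) ∧
        ∀ y' ∈ (C.step y).support, y' ∈ N := by
      intro y hy hpos
      have hyA : C.f y ∈ Act := hz y hy.1
      have hpres : C.f y ∈ simPres Act F := by
        by_contra hnp
        have h1 := hgap _ hyA hnp
        have h2 : C.E F y ≤ (M.P (C.f y).1 (C.f y).2).mean W := by
          rw [hstep, ← C.mean_state y]
          exact PMF.mean_mono _ fun y' hy' => E_le_simVal hF.toIsPathFun
            (hz.of_reach (hy.1.tail hy'))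
        have h3 := hW1 (C.f y).1
        have h4 : δ * (W (C.f y).1 - δ) ≤ δ * (1 - δ) :=
          mul_le_mul_of_nonneg_left (by linarith) hδ.le
        have h5 : (1 + δ) * C.E F y ≤ (1 + δ) * (W (C.f y).1 - δ) :=
          mul_le_mul_of_nonneg_left (by linarith) (by linarith)
        nlinarith
      refine ⟨?_, fun y' hy' => ⟨hy.1.tail hy', hy.2.tail ⟨_, hpres, C.fst_mem_support hy'⟩⟩⟩
      rw [PMF.mean_sub, PMF.mean_const_mul, ← hstep, C.mean_state y W, hpres.2]
    obtain ⟨N', hN'N, ⟨y, hy⟩, hN', m, hm, hd⟩ :=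
      Sim.exists_closed_max (N := N) hsub (z₀ := z)
        ⟨Relation.ReflTransGen.refl, hzs ▸ Relation.ReflTransGen.refl⟩
        (by rw [hzs]; linarith)
    have h0 : C.E F y = 0 := Sim.E_congr_const fun ρ h0 hρ => by
      refine Set.indicator_of_notMem (fun h => ?_) _
      obtain ⟨t, -, ht⟩ := frequently_atTop.1 h 0
      exact hno _ ht (hN'N (IsRun.mem_of_closed hρ hN' (h0 ▸ hy) t)).2
    have h1 := hd y hy
    have h2 := hW0 (C.f y).1
    rw [h0] at h1
    linarith
  -- Taking the supremum in `key` forces W(s) ≤ 0.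
  have h1 : W s ≤ W s / (1 + δ) := by
    refine csSup_le (simValues_nonempty hAct s) ?_
    rintro _ ⟨C, z, hz, hzs, rfl⟩
    rw [le_div_iff₀ (by linarith), mul_comm]
    exact key C z hz hzs
  rw [le_div_iff₀ (by linarith)] at h1
  nlinarith

/-- A memoryless policy that uses exactly the actions preserving the Büchi value is optimal. -/
theorem buchi_eq_simVal {Act : Set (Σ s, M.act s)}
    (hAct : ∀ s, ∃ b, (⟨s, b⟩ : Σ s, M.act s) ∈ Act) (acc : Set S) {σ : MemorylessPolicy M}
    (hσ : ∀ s b, b ∈ (σ s).support ↔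
      (⟨s, b⟩ : Σ s, M.act s) ∈ simPres Act ((buchiSet M acc).indicator 1))
    {c : Σ s, M.act s} (hc : c ∈ simPres Act ((buchiSet M acc).indicator 1)) :
    (memSim σ).E ((buchiSet M acc).indicator 1) c =
      simVal Act ((buchiSet M acc).indicator 1) c.1 := by
  set F : (ℕ → Σ s, M.act s) → ℝ := (buchiSet M acc).indicator 1 with hFdef
  have hF : M.IsObjective (fun _ => 0) (fun _ => 1) F := isObjective_buchi acc
  set W := simVal Act F with hW
  have hW1 : ∀ s, W s ≤ 1 := simVal_le_one hAct hF.toIsPathFun (abs_indicator_one_le _)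
  set C : Sim M := memSim σ with hC
  have hall : C.Allowed (simPres Act F) c := memSim_allowed (fun s b hb => (hσ s b).1 hb) hc
  refine le_antisymm (E_le_simVal hF.toIsPathFun fun y hy => (hall y hy).1) ?_
  by_contra hlt
  push Not at hlt
  have hstep : ∀ y, C.E F y = (C.step y).mean (C.E F) := fun y => by
    simpa using Sim.E_step hF y
  have hpres : ∀ y, C.Reach c y → W (C.f y).1 = (C.step y).mean (fun y' => W (C.f y').1) :=
    fun y hy => by rw [C.mean_state]; exact (hall y hy).2.symm
  -- The two maximum principles from `safe_eq_simVal` again: first for the deficit, then for the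
  -- value inside the closed set obtained.
  obtain ⟨N, hNz, ⟨y₀, hy₀⟩, hN, m, hm, hd⟩ :=
    Sim.exists_closed_max (N := {y | C.Reach c y}) (d := fun y => W (C.f y).1 - C.E F y)
      (fun y hy _ => ⟨by rw [PMF.mean_sub, ← hstep, ← hpres y hy], C.closed_reach c y hy⟩)
      (z₀ := c) Relation.ReflTransGen.refl (sub_pos.2 hlt)
  have hEnn : ∀ y, 0 ≤ C.E F y := fun y =>
    Sim.E_nonneg hF.toIsPathFun (indicator_one_nonneg _) y
  obtain ⟨N', hN'N, ⟨y₁, hy₁⟩, hN', w, hw, hVw⟩ :=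
    Sim.exists_closed_max (N := N) (d := fun y => W (C.f y).1)
      (fun y hy _ => ⟨(hpres y (hNz hy)).le, hN y hy⟩) hy₀
      (by have := hd y₀ hy₀; have := hEnn y₀; linarith)
  have hmem : ∀ (y y' : Σ s, M.act s), y' ∈ (C.step y).support ↔
      y'.1 ∈ (M.P y.1 y.2).support ∧ y'.2 ∈ (σ y'.1).support := mem_chainStep_support σ
  -- Every preserving action has positive probability under `σ`, so paths in the graph of preserving
  -- actions are realized by the chain. This is where full support is used.
  have hpath : ∀ {s s' : S}, Relation.ReflTransGen (actEdge (simPres Act F)) s s' →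
      ∀ z : Σ s, M.act s, s ∈ (M.P z.1 z.2).support →
      ∃ b', C.Reach z (⟨s', b'⟩ : Σ s, M.act s) := by
    intro s s' h
    induction h using Relation.ReflTransGen.head_induction_on with
    | refl =>
      intro z hz
      obtain ⟨b', hb'⟩ := (σ s').support_nonempty
      exact ⟨b', Relation.ReflTransGen.single ((hmem _ _).2 ⟨hz, hb'⟩)⟩
    | head h1 _ ih =>
      intro z hz
      obtain ⟨b, hb, hs''⟩ := h1
      obtain ⟨b', hb'⟩ := ih ⟨_, b⟩ hs''
      exact ⟨b', Relation.ReflTransGen.head ((hmem _ _).2 ⟨hz, (hσ _ _).2 hb⟩) hb'⟩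
  have hreach : ∀ z ∈ N', ∃ z', C.Reach z z' ∧ (C.f z').1 ∈ acc := by
    intro z hz
    obtain ⟨z', hz'⟩ := (C.step z).support_nonempty
    have h1 : 0 < W (C.f z').1 := by rw [hVw z' (hN' z hz z' hz')]; exact hw
    obtain ⟨s', hs', hr⟩ := exists_reach_acc hAct acc h1
    obtain ⟨b', hb'⟩ := hpath hr z (C.fst_mem_support hz')
    exact ⟨⟨s', b'⟩, hb', hs'⟩
  have h1 : C.E F y₁ = 1 := buchi_eq_one acc hN' hreach hy₁
  have h2 := hd y₁ (hN'N hy₁)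
  have h3 := hW1 (C.f y₁).1
  linarith

/-- The expectation of a path function under a memoryless policy. -/
def memVal (σ : MemorylessPolicy M) (F : (ℕ → Σ s, M.act s) → ℝ) (s : S) : ℝ :=
  (σ s).mean fun b => (memSim σ).E F ⟨s, b⟩

lemma memVal_eq_chainExp (σ : MemorylessPolicy M) {F : (ℕ → Σ s, M.act s) → ℝ}
    (hF : IsPathFun F) :
    memVal σ F M.init =
      chainExp (MemorylessPolicy.chainInit σ) (MemorylessPolicy.chainStep σ) F := by
  rw [chainExp_eq_mean hF, MemorylessPolicy.chainInit, PMF.mean_map]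
  rfl

lemma memSim_E_step (σ : MemorylessPolicy M) {F : (ℕ → Σ s, M.act s) → ℝ}
    {r g : (Σ s, M.act s) → ℝ} (hF : M.IsObjective r g F) (c : Σ s, M.act s) :
    (memSim σ).E F c = r c + g c * (M.P c.1 c.2).mean (memVal σ F) := by
  refine (Sim.E_step (C := memSim σ) hF c).trans ?_
  refine congrArg (fun x => r c + g c * x) ?_
  refine (PMF.mean_bind (β := Σ s, M.act s) (M.P c.1 c.2) _ ((memSim σ).E F)).trans ?_
  exact PMF.mean_congr _ fun s' _ => PMF.mean_map (β := Σ s, M.act s) (σ s') _ _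

/-- A policy that takes the action `b s` in state `s` with probability at least `1 - δ`, and
otherwise a uniformly chosen action in `Act`. -/
lemma exists_mixed_policy {Act : Set (Σ s, M.act s)} (b : ∀ s, M.act s)
    (hb : ∀ s, (⟨s, b s⟩ : Σ s, M.act s) ∈ Act) {δ : ℝ} (hδ : 0 < δ) :
    ∃ σ : MemorylessPolicy M, (∀ s a, a ∈ (σ s).support ↔ (⟨s, a⟩ : Σ s, M.act s) ∈ Act) ∧
      ∀ s (h : M.act s → ℝ) (K : ℝ), (∀ a, h a ≤ K) → 0 ≤ K → h (b s) ≤ 0 →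
        (σ s).mean h ≤ δ * K := by
  have hfin : ∀ s, ∃ t : Finset (M.act s), ∀ a, a ∈ t ↔ (⟨s, a⟩ : Σ s, M.act s) ∈ Act := fun s =>
    ⟨(Set.toFinite {a | (⟨s, a⟩ : Σ s, M.act s) ∈ Act}).toFinset, fun a => by simp⟩
  choose t ht using hfin
  have htn : ∀ s, (t s).Nonempty := fun s => ⟨b s, (ht s _).2 (hb s)⟩
  -- One of n + 1 equally likely outcomes triggers the uniform draw, giving exploration probability
  -- 1/(n + 1) < δ.
  obtain ⟨n, hn⟩ := exists_nat_one_div_lt hδ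
  refine ⟨fun s => (PMF.uniformOfFintype (Fin (n + 1))).bind fun i =>
    if i = 0 then PMF.uniformOfFinset (t s) (htn s) else PMF.pure (b s), fun s a => ?_,
    fun s h K hK hK0 hbs => ?_⟩
  · rw [PMF.mem_support_bind_iff]
    constructor
    · rintro ⟨i, -, hi⟩
      by_cases h0 : i = 0
      · simpa [h0, ht] using hi
      · rw [if_neg h0, PMF.mem_support_pure_iff] at hi
        rw [hi]
        exact hb s
    · intro ha
      exact ⟨0, by simp, by simpa [ht] using ha⟩
  · rw [PMF.mean_bind, PMF.mean_eq_sum]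
    have h1 : ∀ i : Fin (n + 1), ((PMF.uniformOfFintype (Fin (n + 1))) i).toReal *
        (if i = 0 then PMF.uniformOfFinset (t s) (htn s) else PMF.pure (b s)).mean h ≤
        if i = 0 then 1 / ((n : ℝ) + 1) * K else 0 := by
      intro i
      have h2 : ((PMF.uniformOfFintype (Fin (n + 1))) i).toReal = 1 / ((n : ℝ) + 1) := by
        simp [PMF.uniformOfFintype_apply, ENNReal.toReal_add]
      rw [h2]
      have h3 : 0 ≤ 1 / ((n : ℝ) + 1) := by positivity
      split_ifs with h0
      · exact mul_le_mul_of_nonneg_left (PMF.mean_le _ fun a _ => hK a) h3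
      · rw [PMF.mean_pure]
        exact mul_nonpos_of_nonneg_of_nonpos h3 hbs
    refine (Finset.sum_le_sum fun i _ => h1 i).trans ?_
    rw [Finset.sum_ite_eq' Finset.univ (0 : Fin (n + 1)), if_pos (Finset.mem_univ _)]
    exact mul_le_mul_of_nonneg_right hn.le hK0

/-- Near-optimal discounted policies with prescribed supports. Actions are discounted by `γ`,
except that undiscounted actions may lead to a closed set of states without such actions. -/
theorem exists_policy_near_simVal {Act : Set (Σ s, M.act s)}
    (hAct : ∀ s, ∃ b, (⟨s, b⟩ : Σ s, M.act s) ∈ Act) {r g : (Σ s, M.act s) → ℝ}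
    {F : (ℕ → Σ s, M.act s) → ℝ} (hF : M.IsObjective r g F) {γ : ℝ} (hγ0 : 0 ≤ γ) (hγ1 : γ < 1)
    (N : Set S)
    (hN : ∀ c : Σ s, M.act s, c.1 ∈ N →
      g c = γ ∧ ∀ s' ∈ (M.P c.1 c.2).support, s' ∈ N)
    (hg : ∀ c, g c = γ ∨ (g c = 1 ∧ ∀ s' ∈ (M.P c.1 c.2).support, s' ∈ N))
    {ε : ℝ} (hε : 0 < ε) :
    ∃ σ : MemorylessPolicy M, (∀ s b, b ∈ (σ s).support ↔ (⟨s, b⟩ : Σ s, M.act s) ∈ Act) ∧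
      ∀ s, simVal Act F s ≤ memVal σ F s + ε := by
  set U := simVal Act F with hU
  have hg0 : ∀ c, 0 ≤ g c := fun c => by
    rcases hg c with h | ⟨h, -⟩ <;> rw [h]
    · exact hγ0
    · exact zero_le_one
  choose b hb hbU using exists_simVal_le hAct hg0 hF
  -- `K` bounds the Bellman loss of a single badly chosen action.
  obtain ⟨K, hK0, hK⟩ : ∃ K, 0 ≤ K ∧ ∀ c : Σ s, M.act s,
      U c.1 - (r c + g c * (M.P c.1 c.2).mean U) ≤ K := by
    obtain ⟨K, hK⟩ := (Set.finite_range fun c : Σ s, M.act s =>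
      U c.1 - (r c + g c * (M.P c.1 c.2).mean U)).bddAbove
    exact ⟨max K 0, le_max_right _ _, fun c => (hK ⟨c, rfl⟩).trans (le_max_left _ _)⟩
  have h1γ : 0 < 1 - γ := by linarith
  -- Chosen so that δK ≤ ε(1 − γ)/2 and δK/(1 − γ) ≤ ε/2, with total at most ε; `K + 1` avoids
  -- dividing by zero.
  set δ : ℝ := ε * (1 - γ) / (2 * (K + 1)) with hδdef
  have hδ : 0 < δ := by positivity
  obtain ⟨σ, hσ, hmix⟩ := exists_mixed_policy b hb hδ
  refine ⟨σ, hσ, ?_⟩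
  set D : S → ℝ := fun s => U s - memVal σ F s with hD
  -- The deficit is the mean of the immediate Bellman loss plus the discounted deficit of the
  -- successor. The loss is at most 0 at the greedy action, so its mean is at most δK.
  have hDs : ∀ s, ∀ B : ℝ, (∀ a, g ⟨s, a⟩ * (M.P s a).mean D ≤ B) → D s ≤ δ * K + B := by
    intro s B hB
    have h1 : D s = (σ s).mean (fun a => (U s - (r ⟨s, a⟩ + g ⟨s, a⟩ * (M.P s a).mean U)) +
        g ⟨s, a⟩ * (M.P s a).mean D) := by
      simp only [hD]
      nth_rewrite 1 [← (σ s).mean_const (U s)]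
      rw [memVal, ← PMF.mean_sub]
      refine PMF.mean_congr _ fun a _ => ?_
      rw [memSim_E_step σ hF, PMF.mean_sub]
      ring
    rw [h1, PMF.mean_add]
    refine add_le_add (hmix s _ K (fun a => hK ⟨s, a⟩) hK0 ?_) (PMF.mean_le _ fun a _ => hB a)
    have := hbU s
    linarith
  -- The fixed point of m ↦ δK + γm, which bounds the deficit on `N`, where every step is
  -- discounted. Elsewhere an undiscounted step leads into `N` and adds at most one further δK.
  set B : ℝ := δ * K / (1 - γ) with hBdef
  have hB0 : 0 ≤ B := by positivity
  have hBeq : δ * K + γ * B = B := by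
    rw [hBdef]
    field_simp
    ring
  have hfix : ∀ m, m ≤ δ * K + γ * m → m ≤ B := by
    intro m hm
    rw [hBdef, le_div_iff₀ h1γ]
    linarith
  have hDN : ∀ s ∈ N, D s ≤ B := by
    intro s hs
    obtain ⟨s₁, hs₁, hmax⟩ := Set.exists_max_image N D (Set.toFinite N) ⟨s, hs⟩
    refine (hmax s hs).trans (hfix _ (hDs s₁ _ fun a => ?_))
    obtain ⟨h1, h2⟩ := hN ⟨s₁, a⟩ hs₁
    rw [h1]
    exact mul_le_mul_of_nonneg_left (PMF.mean_le _ fun s' hs' => hmax s' (h2 s' hs')) hγ0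
  have hDall : ∀ s, D s ≤ δ * K + B := by
    intro s
    obtain ⟨s₁, -, hmax⟩ := Set.exists_max_image Set.univ D (Set.toFinite _) ⟨s, trivial⟩
    have h1 : D s₁ ≤ δ * K + max (γ * D s₁) B := by
      refine hDs s₁ _ fun a => ?_
      rcases hg ⟨s₁, a⟩ with h | ⟨h, h'⟩
      · rw [h]
        refine le_max_of_le_left (mul_le_mul_of_nonneg_left ?_ hγ0)
        exact PMF.mean_le _ fun s' _ => hmax s' trivial
      · rw [h, one_mul]
        exact le_max_of_le_right (PMF.mean_le _ fun s' hs' => hDN s' (h' s' hs'))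
    refine (hmax s trivial).trans ?_
    rcases max_cases (γ * D s₁) B with ⟨h, -⟩ | ⟨h, -⟩
    · rw [h] at h1
      have := hfix _ h1
      have : 0 ≤ δ * K := by positivity
      linarith
    · rwa [h] at h1
  intro s
  have h1 := hDall s
  have h2 : δ * K + B ≤ ε := by
    have h3 : δ * K ≤ ε * (1 - γ) / 2 := by
      rw [hδdef, div_mul_eq_mul_div, div_le_div_iff₀ (by positivity) (by norm_num)]
      have : 0 < ε * (1 - γ) := by positivity
      nlinarith
    have h4 : B ≤ ε / 2 := by
      rw [hBdef, div_le_iff₀ h1γ]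
      linarith
    nlinarith
  simp only [hD] at h1
  linarith

end Optimality

/-! ### Discounted returns -/

section Return

variable {S A : Type} [Finite S] (M : MDP S A)

lemma MDP.exists_reward_bound : ∃ K, 0 ≤ K ∧ ∀ s, |M.R s| ≤ K := by
  obtain ⟨K, hK⟩ := (Set.finite_range fun s => |M.R s|).bddAbove
  exact ⟨max K 0, le_max_right _ _, fun s => (hK ⟨s, rfl⟩).trans (le_max_left _ _)⟩

lemma MDP.summable_ret (ρ : ℕ → S) : Summable fun t => M.γ ^ t * M.R (ρ t) := by
  obtain ⟨K, -, hK⟩ := M.exists_reward_bound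
  refine Summable.of_norm_bounded
    ((summable_geometric_of_lt_one M.γ_nonneg M.γ_lt_one).mul_right K) fun t => ?_
  rw [norm_mul, norm_pow, Real.norm_of_nonneg M.γ_nonneg]
  exact mul_le_mul_of_nonneg_left (hK _) (pow_nonneg M.γ_nonneg t)

lemma MDP.ret_eq_add (ρ : ℕ → S) :
    M.ret ρ = M.R (ρ 0) + M.γ * M.ret (fun t => ρ (t + 1)) := by
  unfold MDP.ret
  rw [(M.summable_ret ρ).tsum_eq_zero_add, ← tsum_mul_left]
  simp only [pow_zero, one_mul, pow_succ']
  congr 2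
  funext t
  ring

lemma MDP.isPathFun_ret : IsPathFun M.ret := by
  let _ : MeasurableSpace S := ⊤
  constructor
  · refine measurable_of_tendsto_metrizable
      (f := fun n ρ => ∑ t ∈ Finset.range n, M.γ ^ t * M.R (ρ t)) (fun n => ?_) ?_
    · refine Finset.measurable_sum _ fun t _ => Measurable.const_mul ?_ _
      exact measurable_from_top.comp (measurable_pi_apply t)
    · rw [tendsto_pi_nhds]
      exact fun ρ => (M.summable_ret ρ).hasSum.tendsto_sum_nat
  · obtain ⟨K, -, hK⟩ := M.exists_reward_bound
    refine ⟨∑' t, M.γ ^ t * K, fun ρ => ?_⟩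
    have h1 := (summable_geometric_of_lt_one M.γ_nonneg M.γ_lt_one).mul_right K
    rw [← Real.norm_eq_abs]
    refine tsum_of_norm_bounded h1.hasSum fun t => ?_
    rw [norm_mul, norm_pow, Real.norm_of_nonneg M.γ_nonneg]
    exact mul_le_mul_of_nonneg_left (hK _) (pow_nonneg M.γ_nonneg t)

end Return

lemma measurableSet_ltl {AP : Type} (f : LTL AP) :
    @MeasurableSet _ (pathSpace (Set AP)) {w | f.Sat w} := by
  have hshift : ∀ {E : Set (ℕ → Set AP)} (n : ℕ), @MeasurableSet _ (pathSpace (Set AP)) E →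
      @MeasurableSet _ (pathSpace (Set AP)) {w | (fun i => w (i + n)) ∈ E} := fun n hE =>
    measurable_path_shift n hE
  induction f with
  | tru => simp [LTL.Sat]
  | atom a => exact measurableSet_coord 0 {θ | a ∈ θ}
  | and f g hf hg => exact hf.inter hg
  | not f hf => exact hf.compl
  | next f hf => exact hshift 1 hf
  | _ f g hf hg =>
    have : {w | (LTL.until f g).Sat w} = ⋃ t, ({w | (fun i => w (i + t)) ∈ {w | g.Sat w}} ∩
        ⋂ j, ⋂ (_ : j < t), {w | (fun i => w (i + j)) ∈ {w | f.Sat w}}) := by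
      ext w
      simp [LTL.Sat]
    rw [this]
    exact MeasurableSet.iUnion fun t => (hshift t hg).inter
      (MeasurableSet.iInter fun j => MeasurableSet.iInter fun _ => hshift j hf)

/-! ### Paths of the product and deletion of the ε-action. -/

namespace LabeledMDP

variable {S A AP Qs Qb : Type} (M : LabeledMDP S A AP) (D : SafetyAutomaton Qs AP)
  (B : LDBA Qb AP)

/-- The state-action pairs of the product whose action is an `ε`-action. -/
def epsPairs : Set (Σ x, (M.product D B).act x) := {c | c.2.1.isLeft = false}

/-- The product states in the accepting component. -/
def accCompStates (_M : LabeledMDP S A AP) (_D : SafetyAutomaton Qs AP) (B : LDBA Qb AP) :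
    Set (S × Qs × Qb) := {x | x.2.2 ∈ B.accComp}

/-- The path of `M` obtained by deleting the first `ε`-action. -/
def dropPath (ρ : ℕ → Σ x, (M.product D B).act x) : ℕ → S :=
  fun t => (dropFirst (M.epsPairs D B) ρ t).1.1

variable {M D B}

lemma product_succ_inl {x : S × Qs × Qb} {a : A}
    (h : (Sum.inl a : A ⊕ Qb) ∈ (M.product D B).act x) {x' : S × Qs × Qb}
    (hx' : x' ∈ ((M.product D B).P x ⟨Sum.inl a, h⟩).support) :
    x'.1 ∈ (M.P x.1 ⟨a, h⟩).support ∧ x'.2.1 = D.step x.2.1 (M.L x.1) ∧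
      x'.2.2 = B.step x.2.2 (M.L x.1) := by
  obtain ⟨s', hs', rfl⟩ := (PMF.mem_support_map_iff _ _ _).1 hx'
  exact ⟨hs', rfl, rfl⟩

lemma product_succ_inr {x : S × Qs × Qb} {q : Qb}
    (h : (Sum.inr q : A ⊕ Qb) ∈ (M.product D B).act x) {x' : S × Qs × Qb}
    (hx' : x' ∈ ((M.product D B).P x ⟨Sum.inr q, h⟩).support) : x' = (x.1, x.2.1, q) :=
  (PMF.mem_support_pure_iff _ _).1 hx'

lemma product_absorbing : (M.product D B).Absorbing {x | x.2.1 ∈ D.acc} := by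
  rintro ⟨x, ⟨a | q, h⟩⟩ hx x' hx'
  · have h1 := (product_succ_inl h hx').2.1
    simp only [Set.mem_ofPred_eq] at hx ⊢
    rw [h1, D.absorbing _ hx]
    exact hx
  · rw [product_succ_inr h hx']
    exact hx

lemma notMem_epsPairs_of_accComp {c : Σ x, (M.product D B).act x}
    (hc : c.1 ∈ M.accCompStates D B) : c ∉ M.epsPairs D B := by
  obtain ⟨x, ⟨a | q, h⟩⟩ := c
  · simp [epsPairs]
  · have h1 : q ∈ B.eps x.2.2 := h
    rw [B.eps_accComp _ hc] at h1
    exact absurd h1 (Set.notMem_empty q)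

lemma accComp_succ {c : Σ x, (M.product D B).act x} (hc : c.1 ∈ M.accCompStates D B)
    {x' : S × Qs × Qb} (hx' : x' ∈ ((M.product D B).P c.1 c.2).support) :
    x' ∈ M.accCompStates D B := by
  obtain ⟨x, ⟨a | q, h⟩⟩ := c
  · have := (product_succ_inl h hx').2.2
    rw [accCompStates, Set.mem_ofPred_eq, this]
    exact B.step_accComp _ hc _
  · exact absurd rfl (notMem_epsPairs_of_accComp (c := ⟨x, ⟨Sum.inr q, h⟩⟩) hc)

lemma eps_succ (hB : ∀ q, B.eps q ⊆ B.accComp) {c : Σ x, (M.product D B).act x}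
    (hc : c ∈ M.epsPairs D B) {x' : S × Qs × Qb}
    (hx' : x' ∈ ((M.product D B).P c.1 c.2).support) : x' ∈ M.accCompStates D B := by
  obtain ⟨x, ⟨a | q, h⟩⟩ := c
  · simp [epsPairs] at hc
  · rw [product_succ_inr h hx']
    exact hB _ h

lemma notMem_epsPairs_iff {c : Σ x, (M.product D B).act x} :
    c ∉ M.epsPairs D B ↔ c.2.1.isLeft = true := by
  simp [epsPairs]

section Paths

variable {ρ : ℕ → Σ x, (M.product D B).act x}

/-- An ε-action enters the accepting component, which is closed and has no ε-transitions. So a path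
has at most one ε-action. -/
lemma notMem_epsPairs_of_lt (hB : ∀ q, B.eps q ⊆ B.accComp) (hρ : (M.product D B).IsPath ρ)
    {j t : ℕ} (hj : ρ j ∈ M.epsPairs D B) (ht : j < t) : ρ t ∉ M.epsPairs D B := by
  have h : ∀ k, (ρ (j + 1 + k)).1 ∈ M.accCompStates D B := by
    intro k
    induction k with
    | zero => exact eps_succ hB hj (hρ j)
    | succ k ih => exact accComp_succ ih (hρ (j + 1 + k))
  obtain ⟨k, rfl⟩ := Nat.exists_eq_add_of_le (Nat.succ_le_of_lt ht)
  exact notMem_epsPairs_of_accComp (h k)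

lemma inducedPath_eq_dropPath (hB : ∀ q, B.eps q ⊆ B.accComp)
    (hρ : (M.product D B).IsPath ρ) : M.inducedPath D B ρ = M.dropPath D B ρ := by
  classical
  funext n
  set p : ℕ → Prop := fun t => (ρ t).2.1.isLeft = true with hp
  have hpe : ∀ t, p t ↔ ρ t ∈ (M.epsPairs D B)ᶜ := fun t => notMem_epsPairs_iff.symm
  change (ρ (Nat.nth p n)).1.1 = (if ∀ i < n + 1, ρ i ∈ (M.epsPairs D B)ᶜ then ρ n
    else ρ (n + 1)).1.1
  by_cases h : ∀ i < n + 1, ρ i ∈ (M.epsPairs D B)ᶜ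
  · rw [if_pos h]
    have h1 : Nat.count p n = n :=
      Nat.count_iff_forall.2 fun i hi => (hpe i).2 (h i (Nat.lt_succ_of_lt hi))
    have h2 := Nat.nth_count (p := p) ((hpe n).2 (h n (Nat.lt_succ_self n)))
    rw [h1] at h2
    rw [h2]
  · rw [if_neg h]
    push Not at h
    obtain ⟨j, hj, hjs⟩ := h
    have hj' : ρ j ∈ M.epsPairs D B := not_not.1 hjs
    have hbefore : ∀ i < j, p i := fun i hi => (hpe i).2 fun hi' =>
      notMem_epsPairs_of_lt hB hρ hi' hi hj'
    have hafter : ∀ i, j < i → p i := fun i hi =>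
      (hpe i).2 (notMem_epsPairs_of_lt hB hρ hj' hi)
    -- Past the unique ε-action at `j`, the number of actions of `M` taken so far lags the time by
    -- one, matching the shift in `dropFirst`.
    have hcount : ∀ k, Nat.count p (j + 1 + k) = j + k := by
      intro k
      induction k with
      | zero =>
        rw [Nat.add_zero, Nat.count_succ, if_neg (fun h => (hpe j).1 h hj'), Nat.add_zero,
          Nat.add_zero]
        exact Nat.count_iff_forall.2 hbefore
      | succ k ih =>
        rw [← Nat.add_assoc, Nat.count_succ, ih, if_pos (hafter _ (by omega)), Nat.add_assoc]
    obtain ⟨k, rfl⟩ := Nat.exists_eq_add_of_le (Nat.le_of_lt_succ hj)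
    have h2 := Nat.nth_count (p := p) (hafter (j + 1 + k) (by omega))
    rw [hcount] at h2
    rw [h2, show j + 1 + k = j + k + 1 by omega]

/-- Along a path of the product, the automata read the labels of the induced path. -/
lemma run_count (hρ : (M.product D B).IsPath ρ) (h0 : (ρ 0).1 = (M.product D B).init) (t : ℕ) :
    D.run (fun n => M.L (M.inducedPath D B ρ n))
      (Nat.count (fun t => (ρ t).2.1.isLeft = true) t) = (ρ t).1.2.1 := by
  set p : ℕ → Prop := fun t => (ρ t).2.1.isLeft = true with hp
  induction t with
  | zero => rw [Nat.count_zero, h0]; rfl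
  | succ t ih =>
    have hstep := hρ t
    by_cases hpt : p t
    · rw [Nat.count_succ, if_pos hpt, SafetyAutomaton.run, ih]
      have h1 : M.inducedPath D B ρ (Nat.count p t) = (ρ t).1.1 := by
        change (ρ (Nat.nth p (Nat.count p t))).1.1 = _
        rw [Nat.nth_count hpt]
      rw [h1]
      revert hstep hpt
      simp only [hp]
      rcases ρ t with ⟨x, ⟨a | q, h⟩⟩
      · exact fun hstep _ => (product_succ_inl h hstep).2.1.symm
      · intro _ hl
        simp at hl
    · rw [Nat.count_succ, if_neg hpt, Nat.add_zero, ih]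
      revert hstep hpt
      simp only [hp]
      rcases ρ t with ⟨x, ⟨a | q, h⟩⟩
      · intro _ hl
        simp at hl
      · intro hstep _
        rw [product_succ_inr h hstep]

/-- By `run_count` the safety components along the path are exactly the run on the induced word,
with a repetition at the ε-action. At most one time is not an action of `M`, so every position of
the run is reached. -/
lemma accepts_iff_safe (hB : ∀ q, B.eps q ⊆ B.accComp) (hρ : (M.product D B).IsPath ρ)
    (h0 : (ρ 0).1 = (M.product D B).init) :
    D.Accepts (fun n => M.L (M.inducedPath D B ρ n)) ↔ ρ ∈ M.safeEvent D B := by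
  set p : ℕ → Prop := fun t => (ρ t).2.1.isLeft = true with hp
  have hinf : (Set.ofPred p).Infinite := by
    intro hfin
    have h1 : (Set.ofPred p)ᶜ.Subsingleton := by
      intro i hi j hj
      by_contra hne
      have hi' : ρ i ∈ M.epsPairs D B := not_not.1 (mt notMem_epsPairs_iff.1 hi)
      have hj' : ρ j ∈ M.epsPairs D B := not_not.1 (mt notMem_epsPairs_iff.1 hj)
      rcases lt_or_gt_of_ne hne with h | h
      · exact notMem_epsPairs_of_lt hB hρ hi' h hj'
      · exact notMem_epsPairs_of_lt hB hρ hj' h hi'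
    have h2 := hfin.union h1.finite
    rw [Set.union_compl_self] at h2
    exact Set.infinite_univ h2
  constructor
  · intro h t
    have := h (Nat.count p t)
    rwa [run_count hρ h0] at this
  · intro h n
    have h1 := run_count hρ h0 (Nat.nth p n)
    rw [Nat.count_nth_of_infinite hinf] at h1
    rw [h1]
    exact h _

/-- The LDBA components form an accepting execution, with the count of actions of `M` as reading
position. There is no converse, as acceptance may rely on ε-choices other than those of the path. -/
lemma accepts_of_buchi (hρ : (M.product D B).IsPath ρ) (h0 : (ρ 0).1 = (M.product D B).init)
    (h : ρ ∈ M.buchiEvent D B) : B.Accepts (fun n => M.L (M.inducedPath D B ρ n)) := by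
  set p : ℕ → Prop := fun t => (ρ t).2.1.isLeft = true with hp
  refine ⟨fun t => (ρ t).1.2.2, Nat.count p,
    congrArg (fun x : S × Qs × Qb => x.2.2) h0, Nat.count_zero p, fun t => ?_, h⟩
  have hstep := hρ t
  by_cases hpt : p t
  · left
    rw [Nat.count_succ, if_pos hpt]
    refine ⟨?_, rfl⟩
    have h1 : M.inducedPath D B ρ (Nat.count p t) = (ρ t).1.1 := by
      change (ρ (Nat.nth p (Nat.count p t))).1.1 = _
      rw [Nat.nth_count hpt]
    simp only [h1]
    revert hstep hpt
    simp only [hp]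
    rcases ρ t with ⟨x, ⟨a | q, h⟩⟩
    · exact fun hstep _ => (product_succ_inl h hstep).2.2
    · intro _ hl
      simp at hl
  · right
    rw [Nat.count_succ, if_neg hpt]
    refine ⟨?_, rfl⟩
    revert hstep hpt
    simp only [hp]
    rcases ρ t with ⟨x, ⟨a | q, h⟩⟩
    · intro _ hl
      simp at hl
    · intro hstep _
      rw [product_succ_inr h hstep]
      exact h

end Paths

variable (M D B) in
/-- The return of the path of `M` induced by a path of the product. -/
def retFun (ρ : ℕ → Σ x, (M.product D B).act x) : ℝ := M.ret (M.dropPath D B ρ)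

open Classical in
-- An ε-action takes no time in `M`: it earns nothing and is not discounted. Afterwards no ε-action
-- is left to delete.
lemma isObjective_ret [Finite S] (hB : ∀ q, B.eps q ⊆ B.accComp) :
    (M.product D B).IsObjective (fun c => if c ∈ M.epsPairs D B then 0 else M.R c.1.1)
      (fun c => if c ∈ M.epsPairs D B then 1 else M.γ) (M.retFun D B) where
  toIsPathFun := ((MDP.isPathFun_ret M.toMDP).comp_map
    (fun c : Σ x, (M.product D B).act x => c.1.1)).comp_dropFirst _
  recursion ρ hρ := by
    have hcons : ρ = pathCons (ρ 0) (fun t => ρ (t + 1)) := by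
      funext t
      cases t <;> rfl
    by_cases h : ρ 0 ∈ M.epsPairs D B
    · simp only [if_pos h, zero_add, one_mul, retFun]
      conv_lhs => rw [hcons]
      change M.ret (fun t => (dropFirst (M.epsPairs D B)
        (pathCons (ρ 0) fun t => ρ (t + 1)) t).1.1) = _
      have hdrop : M.dropPath D B (fun t => ρ (t + 1)) = fun t => (ρ (t + 1)).1.1 := by
        unfold dropPath
        rw [dropFirst_eq_self]
        exact fun i => notMem_epsPairs_of_lt hB hρ h (Nat.succ_pos i)
      rw [dropFirst_cons_of_mem h, hdrop]
    · simp only [if_neg h, retFun]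
      conv_lhs => rw [hcons]
      change M.ret (fun t => (dropFirst (M.epsPairs D B)
        (pathCons (ρ 0) fun t => ρ (t + 1)) t).1.1) = _
      rw [dropFirst_cons_of_notMem h, MDP.ret_eq_add]
      rfl

end LabeledMDP

instance {S A : Type} {M : MDP S A} (π : FinMemPolicy M) : Finite π.Mode := π.finite_mode

namespace LabeledMDP

variable {S A AP Qs Qb : Type} {M : LabeledMDP S A AP} {D : SafetyAutomaton Qs AP}
  {B : LDBA Qb AP}

/-! ### Comparing chains on the product with chains on `M` -/

section Compare

variable [Finite S]

/-- The law of the induced path under a chain that simulates the product, in terms of a chain `W`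
without `ε`-actions. -/
lemma chainExp_dropPath (hB : ∀ q, B.eps q ⊆ B.accComp) (C : Sim (M.product D B))
    {W : Type} [Finite W] {stepW : W → PMF W} (oW : W → S) (Λ : W → PMF C.Z)
    (hΛ : ∀ w, ∀ z ∈ (Λ w).support, C.f z ∉ M.epsPairs D B ∧ (C.f z).1.1 = oW w)
    (hstep : ∀ w, (Λ w).bind (skipStep (C.f ⁻¹' M.epsPairs D B) C.step) = (stepW w).bind Λ)
    (init : PMF C.Z) (initW : PMF W)
    (hinit : init.bind (skipRes (C.f ⁻¹' M.epsPairs D B) C.step) = initW.bind Λ)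
    {F : (ℕ → S) → ℝ} (hF : IsPathFun F) :
    chainExp initW stepW (fun ρ => F (fun t => oW (ρ t))) =
      chainExp init C.step (fun ρ => F (M.dropPath D B (fun t => C.f (ρ t)))) := by
  have hN : ∀ z ∈ {z | (C.f z).1 ∈ M.accCompStates D B}, ∀ z' ∈ (C.step z).support,
      z' ∈ {z | (C.f z).1 ∈ M.accCompStates D B} := fun z hz z' hz' =>
    accComp_succ hz (C.fst_mem_support hz')
  have hNskip : ∀ z ∈ {z | (C.f z).1 ∈ M.accCompStates D B},
      z ∉ C.f ⁻¹' M.epsPairs D B := fun z hz => notMem_epsPairs_of_accComp hz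
  have hskip : ∀ z ∈ C.f ⁻¹' M.epsPairs D B, ∀ z' ∈ (C.step z).support,
      z' ∈ {z | (C.f z).1 ∈ M.accCompStates D B} := fun z hz z' hz' =>
    eps_succ hB hz (C.fst_mem_support hz')
  have h1 := chainExp_intertwine oW (fun z => (C.f z).1.1) _ _ hN hNskip hskip Λ hΛ hstep initW hF
  rw [h1, ← hinit, chainExp_skipRes _ _ hN hNskip hskip init
    (hF.comp_map (fun z => (C.f z).1.1))]
  -- It remains to see that deleting in the chain commutes with mapping to state-action pairs.
  refine congrArg _ (funext fun ρ => congrArg F (funext fun t => ?_))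
  unfold dropPath dropFirst
  split_ifs with h2 h3 h3
  · rfl
  · exact absurd h2 h3
  · exact absurd h3 h2
  · rfl

/-- The paths of a chain that start in the initial state of the product. -/
lemma isPath_init (C : Sim (M.product D B)) {init : PMF C.Z}
    (hinit : ∀ z ∈ init.support, (C.f z).1 = (M.product D B).init) {ρ : ℕ → C.Z}
    (h0 : ρ 0 ∈ init.support) (hρ : IsRun C.step ρ) :
    (M.product D B).IsPath (fun t => C.f (ρ t)) ∧ (C.f (ρ 0)).1 = (M.product D B).init :=
  ⟨C.isPath_of_isRun hρ, hinit _ h0⟩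

/-- The indicator function of the paths whose labels satisfy a formula. -/
def satFun (M : LabeledMDP S A AP) (f : LTL AP) : (ℕ → S) → ℝ :=
  {ρ : ℕ → S | f.Sat (fun t => M.L (ρ t))}.indicator 1

lemma measurableSet_sat (M : LabeledMDP S A AP) (f : LTL AP) :
    @MeasurableSet _ (pathSpace S) {ρ : ℕ → S | f.Sat (fun t => M.L (ρ t))} :=
  measurable_path_comp M.L (measurableSet_ltl f)

lemma isPathFun_sat (M : LabeledMDP S A AP) (f : LTL AP) : IsPathFun (M.satFun f) :=
  isPathFun_indicator (measurableSet_sat M f)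

lemma prob_eq_chainExp (π : FinMemPolicy M.toMDP) (f : LTL AP) :
    π.prob {ρ | f.Sat (fun t => M.L (ρ t))} =
      chainExp π.chainInit π.chainStep (fun c => M.satFun f (fun t => (c t).1)) :=
  chainProb_eq_chainExp (measurable_path_comp Prod.fst (measurableSet_sat M f))

variable (C : Sim (M.product D B)) {init : PMF C.Z}

lemma chainExp_safe (hB : ∀ q, B.eps q ⊆ B.accComp) {ψ : LTL AP} (hD : D.Recognizes ψ)
    (hinit : ∀ z ∈ init.support, (C.f z).1 = (M.product D B).init) :
    chainExp init C.step (fun ρ => M.satFun ψ (M.dropPath D B (fun t => C.f (ρ t)))) =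
      chainExp init C.step
        (fun ρ => (M.safeEvent D B).indicator 1 (fun t => C.f (ρ t))) := by
  refine chainExp_congr fun ρ h0 hρ => ?_
  obtain ⟨h1, h2⟩ := isPath_init C hinit h0 hρ
  have h3 := accepts_iff_safe hB h1 h2
  rw [hD, inducedPath_eq_dropPath hB h1] at h3
  unfold satFun
  by_cases h : (fun t => C.f (ρ t)) ∈ M.safeEvent D B
  · rw [Set.indicator_of_mem h, Set.indicator_of_mem (by exact h3.2 h)]; rfl
  · rw [Set.indicator_of_notMem h, Set.indicator_of_notMem (by exact mt h3.1 h)]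

lemma chainExp_buchi_le (hB : ∀ q, B.eps q ⊆ B.accComp) {φ : LTL AP} (hφ : B.Recognizes φ)
    (hinit : ∀ z ∈ init.support, (C.f z).1 = (M.product D B).init) :
    chainExp init C.step (fun ρ => (M.buchiEvent D B).indicator 1 (fun t => C.f (ρ t))) ≤
      chainExp init C.step (fun ρ => M.satFun φ (M.dropPath D B (fun t => C.f (ρ t)))) := by
  have hd : IsPathFun (fun ρ : ℕ → C.Z =>
      M.satFun φ (M.dropPath D B (fun t => C.f (ρ t)))) :=
    (((isPathFun_sat M φ).comp_map
      (fun c : Σ x, (M.product D B).act x => c.1.1)).comp_dropFirst _).comp_map C.f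
  have hb : IsPathFun (fun ρ : ℕ → C.Z =>
      (M.buchiEvent D B).indicator 
        (1 : (ℕ → Σ x, (M.product D B).act x) → ℝ) (fun t => C.f (ρ t))) :=
    (isPathFun_indicator (measurableSet_buchiSet (M := M.product D B)
      {x | x.2.2 ∈ B.acc})).comp_map C.f
  refine chainExp_mono hb hd fun ρ h0 hρ => ?_
  obtain ⟨h1, h2⟩ := isPath_init C hinit h0 hρ
  by_cases h : (fun t => C.f (ρ t)) ∈ M.buchiEvent D B
  · have h3 := accepts_of_buchi h1 h2 h
    rw [hφ, inducedPath_eq_dropPath hB h1] at h3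
    rw [Set.indicator_of_mem h]
    unfold satFun
    rw [Set.indicator_of_mem (by exact h3)]
    rfl
  · rw [Set.indicator_of_notMem h]
    exact indicator_one_nonneg _ _

end Compare

end LabeledMDP

/-! ### Conditional laws and the path law of the induced policy. -/

lemma PMF.bind_congr_support {α β : Type} (p : PMF α) {f g : α → PMF β}
    (h : ∀ a ∈ p.support, f a = g a) : p.bind f = p.bind g := by
  ext y
  simp only [PMF.bind_apply]
  refine tsum_congr fun a => ?_
  by_cases ha : a ∈ p.support
  · rw [h a ha]
  · rw [(p.apply_eq_zero_iff a).2 ha, zero_mul, zero_mul]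

/-- Drawing again from the conditional law given a set, whenever the first draw lies in this set,
does not change the law. -/
lemma PMF.bind_ite_filter {α β : Type} [Finite α] (p : PMF α) (s : Set α)
    [DecidablePred (· ∈ s)] (h : ∃ a ∈ s, a ∈ p.support) (H G : α → PMF β) :
    p.bind (fun a => if a ∈ s then H a else G a) =
      p.bind (fun a => if a ∈ s then (p.filter s h).bind H else G a) := by
  have := Fintype.ofFinite α
  ext y
  set c : ENNReal := ∑ a, s.indicator p a with hc
  have hc0 : c ≠ 0 := by
    obtain ⟨a, has, ha⟩ := h
    intro h0
    have := (Finset.sum_eq_zero_iff.1 h0) a (Finset.mem_univ a)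
    rw [Set.indicator_of_mem has] at this
    exact ha this
  have hct : c ≠ ⊤ := by
    refine ENNReal.sum_ne_top.2 fun a _ => ne_top_of_le_ne_top (p.apply_ne_top a) ?_
    exact Set.indicator_apply_le' (fun _ => le_rfl) (fun _ => zero_le)
  have hF : (p.filter s h).bind H y = c⁻¹ * ∑ a, s.indicator p a * H a y := by
    rw [PMF.bind_apply, tsum_fintype, Finset.mul_sum]
    refine Finset.sum_congr rfl fun a _ => ?_
    rw [PMF.filter_apply, tsum_fintype, ← hc]
    ring
  have hsplit : ∀ K : α → PMF β, (p.bind fun a => if a ∈ s then K a else G a) y =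
      (∑ a, s.indicator p a * K a y) + ∑ a, sᶜ.indicator p a * G a y := by
    intro K
    rw [PMF.bind_apply, tsum_fintype, ← Finset.sum_add_distrib]
    refine Finset.sum_congr rfl fun a _ => ?_
    by_cases ha : a ∈ s <;> simp [ha]
  rw [hsplit, hsplit]
  congr 1
  rw [← Finset.sum_mul, ← hc, hF, ← mul_assoc, ENNReal.mul_inv_cancel hc0 hct, one_mul]

namespace LabeledMDP

variable {S A AP Qs Qb : Type} {M : LabeledMDP S A AP} {D : SafetyAutomaton Qs AP}
  {B : LDBA Qb AP}

/-- An action of `M` as an action of the product. -/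
def liftPair (M : LabeledMDP S A AP) (D : SafetyAutomaton Qs AP) (B : LDBA Qb AP)
    (x : S × Qs × Qb) (a : M.act x.1) : Σ x, (M.product D B).act x :=
  ⟨x, ⟨Sum.inl a.1, a.2⟩⟩

lemma liftPair_notMem (x : S × Qs × Qb) (a : M.act x.1) :
    M.liftPair D B x a ∉ M.epsPairs D B := by
  simp [liftPair, epsPairs]

lemma chainStep_liftPair (σ : MemorylessPolicy (M.product D B)) (x : S × Qs × Qb)
    (a : M.act x.1) :
    MemorylessPolicy.chainStep σ (M.liftPair D B x a) =
      (M.P x.1 a).bind fun s' => (σ (s', D.step x.2.1 (M.L x.1), B.step x.2.2 (M.L x.1))).map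
        (Sigma.mk (s', D.step x.2.1 (M.L x.1), B.step x.2.2 (M.L x.1))) := by
  change ((M.P x.1 a).map _).bind _ = _
  rw [PMF.bind_map]
  rfl

section Induced

variable [Finite S] [Finite A] [Finite Qs] [Finite Qb]

lemma realAct_map_lift (σ : MemorylessPolicy (M.product D B)) (x : S × Qs × Qb)
    (h : ∃ b ∈ {b : (M.product D B).act x | b.1.isLeft = true}, b ∈ (σ x).support) :
    (realAct σ x).map (M.liftPair D B x) =
      ((σ x).filter {b | b.1.isLeft = true} h).bind fun b => PMF.pure ⟨x, b⟩ := by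
  rw [realAct, dif_pos h, PMF.map_comp, ← PMF.bind_pure_comp]
  refine PMF.bind_congr_support _ fun b hb => ?_
  obtain ⟨hb, -⟩ := (PMF.mem_support_filter_iff _).1 hb
  obtain ⟨a | q, hb'⟩ := b
  · rfl
  · simp at hb

/-- No ε-action is available here, so the conditioning in `realAct` is vacuous. -/
lemma realAct_map_lift_of_accComp (σ : MemorylessPolicy (M.product D B)) {x : S × Qs × Qb}
    (hx : x ∈ M.accCompStates D B) :
    (realAct σ x).map (M.liftPair D B x) = (σ x).map (Sigma.mk x) := by
  classical
  have hall : ∀ b : (M.product D B).act x, b ∈ {b : (M.product D B).act x | b.1.isLeft = true} :=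
    fun b => notMem_epsPairs_iff.1 (notMem_epsPairs_of_accComp (c := ⟨x, b⟩) hx)
  have h : ∃ b ∈ {b : (M.product D B).act x | b.1.isLeft = true}, b ∈ (σ x).support := by
    obtain ⟨b, hb⟩ := (σ x).support_nonempty
    exact ⟨b, hall b, hb⟩
  have h1 := PMF.bind_ite_filter (σ x) _ h
    (fun b => PMF.pure (⟨x, b⟩ : Σ x, (M.product D B).act x))
    (fun b => PMF.pure (⟨x, b⟩ : Σ x, (M.product D B).act x))
  simp only [hall, if_true, PMF.bind_const] at h1
  rw [realAct_map_lift σ x h, ← h1, ← PMF.bind_pure_comp]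
  rfl

/-- Resolving the `ε`-action in a product state, and then drawing the action of `M`. -/
lemma entry_skipRes (hB : ∀ q, B.eps q ⊆ B.accComp) (σ : MemorylessPolicy (M.product D B))
    (x : S × Qs × Qb) :
    ((σ x).map (Sigma.mk x)).bind
        (skipRes (M.epsPairs D B) (MemorylessPolicy.chainStep σ)) =
      ((resolveEps σ x).map fun q => (x.1, x.2.1, q)).bind fun w =>
        (realAct σ w).map (M.liftPair D B w) := by
  set Λ : S × Qs × Qb → PMF (Σ x, (M.product D B).act x) := fun w =>
    (realAct σ w).map (M.liftPair D B w) with hΛ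
  rw [resolveEps, PMF.map_comp, PMF.bind_map, PMF.bind_map]
  set s : Set ((M.product D B).act x) := {b | b.1.isLeft = true} with hs
  set G : (M.product D B).act x → PMF (Σ x, (M.product D B).act x) := fun b =>
    Λ (x.1, x.2.1, Sum.elim (fun _ => x.2.2) (fun q => q) b.1) with hG
  have h1 : ∀ b : (M.product D B).act x,
      skipRes (M.epsPairs D B) (MemorylessPolicy.chainStep σ) ⟨x, b⟩ =
        if b ∈ s then PMF.pure ⟨x, b⟩ else G b := by
    rintro ⟨a | q, hb⟩
    · rw [skipRes, if_neg (by simp [epsPairs]), if_pos (by simp [hs])]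
    · rw [skipRes, if_pos (by simp [epsPairs]), if_neg (by simp [hs])]
      have hq : q ∈ B.eps x.2.2 := hb
      have h2 : ((x.1, x.2.1, q) : S × Qs × Qb) ∈ M.accCompStates D B := hB _ hq
      refine (PMF.pure_bind _ _).trans ?_
      exact (realAct_map_lift_of_accComp σ h2).symm
  have h2 : ∀ b ∈ s, G b = Λ x := by
    rintro ⟨a | q, hb⟩ hbs
    · rfl
    · simp [hs] at hbs
  -- If `σ` takes actions of `M` with positive probability, redrawing from the conditional law
  -- changes nothing. Otherwise an ε-action is certain, and the default in `realAct` at `x` is never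
  -- used.
  by_cases h : ∃ b ∈ s, b ∈ (σ x).support
  · have h3 := PMF.bind_ite_filter (σ x) s h
      (fun b => PMF.pure (⟨x, b⟩ : Σ x, (M.product D B).act x)) G
    have h4 : (((σ x).filter s h).bind fun b =>
        PMF.pure (⟨x, b⟩ : Σ x, (M.product D B).act x)) = Λ x :=
      (realAct_map_lift σ x h).symm
    rw [h4] at h3
    refine Eq.trans (congrArg _ (funext h1)) (h3.trans (congrArg _ (funext fun b => ?_)))
    by_cases hb : b ∈ s
    · rw [if_pos hb, ← h2 b hb]; rfl
    · rw [if_neg hb]; rfl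
  · refine PMF.bind_congr_support _ fun b hb => ?_
    refine (h1 b).trans ?_
    rw [if_neg fun hbs => h ⟨b, hbs, hb⟩]
    rfl

/-- The law of the path of `M` under the induced policy. -/
theorem chainExp_inducedPolicy (hB : ∀ q, B.eps q ⊆ B.accComp)
    (σ : MemorylessPolicy (M.product D B)) {F : (ℕ → S) → ℝ} (hF : IsPathFun F) :
    chainExp (inducedPolicy σ).chainInit (inducedPolicy σ).chainStep
        (fun c => F (fun t => (c t).1)) =
      chainExp (MemorylessPolicy.chainInit σ) (MemorylessPolicy.chainStep σ)
        (fun ρ => F (M.dropPath D B ρ)) := by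
  -- An intermediate chain: product states with the ε-choice already resolved. It is intertwined
  -- with the product chain and with the chain of the induced policy.
  set stepW : S × Qs × Qb → PMF (S × Qs × Qb) := fun w =>
    (realAct σ w).bind fun a => (M.P w.1 a).bind fun s' =>
      (resolveEps σ (s', D.step w.2.1 (M.L w.1), B.step w.2.2 (M.L w.1))).map fun q =>
        (s', D.step w.2.1 (M.L w.1), q) with hstepW
  set initW : PMF (S × Qs × Qb) :=
    (resolveEps σ (M.product D B).init).map fun q => (M.init, D.init, q) with hinitW
  set Λ : S × Qs × Qb → PMF (Σ x, (M.product D B).act x) := fun w =>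
    (realAct σ w).map (M.liftPair D B w) with hΛ
  have hstep : ∀ w, (Λ w).bind (skipStep (M.epsPairs D B) (MemorylessPolicy.chainStep σ)) =
      (stepW w).bind Λ := by
    intro w
    rw [hΛ, PMF.bind_map, hstepW]
    simp only [PMF.bind_bind]
    refine congrArg _ (funext fun a => ?_)
    rw [Function.comp_apply, skipStep, chainStep_liftPair, PMF.bind_bind]
    exact congrArg _ (funext fun s' => entry_skipRes hB σ _)
  have h1 := chainExp_dropPath hB (memSim σ) (stepW := stepW) (fun w => w.1) Λ
    (by
      intro w z hz
      obtain ⟨a, -, rfl⟩ := (PMF.mem_support_map_iff _ _ _).1 hz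
      exact ⟨liftPair_notMem w a, rfl⟩)
    hstep (MemorylessPolicy.chainInit σ) initW (entry_skipRes hB σ (M.product D B).init) hF
  refine Eq.trans ?_ h1
  let Conf : Type := S × ((Qs × Qb) × (Qs × Qb))
  -- The second component of the mode is a function of the state and the first component, so
  -- configurations are encoded deterministically.
  let conf : S × Qs × Qb → Conf := fun w =>
    (w.1, ((w.2.1, w.2.2), (D.step w.2.1 (M.L w.1), B.step w.2.2 (M.L w.1))))
  let stepP : Conf → PMF Conf := (inducedPolicy σ).chainStep
  have hstepP : ∀ w, (PMF.pure (conf w)).bind stepP =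
      (stepW w).bind fun w => PMF.pure (conf w) := by
    intro w
    rw [PMF.pure_bind]
    simp only [hstepW, PMF.bind_bind]
    have h : stepP (conf w) = (realAct σ w).bind fun a => (M.P w.1 a).bind fun s' =>
        ((resolveEps σ (s', D.step w.2.1 (M.L w.1), B.step w.2.2 (M.L w.1))).map fun q =>
          (((D.step w.2.1 (M.L w.1), q), (D.step (D.step w.2.1 (M.L w.1)) (M.L s'),
            B.step q (M.L s'))) : (Qs × Qb) × (Qs × Qb))).map fun m => (s', m) := rfl
    rw [h]
    refine congrArg _ (funext fun a => congrArg _ (funext fun s' => ?_))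
    rw [PMF.map_comp, PMF.bind_map]
    rfl
  have hinit : ((inducedPolicy σ).chainInit : PMF Conf) =
      initW.bind fun w => PMF.pure (conf w) := by
    have h : ((inducedPolicy σ).chainInit : PMF Conf) =
        ((resolveEps σ (M.product D B).init).map fun q =>
          (((D.init, q), (D.step D.init (M.L M.init),
            B.step q (M.L M.init))) : (Qs × Qb) × (Qs × Qb))).map fun m => (M.init, m) := rfl
    rw [h, hinitW, PMF.map_comp, PMF.bind_map]
    rfl
  have h2 := chainExp_intertwine' (stepW := stepW) (stepZ := stepP)
    (fun w => w.1) Prod.fst (fun w => PMF.pure (conf w))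
    (fun w z hz => by rw [(PMF.mem_support_pure_iff _ _).1 hz]) hstepP initW hF
  rw [← hinit] at h2
  exact h2.symm

end Induced

end LabeledMDP

namespace LabeledMDP

variable {S A AP Qs Qb : Type} {M : LabeledMDP S A AP}

/-! ### Finite-memory policies of `M` as chains on the product -/

/-- The Markov chain of a finite-memory policy as a labelled MDP with a single action. A state
consists of a state of `M` and the mode before the visit to this state. -/
def policyMDP (π : FinMemPolicy M.toMDP) : LabeledMDP (S × π.Mode) Unit AP where
  init := (M.init, π.m₀)
  act _ := Set.univ
  act_nonempty _ := Set.univ_nonempty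
  P c _ := (π.T c.2 c.1).bind fun m => (π.choose m c.1).bind fun a =>
    (M.P c.1 a).map fun s' => (s', m)
  R _ := 0
  γ := 0
  γ_nonneg := le_rfl
  γ_lt_one := one_pos
  L c := M.L c.1

/-- The only policy of `policyMDP`. -/
def policyMDPPolicy (π : FinMemPolicy M.toMDP) : FinMemPolicy (policyMDP π).toMDP where
  Mode := Unit
  finite_mode := inferInstance
  m₀ := ()
  T _ _ := PMF.pure ()
  choose _ _ := PMF.pure ⟨(), trivial⟩

/-- Both laws are compared with the chain that records the mode before the visit; drawing the mode
switch recovers the configurations of `π`. -/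
lemma chainExp_policyMDP [Finite S] (π : FinMemPolicy M.toMDP) {F : (ℕ → S) → ℝ}
    (hF : IsPathFun F) :
    chainExp (policyMDPPolicy π).chainInit (policyMDPPolicy π).chainStep
        (fun c => F (fun t => (c t).1.1)) =
      chainExp π.chainInit π.chainStep (fun c => F (fun t => (c t).1)) := by
  let stepW : S × π.Mode → PMF (S × π.Mode) := fun c =>
    (π.T c.2 c.1).bind fun m => (π.choose m c.1).bind fun a =>
      (M.P c.1 a).map fun s' => (s', m)
  have h1 := chainExp_intertwine' (stepW := stepW) (stepZ := π.chainStep) (fun w => w.1) Prod.fst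
    (fun w => (π.T w.2 w.1).map fun m => (w.1, m))
    (fun w z hz => by obtain ⟨m, -, rfl⟩ := (PMF.mem_support_map_iff _ _ _).1 hz; rfl)
    (fun w => by
      rw [PMF.bind_map]
      simp only [stepW, PMF.bind_bind, PMF.bind_map]
      rfl) (PMF.pure (M.init, π.m₀)) hF
  let stepN : (S × π.Mode) × Unit → PMF ((S × π.Mode) × Unit) := (policyMDPPolicy π).chainStep
  have h2 := chainExp_intertwine' (stepW := stepW) (stepZ := stepN) (fun w => w.1)
    (fun c => c.1.1) (fun w => PMF.pure (w, ()))
    (fun w z hz => by rw [(PMF.mem_support_pure_iff _ _).1 hz])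
    (fun w => by
      rw [PMF.pure_bind]
      have h : stepN (w, ()) = (PMF.pure (⟨(), trivial⟩ : (Set.univ : Set Unit))).bind fun _ =>
        (stepW w).bind fun c => (PMF.pure ()).map fun m => (c, m) := rfl
      rw [h, PMF.pure_bind]
      simp only [PMF.pure_map]) (PMF.pure (M.init, π.m₀)) hF
  have h3 : ((policyMDPPolicy π).chainInit : PMF ((S × π.Mode) × Unit)) =
      (PMF.pure (M.init, π.m₀)).bind fun w => PMF.pure (w, ()) := by
    rw [PMF.pure_bind]
    exact PMF.pure_map _ _
  have h4 : π.chainInit = (PMF.pure (M.init, π.m₀)).bind fun w =>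
      (π.T w.2 w.1).map fun m => (w.1, m) := by
    rw [PMF.pure_bind]
    rfl
  rw [← h3] at h2
  rw [← h4] at h1
  exact h2.symm.trans h1

variable {D : SafetyAutomaton Qs AP} {B : LDBA Qb AP}

/-- The product of `policyMDP` with the LDBA. -/
abbrev policyProduct (π : FinMemPolicy M.toMDP) (B : LDBA Qb AP) :
    MDP ((S × π.Mode) × Unit × Qb) (Unit ⊕ Qb) :=
  (policyMDP π).product (SafetyAutomaton.trivial AP) B

variable (M D B) in
/-- The states of the chain on the product of `M` that is built from a finite-memory policy and a
policy of `policyProduct`. -/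
abbrev ResolvedState (π : FinMemPolicy M.toMDP) : Type :=
  (Σ x, (M.product D B).act x) × π.Mode

variable (D) in
/-- An action of `policyProduct` as an action of the product: `ε`-actions are kept, and otherwise
the finite-memory policy switches its mode and draws an action. -/
def resolveAct (π : FinMemPolicy M.toMDP) (x : S × Qs × Qb) (m : π.Mode) :
    (policyProduct π B).act ((x.1, m), (), x.2.2) → PMF (ResolvedState M D B π)
  | ⟨Sum.inr q, h⟩ => PMF.pure (⟨x, ⟨Sum.inr q, h⟩⟩, m)
  | ⟨Sum.inl _, _⟩ => (π.T m x.1).bind fun m' =>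
      (π.choose m' x.1).map fun a => (M.liftPair D B x a, m')

variable (D) in
/-- The choice made when the product enters the state `x`. -/
def resolveEntry (π : FinMemPolicy M.toMDP) (τ : MemorylessPolicy (policyProduct π B))
    (x : S × Qs × Qb) (m : π.Mode) : PMF (ResolvedState M D B π) :=
  (τ ((x.1, m), (), x.2.2)).bind (resolveAct D π x m)

lemma resolveEntry_fst (π : FinMemPolicy M.toMDP) (τ : MemorylessPolicy (policyProduct π B))
    (x : S × Qs × Qb) (m : π.Mode) :
    ∀ z ∈ (resolveEntry D π τ x m).support, z.1.1 = x := by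
  intro z hz
  obtain ⟨⟨a | q, h⟩, -, hz⟩ := (PMF.mem_support_bind_iff _ _ _).1 hz
  · obtain ⟨m', -, hz⟩ := (PMF.mem_support_bind_iff _ _ _).1 hz
    obtain ⟨a, -, rfl⟩ := (PMF.mem_support_map_iff _ _ _).1 hz
    rfl
  · rw [(PMF.mem_support_pure_iff _ _).1 hz]

variable (D) in
/-- Transitions of the chain on the product. -/
def resolveStep (π : FinMemPolicy M.toMDP) (τ : MemorylessPolicy (policyProduct π B))
    (z : ResolvedState M D B π) : PMF (ResolvedState M D B π) :=
  ((M.product D B).P z.1.1 z.1.2).bind fun x' => resolveEntry D π τ x' z.2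

lemma map_eq_pure_of_forall {α β : Type} (p : PMF α) (f : α → β) (b : β)
    (h : ∀ a ∈ p.support, f a = b) : p.map f = PMF.pure b := by
  rw [← PMF.bind_pure_comp, PMF.bind_congr_support p (g := fun _ => PMF.pure b)
    (fun a ha => by rw [Function.comp_apply, h a ha]), PMF.bind_const]

section Finite

variable [Finite S] [Finite A] [Finite Qs] [Finite Qb]

variable (D) in
/-- The chain on the product that is built from a finite-memory policy and a policy of
`policyProduct`. -/
def resolveSim (π : FinMemPolicy M.toMDP) (τ : MemorylessPolicy (policyProduct π B)) :
    Sim (M.product D B) where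
  Z := ResolvedState M D B π
  finite := inferInstance
  step := resolveStep D π τ
  f := Prod.fst
  compat z := by
    rw [resolveStep, PMF.map_bind]
    conv_rhs => rw [← PMF.bind_pure ((M.product D B).P z.1.1 z.1.2)]
    exact congrArg _ (funext fun x' => map_eq_pure_of_forall _ _ _ (resolveEntry_fst π τ x' z.2))

lemma resolveStep_liftPair (π : FinMemPolicy M.toMDP) (τ : MemorylessPolicy (policyProduct π B))
    (x : S × Qs × Qb) (a : M.act x.1) (m : π.Mode) :
    resolveStep D π τ (M.liftPair D B x a, m) = (M.P x.1 a).bind fun s' =>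
      resolveEntry D π τ (s', D.step x.2.1 (M.L x.1), B.step x.2.2 (M.L x.1)) m := by
  change ((M.P x.1 a).map _).bind _ = _
  rw [PMF.bind_map]
  rfl

lemma resolveStep_eps (π : FinMemPolicy M.toMDP) (τ : MemorylessPolicy (policyProduct π B))
    (x : S × Qs × Qb) (q : Qb) (h : (Sum.inr q : A ⊕ Qb) ∈ (M.product D B).act x) (m : π.Mode) :
    resolveStep D π τ (⟨x, ⟨Sum.inr q, h⟩⟩, m) = resolveEntry D π τ (x.1, x.2.1, q) m :=
  PMF.pure_bind _ _

/-- The law of the states of the LDBA is the one in `policyProduct`. -/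
lemma chainExp_resolve_buchi (π : FinMemPolicy M.toMDP)
    (τ : MemorylessPolicy (policyProduct π B)) {F : (ℕ → Qb) → ℝ} (hF : IsPathFun F) :
    chainExp (MemorylessPolicy.chainInit τ) (MemorylessPolicy.chainStep τ)
        (fun ρ => F (fun t => (ρ t).1.2.2)) =
      chainExp (resolveEntry D π τ (M.product D B).init π.m₀) (resolveStep D π τ)
        (fun ρ => F (fun t => (ρ t).1.1.2.2)) := by
  -- The connecting chain is that of `τ` with the state of the safety automaton carried along;
  -- forgetting the latter gives back `τ`, while `Λ` leads to the chain on the product.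
  let Y : Type := Σ y, (policyProduct π B).act y
  let next : Y × Qs → Qs := fun w =>
    Sum.elim (fun _ => D.step w.2 (M.L w.1.1.1.1)) (fun _ => w.2) w.1.2.1
  let stepW : Y × Qs → PMF (Y × Qs) := fun w =>
    (MemorylessPolicy.chainStep τ w.1).map fun y => (y, next w)
  let Λ : Y × Qs → PMF (ResolvedState M D B π) := fun w =>
    resolveAct D π (w.1.1.1.1, w.2, w.1.1.2.2) w.1.1.1.2 w.1.2
  have hentry : ∀ (s : S) (m : π.Mode) (u : Unit) (qs : Qs) (qb : Qb),
      ((τ ((s, m), u, qb)).map fun b => ((⟨((s, m), u, qb), b⟩ : Y), qs)).bind Λ =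
        resolveEntry D π τ (s, qs, qb) m := by
    intro s m u qs qb
    rw [PMF.bind_map]
    rfl
  have hΛ : ∀ w, ∀ z ∈ (Λ w).support, z.1.1.2.2 = w.1.1.2.2 := by
    rintro ⟨⟨⟨⟨s, m⟩, u, qb⟩, ⟨a | q, h⟩⟩, qs⟩ z hz
    · obtain ⟨m', -, hz⟩ := (PMF.mem_support_bind_iff _ _ _).1 hz
      obtain ⟨a, -, rfl⟩ := (PMF.mem_support_map_iff _ _ _).1 hz
      rfl
    · rw [(PMF.mem_support_pure_iff _ _).1 hz]
  have hstep : ∀ w, (Λ w).bind (resolveStep D π τ) = (stepW w).bind Λ := by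
    rintro ⟨⟨⟨⟨s, m⟩, u, qb⟩, ⟨a | q, h⟩⟩, qs⟩
    · have h1 : Λ (⟨((s, m), u, qb), ⟨Sum.inl a, h⟩⟩, qs) = (π.T m s).bind fun m' =>
        (π.choose m' s).map fun a => (M.liftPair D B (s, qs, qb) a, m') := rfl
      have h2 : stepW (⟨((s, m), u, qb), ⟨Sum.inl a, h⟩⟩, qs) =
          ((((π.T m s).bind fun m => (π.choose m s).bind fun a =>
            (M.P s a).map fun s' => (s', m)).map fun c => (c, (), B.step qb (M.L s))).bind
              fun y => (τ y).map (Sigma.mk y)).map fun y => (y, D.step qs (M.L s)) := rfl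
      rw [h1, h2]
      simp only [PMF.bind_bind, PMF.bind_map, PMF.map_bind, PMF.map_comp]
      refine congrArg _ (funext fun m' => congrArg _ (funext fun a => ?_))
      rw [Function.comp_apply, resolveStep_liftPair]
      refine congrArg _ (funext fun s' => ?_)
      refine (hentry s' m' () (D.step qs (M.L s)) (B.step qb (M.L s))).symm.trans ?_
      simp only [Function.comp_apply, PMF.bind_map]
      rfl
    · have h1 : Λ (⟨((s, m), u, qb), ⟨Sum.inr q, h⟩⟩, qs) =
          PMF.pure (⟨(s, qs, qb), ⟨Sum.inr q, h⟩⟩, m) := rfl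
      have h2 : stepW (⟨((s, m), u, qb), ⟨Sum.inr q, h⟩⟩, qs) =
          ((PMF.pure ((s, m), u, q)).bind
              fun y => (τ y).map (Sigma.mk y)).map fun y => (y, qs) := rfl
      rw [h1, h2, PMF.pure_bind, PMF.pure_bind, PMF.map_comp]
      exact (resolveStep_eps π τ (s, qs, qb) q h m).trans (hentry s m u qs q).symm
  let initW : PMF (Y × Qs) := (MemorylessPolicy.chainInit τ).map fun y => (y, D.init)
  have h1 := chainExp_intertwine' (stepW := stepW) (stepZ := resolveStep D π τ)
    (fun w => w.1.1.2.2) (fun z => z.1.1.2.2) Λ hΛ hstep initW hF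
  have h2 := chainExp_intertwine' (stepW := stepW) (stepZ := MemorylessPolicy.chainStep τ)
    (fun w => w.1.1.2.2) (fun y => y.1.2.2) (fun w => PMF.pure w.1)
    (fun w z hz => by rw [(PMF.mem_support_pure_iff _ _).1 hz])
    (fun w => by
      rw [PMF.pure_bind, PMF.bind_map]
      exact (PMF.bind_pure _).symm) initW hF
  have h3 : initW.bind Λ = resolveEntry D π τ (M.product D B).init π.m₀ := by
    refine Eq.trans ?_ (hentry M.init π.m₀ () D.init B.init)
    simp only [initW, MemorylessPolicy.chainInit, PMF.map_comp]
    rfl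
  have h4 : (initW.bind fun w => PMF.pure w.1) = MemorylessPolicy.chainInit τ := by
    rw [PMF.bind_map]
    exact PMF.bind_pure _
  rw [h3] at h1
  rw [h4] at h2
  exact h2.symm.trans h1

/-- The LDBA state in which the next action of `M` is taken. -/
def resolvedComp (π : FinMemPolicy M.toMDP) (τ : MemorylessPolicy (policyProduct π B))
    (x : S × Qs × Qb) (m : π.Mode) : PMF Qb :=
  (τ ((x.1, m), (), x.2.2)).map fun b => Sum.elim (fun _ => x.2.2) (fun q => q) b.1

lemma resolveEntry_of_accComp (π : FinMemPolicy M.toMDP)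
    (τ : MemorylessPolicy (policyProduct π B)) {x : S × Qs × Qb}
    (hx : x ∈ M.accCompStates D B) (m : π.Mode) :
    resolveEntry D π τ x m = (π.T m x.1).bind fun m' =>
      (π.choose m' x.1).map fun a => (M.liftPair D B x a, m') := by
  rw [resolveEntry, PMF.bind_congr_support _ (g := fun _ => (π.T m x.1).bind fun m' =>
      (π.choose m' x.1).map fun a => (M.liftPair D B x a, m')), PMF.bind_const]
  rintro ⟨a | q, h⟩ -
  · rfl
  · have h1 : q ∈ B.eps x.2.2 := h
    rw [B.eps_accComp _ hx] at h1
    exact absurd h1 (Set.notMem_empty q)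

/-- An ε-action leaves the state of `M` and the mode untouched, and the state it enters offers no
further one. So the mode switch and action of `π` are drawn from the same laws with or without it.
-/
lemma resolveEntry_skipRes (hB : ∀ q, B.eps q ⊆ B.accComp) (π : FinMemPolicy M.toMDP)
    (τ : MemorylessPolicy (policyProduct π B)) (x : S × Qs × Qb) (m : π.Mode) :
    (resolveEntry D π τ x m).bind
        (skipRes (Prod.fst ⁻¹' M.epsPairs D B) (resolveStep D π τ)) =
      ((resolvedComp π τ x m).bind fun q => (π.T m x.1).map fun m' =>
        (((x.1, x.2.1, q), m') : (S × Qs × Qb) × π.Mode)).bind fun w =>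
          (π.choose w.2 w.1.1).map fun a => (M.liftPair D B w.1 a, w.2) := by
  rw [resolveEntry, resolvedComp, PMF.bind_bind, PMF.bind_map, PMF.bind_bind]
  refine congrArg _ (funext fun b => ?_)
  obtain ⟨a | q, h⟩ := b
  · change ((π.T m x.1).bind _).bind _ = ((π.T m x.1).map _).bind _
    rw [PMF.bind_bind, PMF.bind_map]
    refine congrArg _ (funext fun m' => ?_)
    rw [PMF.bind_map]
    refine Eq.trans ?_ (PMF.bind_pure_comp (fun a => (M.liftPair D B x a, m')) (π.choose m' x.1))
    refine congrArg _ (funext fun a => ?_)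
    exact if_neg (liftPair_notMem x a)
  · change (PMF.pure _).bind _ = ((π.T m x.1).map _).bind _
    have hq : ((x.1, x.2.1, q) : S × Qs × Qb) ∈ M.accCompStates D B :=
      hB x.2.2 (show q ∈ B.eps x.2.2 from h)
    rw [PMF.pure_bind, skipRes, if_pos (by simp [epsPairs])]
    refine (resolveStep_eps π τ x q h m).trans ?_
    rw [resolveEntry_of_accComp π τ hq, PMF.bind_map]
    rfl

/-- The law of the induced path is the law of the path under the finite-memory policy. -/
lemma chainExp_resolve (hB : ∀ q, B.eps q ⊆ B.accComp) (π : FinMemPolicy M.toMDP)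
    (τ : MemorylessPolicy (policyProduct π B)) {F : (ℕ → S) → ℝ} (hF : IsPathFun F) :
    chainExp π.chainInit π.chainStep (fun c => F (fun t => (c t).1)) =
      chainExp (resolveEntry D π τ (M.product D B).init π.m₀) (resolveStep D π τ)
        (fun ρ => F (M.dropPath D B (fun t => (ρ t).1))) := by
  let W : Type := (S × Qs × Qb) × π.Mode
  let entryW : S × Qs × Qb → π.Mode → PMF W := fun x m =>
    (resolvedComp π τ x m).bind fun q => (π.T m x.1).map fun m' => ((x.1, x.2.1, q), m')
  let stepW : W → PMF W := fun w => (π.choose w.2 w.1.1).bind fun a =>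
    (M.P w.1.1 a).bind fun s' =>
      entryW (s', D.step w.1.2.1 (M.L w.1.1), B.step w.1.2.2 (M.L w.1.1)) w.2
  let Λ : W → PMF (ResolvedState M D B π) := fun w =>
    (π.choose w.2 w.1.1).map fun a => (M.liftPair D B w.1 a, w.2)
  have hstep : ∀ w, (Λ w).bind (skipStep (Prod.fst ⁻¹' M.epsPairs D B) (resolveStep D π τ)) =
      (stepW w).bind Λ := by
    intro w
    simp only [Λ, stepW, PMF.bind_map, PMF.bind_bind]
    refine congrArg _ (funext fun a => ?_)
    rw [Function.comp_apply, skipStep, resolveStep_liftPair, PMF.bind_bind]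
    exact congrArg _ (funext fun s' => resolveEntry_skipRes hB π τ _ _)
  have h1 := chainExp_dropPath hB (resolveSim D π τ) (stepW := stepW) (fun w => w.1.1) Λ
    (by
      intro w z hz
      obtain ⟨a, -, rfl⟩ := (PMF.mem_support_map_iff _ _ _).1 hz
      exact ⟨liftPair_notMem w.1 a, rfl⟩)
    hstep (resolveEntry D π τ (M.product D B).init π.m₀) (entryW (M.product D B).init π.m₀)
    (resolveEntry_skipRes hB π τ _ _) hF
  refine Eq.trans ?_ h1
  -- The mode switch does not depend on the resolved LDBA state, which therefore averages out.
  have hconf : ∀ (x : S × Qs × Qb) (m : π.Mode),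
      ((entryW x m).bind fun w => PMF.pure ((w.1.1, w.2) : S × π.Mode)) =
        (π.T m x.1).map fun m' => (x.1, m') := by
    intro x m
    simp only [entryW, PMF.bind_bind, PMF.bind_map]
    refine Eq.trans ?_ (PMF.bind_const (resolvedComp π τ x m) _)
    refine congrArg _ (funext fun q => ?_)
    exact PMF.bind_pure_comp (fun m' => (x.1, m')) (π.T m x.1)
  have h2 := chainExp_intertwine' (stepW := stepW) (stepZ := π.chainStep)
    (fun w => w.1.1) Prod.fst (fun w => PMF.pure (w.1.1, w.2))
    (fun w z hz => by rw [(PMF.mem_support_pure_iff _ _).1 hz])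
    (fun w => by
      rw [PMF.pure_bind]
      simp only [stepW, PMF.bind_bind]
      refine congrArg _ (funext fun a => congrArg _ (funext fun s' => ?_))
      exact (hconf (s', D.step w.1.2.1 (M.L w.1.1), B.step w.1.2.2 (M.L w.1.1)) w.2).symm)
      (entryW (M.product D B).init π.m₀) hF
  rw [hconf] at h2
  exact h2.symm

end Finite

end LabeledMDP

/-! ### Lexicographic optimality -/

section Lexicographic

variable {S A : Type} [Finite S] [Finite A] {M : MDP S A}

lemma exists_univ_act (M : MDP S A) (s : S) :
    ∃ b, (⟨s, b⟩ : Σ s, M.act s) ∈ (Set.univ : Set (Σ s, M.act s)) :=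
  ⟨⟨_, (M.act_nonempty s).some_mem⟩, trivial⟩

variable (M) in
/-- The actions that preserve the optimal probability of staying in `G`. -/
def safeActs (G : Set S) : Set (Σ s, M.act s) := simPres Set.univ ((safeSet M G).indicator 1)

variable (M) in
/-- Among these, the actions that preserve the optimal probability of visiting `acc` infinitely
often. -/
def buchiActs (G acc : Set S) : Set (Σ s, M.act s) :=
  simPres (safeActs M G) ((buchiSet M acc).indicator 1)

lemma exists_safeActs {G : Set S} (hG : M.Absorbing G) (s : S) :
    ∃ b, (⟨s, b⟩ : Σ s, M.act s) ∈ safeActs M G :=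
  exists_mem_simPres (exists_univ_act M) (isObjective_safe hG) s

lemma exists_buchiActs {G : Set S} (hG : M.Absorbing G) (acc : Set S) (s : S) :
    ∃ b, (⟨s, b⟩ : Σ s, M.act s) ∈ buchiActs M G acc :=
  exists_mem_simPres (exists_safeActs hG) (isObjective_buchi acc) s

variable {Act : Set (Σ s, M.act s)} {F : (ℕ → Σ s, M.act s) → ℝ} {C : Sim M} {init : PMF C.Z}
  {s : S}

lemma chainExp_sim_eq_mean (hF : IsPathFun F) (C : Sim M) (init : PMF C.Z) :
    chainExp init C.step (fun ρ => F (fun t => C.f (ρ t))) = init.mean (C.E F) :=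
  chainExp_eq_mean (hF.comp_map C.f)

lemma chainExp_le_simVal (hF : IsPathFun F) (hinit : ∀ z ∈ init.support, (C.f z).1 = s)
    (hall : ∀ z ∈ init.support, C.Allowed Act z) :
    chainExp init C.step (fun ρ => F (fun t => C.f (ρ t))) ≤ simVal Act F s := by
  rw [chainExp_sim_eq_mean hF]
  exact PMF.mean_le _ fun z hz => hinit z hz ▸ E_le_simVal hF (hall z hz)

/-- The expectation averages over initial chain states, each bounded by the value; reaching the
bound makes each of positive probability optimal, so `allowed_simPres` applies. -/
lemma allowed_of_chainExp_ge (hAct : ∀ s, ∃ b, (⟨s, b⟩ : Σ s, M.act s) ∈ Act)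
    (hF : M.IsObjective (fun _ => 0) (fun _ => 1) F)
    (hinit : ∀ z ∈ init.support, (C.f z).1 = s) (hall : ∀ z ∈ init.support, C.Allowed Act z)
    (hopt : simVal Act F s ≤ chainExp init C.step (fun ρ => F (fun t => C.f (ρ t)))) :
    ∀ z ∈ init.support, C.Allowed (simPres Act F) z := by
  intro z hz
  refine allowed_simPres hAct hF (hall z hz) ?_
  rw [chainExp_sim_eq_mean hF.toIsPathFun] at hopt
  have h := PMF.eq_of_mean_le init (f := C.E F) (g := fun _ => simVal Act F s)
    (fun z hz => hinit z hz ▸ E_le_simVal hF.toIsPathFun (hall z hz))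
    (by rw [PMF.mean_const]; exact hopt) z hz
  rw [hinit z hz]
  exact h.ge

/-- Optimality bounds for chains that start in `s`. -/
theorem lexicographic_bounds {G acc : Set S} (hG : M.Absorbing G) (hF : IsPathFun F)
    (hinit : ∀ z ∈ init.support, (C.f z).1 = s) :
    let e : ((ℕ → Σ s, M.act s) → ℝ) → ℝ := fun F =>
      chainExp init C.step (fun ρ => F (fun t => C.f (ρ t)))
    let V := simVal Set.univ ((safeSet M G).indicator 1) s
    let W := simVal (safeActs M G) ((buchiSet M acc).indicator 1) s
    let U := simVal (buchiActs M G acc) F s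
    e ((safeSet M G).indicator 1) ≤ V ∧
      (V ≤ e ((safeSet M G).indicator 1) → e ((buchiSet M acc).indicator 1) ≤ W ∧
        (W ≤ e ((buchiSet M acc).indicator 1) → e F ≤ U)) := by
  intro e V W U
  have hs := isObjective_safe hG
  have hb := isObjective_buchi (M := M) acc
  have h0 : ∀ z ∈ init.support, C.Allowed Set.univ z := fun _ _ _ _ => trivial
  refine ⟨chainExp_le_simVal hs.toIsPathFun hinit h0, fun hV => ?_⟩
  have h1 := allowed_of_chainExp_ge (exists_univ_act M) hs hinit h0 hV
  refine ⟨chainExp_le_simVal hb.toIsPathFun hinit h1, fun hW => ?_⟩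
  exact chainExp_le_simVal hF hinit (allowed_of_chainExp_ge (exists_safeActs hG) hb hinit h1 hW)

/-- Memoryless policies that attain the optimal probabilities and nearly the optimal return. -/
theorem exists_policy_lexicographic {G acc : Set S} (hG : M.Absorbing G)
    {r g : (Σ s, M.act s) → ℝ} (hF : M.IsObjective r g F) {γ : ℝ} (hγ0 : 0 ≤ γ) (hγ1 : γ < 1)
    (N : Set S)
    (hN : ∀ c : Σ s, M.act s, c.1 ∈ N →
      g c = γ ∧ ∀ s' ∈ (M.P c.1 c.2).support, s' ∈ N)
    (hg : ∀ c, g c = γ ∨ (g c = 1 ∧ ∀ s' ∈ (M.P c.1 c.2).support, s' ∈ N))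
    {ε : ℝ} (hε : 0 < ε) :
    ∃ σ : MemorylessPolicy M,
      memVal σ ((safeSet M G).indicator 1) s =
        simVal Set.univ ((safeSet M G).indicator 1) s ∧
      memVal σ ((buchiSet M acc).indicator 1) s =
        simVal (safeActs M G) ((buchiSet M acc).indicator 1) s ∧
      simVal (buchiActs M G acc) F s ≤ memVal σ F s + ε := by
  obtain ⟨σ, hσ, hσF⟩ := exists_policy_near_simVal (exists_buchiActs hG acc) hF hγ0 hγ1 N hN hg hε
  refine ⟨σ, ?_, ?_, hσF s⟩
  · refine PMF.mean_congr_const _ fun b hb => ?_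
    refine safe_eq_simVal (C := memSim σ) (z := ⟨s, b⟩) hG ?_
    exact memSim_allowed (fun s b hb => ((hσ s b).1 hb).1) ((hσ s b).1 hb).1
  · refine PMF.mean_congr_const _ fun b hb => ?_
    exact buchi_eq_simVal (exists_safeActs hG) acc hσ (c := ⟨s, b⟩) ((hσ s b).1 hb)

end Lexicographic

/-- Lexicographic optimization on two sets: `v` are the objectives on the first set, `u` those on
the second one, and `k` maps the first set to the second one. -/
lemma lexicographic_transfer {α : Type*} {β : Type*} {v₁ v₂ v₃ : α → ℝ} {u₁ u₂ u₃ : β → ℝ}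
    {V W U ν : ℝ} (k : α → β) (hν : 0 < ν)
    (hv : ∀ a, v₁ a ≤ V ∧ (V ≤ v₁ a → v₂ a ≤ W ∧ (W ≤ v₂ a → v₃ a ≤ U)))
    (hopt : ∀ ε > 0, ∃ a, v₁ a = V ∧ v₂ a = W ∧ U ≤ v₃ a + ε)
    (hu : ∀ b, u₁ b ≤ V ∧ (V ≤ u₁ b → u₂ b ≤ W ∧ (W ≤ u₂ b → u₃ b ≤ U)))
    (hk : ∀ a, u₁ (k a) = v₁ a ∧ v₂ a ≤ u₂ (k a) ∧ u₃ (k a) = v₃ a) :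
    (nearArgmaxOn (argmaxOn (argmaxOn Set.univ v₁) v₂) v₃ ν).Nonempty ∧
      ∀ a ∈ nearArgmaxOn (argmaxOn (argmaxOn Set.univ v₁) v₂) v₃ ν,
        k a ∈ nearArgmaxOn (argmaxOn (argmaxOn Set.univ u₁) u₂) u₃ ν := by
  have hmem : ∀ a, v₁ a = V → v₂ a = W → a ∈ argmaxOn (argmaxOn Set.univ v₁) v₂ := by
    intro a h1 h2
    refine ⟨⟨trivial, fun y _ => h1 ▸ (hv y).1⟩, fun y hy => ?_⟩
    rw [h2]
    exact ((hv y).2 (h1 ▸ hy.2 a trivial)).1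
  obtain ⟨a₁, ha₁, ha₁', -⟩ := hopt 1 one_pos
  have hmem' : ∀ a ∈ argmaxOn (argmaxOn Set.univ v₁) v₂, V ≤ v₁ a ∧ W ≤ v₂ a := by
    rintro a ⟨⟨-, h1⟩, h2⟩
    exact ⟨ha₁ ▸ h1 a₁ trivial, ha₁' ▸ h2 a₁ ⟨trivial, fun y _ => ha₁ ▸ (hv y).1⟩⟩
  have hle : ∀ a ∈ argmaxOn (argmaxOn Set.univ v₁) v₂, v₃ a ≤ U := fun a ha =>
    (((hv a).2 (hmem' a ha).1).2 (hmem' a ha).2)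
  have hbdd : BddAbove (v₃ '' argmaxOn (argmaxOn Set.univ v₁) v₂) := by
    refine ⟨U, ?_⟩
    rintro _ ⟨a, ha, rfl⟩
    exact hle a ha
  -- This lower bound on the first side and the upper bound `U` on the second let the ν-gap pass
  -- from `a` to `k a`.
  have hsup : U ≤ sSup (v₃ '' argmaxOn (argmaxOn Set.univ v₁) v₂) := by
    refine le_of_forall_pos_le_add fun ε hε => ?_
    obtain ⟨a, h1, h2, h3⟩ := hopt ε hε
    exact h3.trans (add_le_add (le_csSup hbdd ⟨a, hmem a h1 h2, rfl⟩) le_rfl)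
  constructor
  · obtain ⟨a, h1, h2, h3⟩ := hopt ν hν
    refine ⟨a, hmem a h1 h2, ?_⟩
    have : sSup (v₃ '' argmaxOn (argmaxOn Set.univ v₁) v₂) ≤ U := by
      refine csSup_le ⟨_, a, hmem a h1 h2, rfl⟩ ?_
      rintro _ ⟨a, ha, rfl⟩
      exact hle a ha
    linarith
  · rintro a ⟨ha, haν⟩
    obtain ⟨h1, h2, h3⟩ := hk a
    obtain ⟨h4, h5⟩ := hmem' a ha
    have hsafe : k a ∈ argmaxOn Set.univ u₁ :=
      ⟨trivial, fun b _ => (hu b).1.trans (h1 ▸ h4)⟩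
    have hka : k a ∈ argmaxOn (argmaxOn Set.univ u₁) u₂ := by
      refine ⟨hsafe, fun b hb => ?_⟩
      have h6 : V ≤ u₁ b := (h1 ▸ h4 : V ≤ u₁ (k a)).trans (hb.2 _ trivial)
      -- The inequality for the second objective suffices: `W` bounds all competitors and `k a`
      -- already reaches it.
      exact ((hu b).2 h6).1.trans (h5.trans h2)
    refine ⟨hka, ?_⟩
    have : sSup (u₃ '' argmaxOn (argmaxOn Set.univ u₁) u₂) ≤ U := by
      refine csSup_le ⟨_, k a, hka, rfl⟩ ?_
      rintro _ ⟨b, hb, rfl⟩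
      have h6 : V ≤ u₁ b := (h1 ▸ h4 : V ≤ u₁ (k a)).trans (hb.1.2 _ trivial)
      exact ((hu b).2 h6).2 ((h5.trans h2).trans (hb.2 _ hsafe))
    rw [h3]
    linarith

/-! ### Assembling the comparison between the product and the original MDP. -/

namespace LabeledMDP

variable {S A AP Qs Qb : Type} [Finite S] [Finite A] [Finite Qs] [Finite Qb]
  {M : LabeledMDP S A AP} {D : SafetyAutomaton Qs AP} {B : LDBA Qb AP}

lemma expRetProduct_eq (hB : ∀ q, B.eps q ⊆ B.accComp) (σ : MemorylessPolicy (M.product D B)) :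
    M.expRetProduct D B σ =
      chainExp (MemorylessPolicy.chainInit σ) (MemorylessPolicy.chainStep σ) (M.retFun D B) := by
  refine chainExp_congr fun ρ _ hρ => ?_
  have h : (M.product D B).IsPath ρ := (memSim σ).isPath_of_isRun hρ
  change M.ret (M.inducedPath D B ρ) = M.ret (M.dropPath D B ρ)
  rw [inducedPath_eq_dropPath hB h]

lemma chainInit_fst (σ : MemorylessPolicy (M.product D B)) :
    ∀ c ∈ (MemorylessPolicy.chainInit σ).support, c.1 = (M.product D B).init := by
  intro c hc
  obtain ⟨b, -, rfl⟩ := (PMF.mem_support_map_iff _ _ _).1 hc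
  rfl

/-- The objectives of a finite-memory policy are attained, or exceeded, by a chain on the
product. -/
lemma exists_sim_of_policy {ψ φ : LTL AP} (hD : D.Recognizes ψ) (hφ : B.Recognizes φ)
    (hB : B.Suitable) (π : FinMemPolicy M.toMDP) :
    ∃ (C : Sim (M.product D B)) (init : PMF C.Z),
      (∀ z ∈ init.support, (C.f z).1 = (M.product D B).init) ∧
      π.prob {ρ | ψ.Sat (fun t => M.L (ρ t))} = chainExp init C.step
        (fun ρ => (M.safeEvent D B).indicator 1 (fun t => C.f (ρ t))) ∧
      π.prob {ρ | φ.Sat (fun t => M.L (ρ t))} ≤ chainExp init C.step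
        (fun ρ => (M.buchiEvent D B).indicator 1 (fun t => C.f (ρ t))) ∧
      π.expRet = chainExp init C.step (fun ρ => M.retFun D B (fun t => C.f (ρ t))) := by
  obtain ⟨hB, hgood⟩ := hB
  -- Suitability is applied to the Markov chain of `π`, so `τ` only resolves ε-choices and may look
  -- at the mode of `π`.
  obtain ⟨τ, hτ⟩ := hgood (S × π.Mode) Unit (policyMDP π) (policyMDPPolicy π)
  have hinit : ∀ z ∈ (resolveEntry D π τ (M.product D B).init π.m₀).support,
      ((resolveSim D π τ).f z).1 = (M.product D B).init := resolveEntry_fst π τ _ _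
  refine ⟨resolveSim D π τ, resolveEntry D π τ (M.product D B).init π.m₀, hinit, ?_, ?_, ?_⟩
  · rw [prob_eq_chainExp, chainExp_resolve (D := D) hB π τ (isPathFun_sat M ψ)]
    exact chainExp_safe (resolveSim D π τ) hB hD hinit
  · have h1 : {ρ : ℕ → S × π.Mode | B.Accepts (fun t => (policyMDP π).L (ρ t))} =
        {ρ | φ.Sat (fun t => (policyMDP π).L (ρ t))} := by
      ext ρ
      exact hφ (fun t => (policyMDP π).L (ρ t))
    rw [h1, prob_eq_chainExp] at hτ
    have h2 := chainExp_policyMDP π (isPathFun_sat M φ)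
    rw [prob_eq_chainExp, ← h2]
    refine hτ.trans (le_of_eq ?_)
    have h3 := chainExp_resolve_buchi (D := D) π τ
      (isPathFun_indicator (measurableSet_frequently_coord B.acc))
    refine Eq.trans ?_ h3
    exact chainProb_eq_chainExp (measurableSet_buchiSet (M := policyProduct π B)
      {x | x.2.2 ∈ B.acc})
  · exact chainExp_resolve (D := D) hB π τ (MDP.isPathFun_ret M.toMDP)

/-- The optimal sets of `M` and of the product are related by the induced policy. -/
theorem retNearOptProduct_nonempty_and_inducedPolicy_mem {ψ φ : LTL AP} (hD : D.Recognizes ψ)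
    (hB : B.Recognizes φ) (hBs : B.Suitable) {ν : ℝ} (hν : 0 < ν) :
    (M.retNearOptProduct D B ν).Nonempty ∧
      ∀ σ ∈ M.retNearOptProduct D B ν, inducedPolicy σ ∈ M.retNearOpt ψ φ ν := by
  classical
  have heps := hBs.1
  have hG : (M.product D B).Absorbing {x | x.2.1 ∈ D.acc} := product_absorbing
  have hF := isObjective_ret (M := M) (D := D) heps
  have hsafe := (isObjective_safe hG).toIsPathFun
  have hbuchi := (isObjective_buchi (M := M.product D B) {x | x.2.2 ∈ B.acc}).toIsPathFun
  have hprob : ∀ σ : MemorylessPolicy (M.product D B),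
      MemorylessPolicy.prob σ (M.safeEvent D B) = chainExp (MemorylessPolicy.chainInit σ)
        (MemorylessPolicy.chainStep σ) ((M.safeEvent D B).indicator 1) ∧
      MemorylessPolicy.prob σ (M.buchiEvent D B) = chainExp (MemorylessPolicy.chainInit σ)
        (MemorylessPolicy.chainStep σ) ((M.buchiEvent D B).indicator 1) := fun σ =>
    ⟨chainProb_eq_chainExp (measurableSet_safeSet (M := M.product D B) {x | x.2.1 ∈ D.acc}),
      chainProb_eq_chainExp (measurableSet_buchiSet (M := M.product D B) {x | x.2.2 ∈ B.acc})⟩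
  refine lexicographic_transfer (V := simVal Set.univ ((safeSet (M.product D B)
      {x | x.2.1 ∈ D.acc}).indicator 1) (M.product D B).init)
    (W := simVal (safeActs (M.product D B) {x | x.2.1 ∈ D.acc})
      ((buchiSet (M.product D B) {x | x.2.2 ∈ B.acc}).indicator 1) (M.product D B).init)
    (U := simVal (buchiActs (M.product D B) {x | x.2.1 ∈ D.acc} {x | x.2.2 ∈ B.acc})
      (M.retFun D B) (M.product D B).init) _ hν ?_ ?_ ?_ ?_
  · intro σ
    rw [(hprob σ).1, (hprob σ).2, expRetProduct_eq heps]
    exact lexicographic_bounds (C := memSim σ) (acc := {x | x.2.2 ∈ B.acc}) hG hF.toIsPathFun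
      (chainInit_fst σ)
  · intro ε hε
    -- The closed set without undiscounted actions is the accepting component, entered by every
    -- ε-action.
    obtain ⟨σ, h1, h2, h3⟩ := exists_policy_lexicographic (s := (M.product D B).init)
      (acc := {x | x.2.2 ∈ B.acc}) hG hF M.γ_nonneg M.γ_lt_one (M.accCompStates D B)
      (fun c hc => ⟨if_neg (notMem_epsPairs_of_accComp hc), fun s' hs' => accComp_succ hc hs'⟩)
      (fun c => by
        by_cases hc : c ∈ M.epsPairs D B
        · exact Or.inr ⟨if_pos hc, fun s' hs' => eps_succ heps hc hs'⟩
        · exact Or.inl (if_neg hc)) hε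
    rw [memVal_eq_chainExp σ hsafe] at h1
    rw [memVal_eq_chainExp σ hbuchi] at h2
    rw [memVal_eq_chainExp σ hF.toIsPathFun] at h3
    refine ⟨σ, (hprob σ).1.trans h1, (hprob σ).2.trans h2, ?_⟩
    rw [expRetProduct_eq heps]
    exact h3
  · intro π
    obtain ⟨C, init, hinit, h1, h2, h3⟩ := exists_sim_of_policy hD hB hBs π
    obtain ⟨h4, h5⟩ := lexicographic_bounds (acc := {x | x.2.2 ∈ B.acc}) hG hF.toIsPathFun hinit
    refine ⟨h1.le.trans h4, fun hV => ?_⟩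
    obtain ⟨h6, h7⟩ := h5 (hV.trans h1.le)
    exact ⟨h2.trans h6, fun hW => h3.le.trans (h7 (hW.trans h2))⟩
  · intro σ
    have hinit := chainInit_fst σ
    refine ⟨?_, ?_, ?_⟩
    · rw [prob_eq_chainExp, chainExp_inducedPolicy heps σ (isPathFun_sat M ψ), (hprob σ).1]
      exact chainExp_safe (memSim σ) heps hD hinit
    · rw [prob_eq_chainExp, chainExp_inducedPolicy heps σ (isPathFun_sat M φ), (hprob σ).2]
      exact chainExp_buchi_le (memSim σ) heps hB hinit
    · rw [expRetProduct_eq heps]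
      exact chainExp_inducedPolicy heps σ (MDP.isPathFun_ret M.toMDP)

end LabeledMDP

end

theorem lemma1 {S A AP Qs Qb : Type} [Finite S] [Finite A] [Finite AP] [Finite Qs] [Finite Qb]
    (M : LabeledMDP S A AP) (ψ φ : LTL AP)
    (D : SafetyAutomaton Qs AP) (hD : D.Recognizes ψ)
    (B : LDBA Qb AP) (hB : B.Recognizes φ) (hBs : B.Suitable)
    (ν : ℝ) (hν : 0 < ν) :
    (M.retNearOptProduct D B ν).Nonempty ∧
      ∀ σ ∈ M.retNearOptProduct D B ν,
        LabeledMDP.inducedPolicy σ ∈ M.retNearOpt ψ φ ν :=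
  LabeledMDP.retNearOptProduct_nonempty_and_inducedPolicy_mem hD hB hBs hν
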